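/- **Setting.** Let $\mathcal A$ be a finite alphabet with $d$ letters, $\pi=(\pi_0,\pi_1)$ a pair of bijections $\mathcal A\to\{1,\dots,d\}$ which is irreducible ($\pi_1\circ\pi_0^{-1}\{1,\dots,k\}\ne\{1,\dots,k\}$ for $1\le k<d$), and $\lambda\in\mathbb R_{>0}^{\mathcal A}$. Put $I=[0,|\lambda|)$, $|\lambda|=\sum_\alpha\lambda_\alpha$, $I_\alpha=[l_\alpha,r_\alpha)$ with $l_\alpha=\sum_{\pi_0(\beta)<\pi_0(\alpha)}\lambda_\beta$, $r_\alpha=l_\alpha+\lambda_\alpha$, $m_\alpha=(l_\alpha+r_\alpha)/2$. The interval exchange transformation (IET) $T=T_{(\pi,\lambda)}:I\to I$ is $T(x)=x+w_\alpha$ on $I_\alpha$, where $w=\Omega_\pi\lambda$, with $\Omega_{\alpha\beta}=1$ if $\pi_1(\alpha)>\pi_1(\beta)$, $\pi_0(\alpha)<\pi_0(\beta)$, $\Omega_{\alpha\beta}=-1$ if both inequalities are reversed, and $\Omega_{\alpha\beta}=0$ otherwise; $H(\pi)=\Omega_\pi(\mathbb R^{\mathcal A})$. Keane's condition: $T^ml_\alpha\ne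 l_\beta$ for all $m\ge1$ and all $\alpha,\beta$ with $\pi_0(\beta)\ne1$. Rauzy–Veech induction $\mathcal R(T)=T_{(\tilde\pi,\tilde\lambda)}$: let $\varepsilon=0$ if $\lambda_{\pi_0^{-1}(d)}>\lambda_{\pi_1^{-1}(d)}$ and $\varepsilon=1$ if $<$; $A(T)=\mathrm{Id}+E_{\pi_\varepsilon^{-1}(d)\,\pi_{1-\varepsilon}^{-1}(d)}$ (where $E_{ij}$ is the matrix unit), $\tilde\lambda=A(T)^{-1}\lambda$, $\tilde\pi_\varepsilon=\pi_\varepsilon$, and, with $p=\pi_{1-\varepsilon}\circ\pi_\varepsilon^{-1}(d)$, $\tilde\pi_{1-\varepsilon}(\alpha)$ equals $\pi_{1-\varepsilon}(\alpha)$ if $\pi_{1-\varepsilon}(\alpha)\le p$, $\pi_{1-\varepsilon}(\alpha)+1$ if $p<\pi_{1-\varepsilon}(\alpha)<d$, and $p+1$ if $\pi_{1-\varepsilon}(\alpha)=d$. Put $A^{(n)}(T)=A(T)A(\mathcal RT)\cdots A(\mathcal R^{n-1}T)$. An accelerating sequence is a strictly increasing sequence $(n_k)_{k\ge0}$ of integers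 with $n_0=0$; for it let $T^{(k)}=\mathcal R^{n_k}(T)$, an IET of $I^{(k)}\subset I$ exchanging the intervals $I^{(k)}_\alpha$, $Q(k,l)=A^{(n_l-n_k)}(\mathcal R^{n_k}T)^t$ for $k\le l$, $Q(k)=Q(0,k)$, $Z(k+1)=Q(k,k+1)$, $Q_\alpha(k)=\sum_\beta Q_{\alpha\beta}(k)$. Norms: $\|h\|=\sum_\alpha|h_\alpha|$ for vectors, $\|B\|=\max_\alpha\sum_\beta|B_{\alpha\beta}|$ for matrices. **FDC.** Fix $\gamma\ge1$ and $\lambda_1>\dots>\lambda_\gamma>\lambda_{\gamma+1}=0$. $T$ is *Oseledets generic* if for some accelerating sequence, with corresponding matrices $Q(n)$, there are subspaces $\{0\}=E_0\subset E_{-1}\subset\dots\subset E_{-\gamma}\subset E_{\gamma+1}\subset E_\gamma\subset\dots\subset E_1=\mathbb R^{\mathcal A}$ such that $\lim_n\frac1n\log\|Q(n)h\|$ equals $-\lambda_i$ on $E_{-i}\setminus E_{-i+1}$, $0$ on $E_{\gamma+1}\setminus E_{-\gamma}$, $\lambda_i$ on $E_i\setminus E_{i+1}$, and $\dim E_{-i}-\dim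 E_{-i+1}=\dim E_i-\dim E_{i+1}=1$ ($1\le i\le\gamma$). For $\tau>0$ an accelerating sequence $(n_k)$ is an *FDC-acceleration for $\tau$* if there are $c>0$, $C,\kappa\ge1$, $\delta\in(0,1)$, natural numbers $(r_n)_{n\ge0}$ with $r_0=0$ (write $r(k,l)=\sum_{k\le j<l}r_j$) and subspaces $\{0\}=U_1\subset\dots\subset U_{\gamma+1}\subset H(\pi)$ with $E_j\oplus U_j=\mathbb R^{\mathcal A}$ for $1\le j\le\gamma+1$, such that, with $E_j^{(k)}=Q(k)E_j$, $U_j^{(k)}=Q(k)U_j$, - for every $k\ge1$ there is an integer $0<p_k\le\min_\alpha Q_\alpha(k)$ such that the sets $T^iI^{(k)}$, $0\le i<p_k$, are pairwise disjoint intervals of total length at least $\delta|I|$; - $\lim_n r(0,n)/n$ exists and lies in $(1,1+\tau)$; - $\|Q(k,l)|_{E_j^{(k)}}\|\le Ce^{(\lambda_j+\tau)r(k,l)}$ for $0\le k<l$, $1\le j\le\gamma+1$; - $\|(Q(k,l)|_{U_j^{(k)}})^{-1}\|\le Ce^{(-\lambda_{j-1}+\tau)r(k,l)}$ for $0\le k<l$,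 $2\le j\le\gamma+1$; - $\|Z(k+1)\|\le Ce^{\tau k}$, $\;ce^{\lambda_1k}\le\|Q(k)\|\le Ce^{\lambda_1(1+\tau)k}$ and $\max_\alpha|I^{(k)}|/|I^{(k)}_\alpha|\le\kappa$ for $k\ge0$; - $|\sin\angle(E_j^{(k)},U_j^{(k)})|\ge c\|Q(k)\|^{-\tau}$ for $k\ge0$, $2\le j\le\gamma+1$. $T$ satisfies the *Filtration Diophantine Condition (FDC)* if it satisfies Keane's condition, is Oseledets generic, and has an FDC-acceleration for every $\tau>0$ (with the same $\lambda_i$ and $E_i$). **Function spaces.** For $0<a<1$, $P_aG$ is the space of functions $\varphi$ that are $C^1$ on $\bigcup_\alpha(l_\alpha,r_\alpha)$, such that $|\varphi'(x)|(x-l_\alpha)^{1+a}$ on $(l_\alpha,m_\alpha]$ and $|\varphi'(x)|(r_\alpha-x)^{1+a}$ on $[m_\alpha,r_\alpha)$ are bounded for each $\alpha$, the limits $C_\alpha^+=-\lim_{x\searrow l_\alpha}\varphi'(x)(x-l_\alpha)^{1+a}$ and $C_\alpha^-=\lim_{x\nearrow r_\alpha}\varphi'(x)(r_\alpha-x)^{1+a}$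 exist, and $C^-_{\pi_0^{-1}(d)}C^-_{\pi_1^{-1}(d)}=0=C^+_{\pi_0^{-1}(1)}C^+_{\pi_1^{-1}(1)}$. $\widehat P_a$ is the space of Borel functions $\varphi:I\to\mathbb R$ such that $|\varphi(x)|(x-l_\alpha)^a$ on $(l_\alpha,m_\alpha]$ and $|\varphi(x)|(r_\alpha-x)^a$ on $[m_\alpha,r_\alpha)$ are bounded for each $\alpha$. **Special flow.** Let $g:I\to(0,\infty]$ with $\inf g>0$. On $I^g=\{(x,r):x\in I,\ 0\le r<g(x)\}$ (with Lebesgue measure), $T^g_t(x,r)=(T^nx,\,r+t-g^{(n)}(x))$ where $g^{(n)}=\sum_{0\le i<n}g\circ T^i$ and $g^{(n)}(x)\le r+t<g^{(n+1)}(x)$. For integrable $f:I^g\to\mathbb R$ put $\varphi_f(x)=\int_0^{g(x)}f(x,r)\,dr$, which is defined for a.e. $x\in I$; $\varphi_f\in P_bG$ and $\varphi_{|f|}\in\widehat P_b$ are understood up to equality a.e. Given an accelerating sequence, let $S(k)\varphi(x)=\sum_{0\le i<Q_\alpha(k)}\varphi(T^ix)$ for $x\in I^{(k)}_\alpha$,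 and let $\mathcal M^{(k)}(\psi)\in\mathbb R^{\mathcal A}$ be the vector of the mean values of $\psi$ on the intervals $I^{(k)}_\alpha$. **Theorem.** Suppose that $T$ satisfies FDC, $0<b\le a<1$, the roof function $g$ is in $P_aG$ (in particular finite on each $(l_\alpha,r_\alpha)$), and $f:I^g\to\mathbb R$ is an integrable function with $\varphi_f\in P_bG$ and $\varphi_{|f|}\in\widehat P_b$. Assume that for every $\tau>0$ there is an FDC-acceleration for $\tau$ along which $$\|\mathcal M^{(k)}(S(k)\varphi_f)\|=O\big(e^{b\lambda_1(1+\tau)k}\big)\quad(k\to\infty).$$ Then for every $s\ge0$ the integral $\int_0^sf\circ T^g_t\,dt$ is well defined a.e. on $I^g$ and belongs to $L^1(I^g)$, and for every $\tau>0$ $$\Big\|\int_0^sf\circ T^g_t\,dt\Big\|_{L^1(I^g)}=O\big(s^{(1+\tau)b}\big)\quad(s\to+\infty).$$ -/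

import Mathlib

open Set Filter Topology MeasureTheory
open scoped ENNReal

/-! ## Interval exchange transformations -/

/-- Combinatorial and length data of an interval exchange of `d` intervals labelled by `𝒜`.
Positions are counted from `0` to `d - 1`; `perm 0` gives the order before, `perm 1` the order
after the exchange. -/
structure IET (𝒜 : Type*) (d : ℕ) where
  perm : Fin 2 → 𝒜 ≃ Fin d
  len : 𝒜 → ℝ

/-- The last position. -/
def lastPos (d : ℕ) [NeZero d] : Fin d := ⟨d - 1, Nat.sub_lt (NeZero.pos d) Nat.one_pos⟩

namespace IET

variable {𝒜 : Type*} [Fintype 𝒜] [DecidableEq 𝒜] {d : ℕ}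

/-- The total length `|λ| = |I|`. -/
noncomputable def total (T : IET 𝒜 d) : ℝ := ∑ α, T.len α

/-- `I = [0, |λ|)`. -/
def base (T : IET 𝒜 d) : Set ℝ := Ico 0 T.total

/-- Left end point `l_α`. -/
noncomputable def left (T : IET 𝒜 d) (α : 𝒜) : ℝ :=
  ∑ β with T.perm 0 β < T.perm 0 α, T.len β

/-- Right end point `r_α`. -/
noncomputable def right (T : IET 𝒜 d) (α : 𝒜) : ℝ :=
  ∑ β with T.perm 0 β ≤ T.perm 0 α, T.len β

/-- Middle point `m_α`. -/
noncomputable def mid (T : IET 𝒜 d) (α : 𝒜) : ℝ := (T.left α + T.right α) / 2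

/-- `I_α = [l_α, r_α)`. -/
def piece (T : IET 𝒜 d) (α : 𝒜) : Set ℝ := Ico (T.left α) (T.right α)

/-- The matrix `Ω_π`. -/
def Omega (T : IET 𝒜 d) : Matrix 𝒜 𝒜 ℝ := fun α β =>
  if T.perm 1 β < T.perm 1 α ∧ T.perm 0 α < T.perm 0 β then 1
  else if T.perm 1 α < T.perm 1 β ∧ T.perm 0 β < T.perm 0 α then -1
  else 0

/-- The translation vector `w = Ω_π λ`. -/
noncomputable def shift (T : IET 𝒜 d) : 𝒜 → ℝ := T.Omega.mulVec T.len

/-- The transformation: `x ↦ x + w_α` on `I_α` (and the identity outside `I`). -/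
noncomputable def map (T : IET 𝒜 d) (x : ℝ) : ℝ :=
  x + ∑ α, (T.piece α).indicator (fun _ => T.shift α) x

/-- The subspace `H(π) = Ω_π (ℝ^𝒜)`. -/
noncomputable def H (T : IET 𝒜 d) : Submodule ℝ (𝒜 → ℝ) := LinearMap.range T.Omega.mulVecLin

/-- Positive lengths and irreducible permutation: no proper initial segment of positions
`{0, …, k-1}`, `1 ≤ k < d`, is invariant under `π₁ ∘ π₀⁻¹`. -/
structure IsIrreducibleIET (T : IET 𝒜 d) : Prop where
  len_pos : ∀ α, 0 < T.len α
  irreducible : ∀ k : ℕ, 1 ≤ k → k < d →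
    (fun i => T.perm 1 ((T.perm 0).symm i)) '' {i : Fin d | (i : ℕ) < k} ≠
      {i : Fin d | (i : ℕ) < k}

/-- The Keane condition: `T^m l_α ≠ l_β` for `m ≥ 1` unless `β` is the first letter. -/
def Keane (T : IET 𝒜 d) : Prop :=
  ∀ m : ℕ, 1 ≤ m → ∀ α β : 𝒜, (T.perm 0 β : ℕ) ≠ 0 → T.map^[m] (T.left α) ≠ T.left β

/-! ## Rauzy-Veech induction -/

/-- The move of positions in a Rauzy step: positions up to `p` are kept, the last position is
moved to the place right after `p`, the positions in between are shifted by one. -/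
def moveFun (p q : Fin d) : Fin d :=
  if q ≤ p then q
  else if h : (q : ℕ) + 1 < d then ⟨q + 1, h⟩
  else if h : (p : ℕ) + 1 < d then ⟨p + 1, h⟩
  else q

theorem moveFun_injective (p : Fin d) : Function.Injective (moveFun p) := by
  intro q q' h
  have hp := p.2
  have hq := q.2
  have hq' := q'.2
  simp only [moveFun, Fin.le_def] at h
  apply Fin.ext
  split_ifs at h <;> simp only [Fin.ext_iff] at h <;> omega

noncomputable def move (p : Fin d) : Fin d ≃ Fin d :=
  Equiv.ofBijective (moveFun p) (Finite.injective_iff_bijective.mp (moveFun_injective p))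

variable [NeZero d]

/-- The letter in the last position of row `ε`. -/
def lastLetter (T : IET 𝒜 d) (ε : Fin 2) : 𝒜 := (T.perm ε).symm (lastPos d)

open Classical in
/-- The type `ε(π, λ)` of the Rauzy step (under the Keane condition the two lengths differ). -/
noncomputable def rauzyType (T : IET 𝒜 d) : Fin 2 :=
  if T.len (T.lastLetter 1) < T.len (T.lastLetter 0) then 0 else 1

/-- The letter `π_ε⁻¹(d)`. -/
noncomputable def winner (T : IET 𝒜 d) : 𝒜 := T.lastLetter T.rauzyType

/-- The letter `π_{1-ε}⁻¹(d)`. -/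
noncomputable def loser (T : IET 𝒜 d) : 𝒜 := T.lastLetter (1 - T.rauzyType)

/-- The matrix `A(T) = Id + E_{winner, loser}`. -/
noncomputable def rauzyMatrix (T : IET 𝒜 d) : Matrix 𝒜 𝒜 ℕ :=
  1 + Matrix.single T.winner T.loser 1

/-- One step of Rauzy-Veech induction. The new lengths are `A(T)⁻¹ λ`, i.e. the length of the
loser is subtracted from the length of the winner. -/
noncomputable def rauzy (T : IET 𝒜 d) : IET 𝒜 d where
  perm := fun i =>
    if i = T.rauzyType then T.perm i
    else (T.perm i).trans (move (T.perm i T.winner))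
  len := Function.update T.len T.winner (T.len T.winner - T.len T.loser)

/-- The Kontsevich-Zorich cocycle `A^{(n)}(T) = A(T) A(R T) ⋯ A(R^{n-1} T)`. -/
noncomputable def kz (T : IET 𝒜 d) : ℕ → Matrix 𝒜 𝒜 ℕ
  | 0 => 1
  | n + 1 => kz T n * (rauzy^[n] T).rauzyMatrix

/-- Accelerating sequences. -/
structure IsAccelerating (n : ℕ → ℕ) : Prop where
  strictMono : StrictMono n
  zero : n 0 = 0

/-- The accelerated renormalization `T^{(k)} = R^{n_k}(T)`. -/
noncomputable def acc (T : IET 𝒜 d) (n : ℕ → ℕ) (k : ℕ) : IET 𝒜 d := rauzy^[n k] T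

/-- The matrix `Q(k,l) = A^{(n_l - n_k)}(R^{n_k} T)ᵗ`, for `k ≤ l`. -/
noncomputable def Q (T : IET 𝒜 d) (n : ℕ → ℕ) (k l : ℕ) : Matrix 𝒜 𝒜 ℕ :=
  ((T.acc n k).kz (n l - n k)).transpose

/-- `Q(k,l)` acting on `ℝ^𝒜`. -/
noncomputable def Qlin (T : IET 𝒜 d) (n : ℕ → ℕ) (k l : ℕ) : (𝒜 → ℝ) →ₗ[ℝ] (𝒜 → ℝ) :=
  ((T.Q n k l).map (Nat.cast : ℕ → ℝ)).mulVecLin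

/-- `Q_α(k) = ∑_β Q_{αβ}(k)`, the height of the tower over `I^{(k)}_α`. -/
noncomputable def height (T : IET 𝒜 d) (n : ℕ → ℕ) (k : ℕ) (α : 𝒜) : ℕ := ∑ β, T.Q n 0 k α β

/-- The norm `‖B‖ = max_α ∑_β |B_{αβ}|` of a matrix with natural entries. -/
def matNorm (B : Matrix 𝒜 𝒜 ℕ) : ℝ := ((Finset.univ.sup fun α => ∑ β, B α β : ℕ) : ℝ)

/-- The norm of a vector: the sum of the absolute values of its coefficients. -/
def vecNorm (h : 𝒜 → ℝ) : ℝ := ∑ α, |h α|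

/-! ## Oseledets genericity and the Filtration Diophantine Condition -/

/-- Exponents `λ₁ > … > λ_γ > λ_{γ+1} = 0` (`lam j` for `1 ≤ j ≤ γ + 1`) and a filtration
`{0} = E₀ ⊆ E₋₁ ⊆ … ⊆ E_{-γ} ⊆ E_{γ+1} ⊆ E_γ ⊆ … ⊆ E₁ = ℝ^𝒜` (with `E_{cs} = E_{γ+1}`), satisfying
the conclusion of the Oseledets theorem along the accelerating sequence `m`. -/
structure OseledetsGeneric (T : IET 𝒜 d) (γ : ℕ) (lam : ℕ → ℝ) (m : ℕ → ℕ)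
    (E : ℤ → Submodule ℝ (𝒜 → ℝ)) : Prop where
  accelerating : IsAccelerating m
  one_le : 1 ≤ γ
  lam_anti : StrictAntiOn lam (Icc 1 (γ + 1))
  lam_last : lam (γ + 1) = 0
  E_zero : E 0 = ⊥
  E_neg_mono : ∀ i : ℕ, 1 ≤ i → i ≤ γ → E (-(i : ℤ) + 1) ≤ E (-(i : ℤ))
  E_neg_le_cs : E (-(γ : ℤ)) ≤ E ((γ : ℤ) + 1)
  E_pos_mono : ∀ i : ℕ, 1 ≤ i → i ≤ γ → E ((i : ℤ) + 1) ≤ E (i : ℤ)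
  E_one : E 1 = ⊤
  rate_neg : ∀ i : ℕ, 1 ≤ i → i ≤ γ → ∀ h ∈ E (-(i : ℤ)), h ∉ E (-(i : ℤ) + 1) →
    Tendsto (fun n : ℕ => Real.log (vecNorm (T.Qlin m 0 n h)) / n) atTop (𝓝 (-lam i))
  rate_cs : ∀ h ∈ E ((γ : ℤ) + 1), h ∉ E (-(γ : ℤ)) →
    Tendsto (fun n : ℕ => Real.log (vecNorm (T.Qlin m 0 n h)) / n) atTop (𝓝 0)
  rate_pos : ∀ i : ℕ, 1 ≤ i → i ≤ γ → ∀ h ∈ E (i : ℤ), h ∉ E ((i : ℤ) + 1) →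
    Tendsto (fun n : ℕ => Real.log (vecNorm (T.Qlin m 0 n h)) / n) atTop (𝓝 (lam i))
  dim_neg : ∀ i : ℕ, 1 ≤ i → i ≤ γ →
    Module.finrank ℝ (E (-(i : ℤ))) = Module.finrank ℝ (E (-(i : ℤ) + 1)) + 1
  dim_pos : ∀ i : ℕ, 1 ≤ i → i ≤ γ →
    Module.finrank ℝ (E (i : ℤ)) = Module.finrank ℝ (E ((i : ℤ) + 1)) + 1

/-- Complementary filtrations `{0} = U₁ ⊆ … ⊆ U_{γ+1} ⊆ H(π)`, `E_j ⊕ U_j = ℝ^𝒜`. -/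
structure IsComplementary (T : IET 𝒜 d) (γ : ℕ) (E : ℤ → Submodule ℝ (𝒜 → ℝ))
    (U : ℕ → Submodule ℝ (𝒜 → ℝ)) : Prop where
  U_one : U 1 = ⊥
  U_mono : ∀ j : ℕ, 1 ≤ j → j ≤ γ → U j ≤ U (j + 1)
  U_le : U (γ + 1) ≤ T.H
  compl : ∀ j : ℕ, 1 ≤ j → j ≤ γ + 1 → IsCompl (E (j : ℤ)) (U j)

/-- The Rokhlin Towers Condition along an accelerating sequence, with constant `δ`. -/
def RTC (T : IET 𝒜 d) (n : ℕ → ℕ) (δ : ℝ) : Prop :=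
  ∀ k : ℕ, 1 ≤ k → ∃ p : ℕ, 0 < p ∧ (∀ α, p ≤ T.height n k α) ∧
    (∀ i < p, (T.map^[i] '' (T.acc n k).base).OrdConnected) ∧
    (∀ i < p, ∀ j < p, i ≠ j →
      Disjoint (T.map^[i] '' (T.acc n k).base) (T.map^[j] '' (T.acc n k).base)) ∧
    δ * T.total ≤ p * (T.acc n k).total

/-- `r(k,l) = ∑_{k ≤ j < l} r_j`. -/
def rsum (r : ℕ → ℕ) (k l : ℕ) : ℕ := ∑ j ∈ Finset.Ico k l, r j

/-- The estimates of the Filtration Diophantine Condition for one `τ`, with all the data made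
explicit. Operator norms of restrictions are written out as inequalities between vector norms;
`E_j^{(k)} = Q(k) E_j`, `U_j^{(k)} = Q(k) U_j`. -/
structure FDCEstimates (T : IET 𝒜 d) (γ : ℕ) (lam : ℕ → ℝ) (E : ℤ → Submodule ℝ (𝒜 → ℝ))
    (τ : ℝ) (n : ℕ → ℕ) (c C κ : ℝ) (r : ℕ → ℕ) (U : ℕ → Submodule ℝ (𝒜 → ℝ)) : Prop where
  rsum_lim : ∃ ℓ ∈ Ioo (1 : ℝ) (1 + τ),
    Tendsto (fun N : ℕ => (rsum r 0 N : ℝ) / N) atTop (𝓝 ℓ)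
  restrict_E : ∀ k l j : ℕ, k < l → 1 ≤ j → j ≤ γ + 1 →
    ∀ h ∈ (E (j : ℤ)).map (T.Qlin n 0 k),
      vecNorm (T.Qlin n k l h) ≤ C * Real.exp ((lam j + τ) * rsum r k l) * vecNorm h
  restrict_U_inv : ∀ k l j : ℕ, k < l → 2 ≤ j → j ≤ γ + 1 →
    ∀ h ∈ (U j).map (T.Qlin n 0 k),
      vecNorm h ≤ C * Real.exp ((-lam (j - 1) + τ) * rsum r k l) * vecNorm (T.Qlin n k l h)
  Z_bound : ∀ k : ℕ, matNorm (T.Q n k (k + 1)) ≤ C * Real.exp (τ * k)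
  Q_lower : ∀ k : ℕ, c * Real.exp (lam 1 * k) ≤ matNorm (T.Q n 0 k)
  Q_upper : ∀ k : ℕ, matNorm (T.Q n 0 k) ≤ C * Real.exp (lam 1 * (1 + τ) * k)
  balanced : ∀ (k : ℕ) (α : 𝒜), (T.acc n k).total / (T.acc n k).len α ≤ κ
  angle : ∀ k j : ℕ, 2 ≤ j → j ≤ γ + 1 →
    ∀ e ∈ (E (j : ℤ)).map (T.Qlin n 0 k), ∀ u ∈ (U j).map (T.Qlin n 0 k), e ≠ 0 → u ≠ 0 →
      c * matNorm (T.Q n 0 k) ^ (-τ) ≤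
        Real.sin (InnerProductGeometry.angle (WithLp.toLp 2 e) (WithLp.toLp 2 u))

/-- `n` is an FDC-acceleration of `T` for the parameter `τ`. -/
def IsFDCAcceleration (T : IET 𝒜 d) (γ : ℕ) (lam : ℕ → ℝ) (E : ℤ → Submodule ℝ (𝒜 → ℝ))
    (τ : ℝ) (n : ℕ → ℕ) : Prop :=
  IsAccelerating n ∧ (∃ δ : ℝ, 0 < δ ∧ δ < 1 ∧ T.RTC n δ) ∧
    ∃ (c C κ : ℝ) (r : ℕ → ℕ) (U : ℕ → Submodule ℝ (𝒜 → ℝ)),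
      0 < c ∧ 1 ≤ C ∧ 1 ≤ κ ∧ r 0 = 0 ∧ T.IsComplementary γ E U ∧
        T.FDCEstimates γ lam E τ n c C κ r U

/-- The Filtration Diophantine Condition, with Lyapunov exponents `lam`, and Oseledets filtration
`E` obtained along the accelerating sequence `m`. -/
structure SatisfiesFDC (T : IET 𝒜 d) (γ : ℕ) (lam : ℕ → ℝ) (m : ℕ → ℕ)
    (E : ℤ → Submodule ℝ (𝒜 → ℝ)) : Prop where
  isIET : T.IsIrreducibleIET
  keane : T.Keane
  generic : T.OseledetsGeneric γ lam m E
  exists_acc : ∀ τ : ℝ, 0 < τ → ∃ n : ℕ → ℕ, T.IsFDCAcceleration γ lam E τ n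

/-! ## Special Birkhoff sums and their mean values -/

/-- `S(k)φ`: on `I^{(k)}_α` it is the Birkhoff sum of `φ` for `T` of length `Q_α(k)`. -/
noncomputable def specialSum (T : IET 𝒜 d) (n : ℕ → ℕ) (k : ℕ) (φ : ℝ → ℝ) (x : ℝ) : ℝ :=
  ∑ α, ((T.acc n k).piece α).indicator (birkhoffSum T.map φ (T.height n k α)) x

/-- The mean value projection: the vector of the mean values of `φ` on the intervals exchanged
by `T`. Applied to `T^{(k)}` it is `M^{(k)}`. -/
noncomputable def meanProj (T : IET 𝒜 d) (φ : ℝ → ℝ) (α : 𝒜) : ℝ :=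
  (∫ x in T.piece α, φ x) / T.len α

/-! ## Functions with polynomial singularities -/

/-- The space `P_a`: functions that are `C¹` on the open intervals `(l_α, r_α)`, with
`p_a(φ) < ∞` and existing limits `C_α^+`, `C_α^-`, given here as the values of `Cp`, `Cm`. -/
structure MemPaWith (T : IET 𝒜 d) (a : ℝ) (φ : ℝ → ℝ) (Cp Cm : 𝒜 → ℝ) : Prop where
  contDiffOn : ∀ α, ContDiffOn ℝ 1 φ (Ioo (T.left α) (T.right α))
  bound : ∃ K : ℝ, ∀ α,
    (∀ x ∈ Ioc (T.left α) (T.mid α), |deriv φ x * (x - T.left α) ^ (1 + a)| ≤ K) ∧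
    (∀ x ∈ Ico (T.mid α) (T.right α), |deriv φ x * (T.right α - x) ^ (1 + a)| ≤ K)
  lim_left : ∀ α, Tendsto (fun x => -(deriv φ x * (x - T.left α) ^ (1 + a)))
    (𝓝[>] (T.left α)) (𝓝 (Cp α))
  lim_right : ∀ α, Tendsto (fun x => deriv φ x * (T.right α - x) ^ (1 + a))
    (𝓝[<] (T.right α)) (𝓝 (Cm α))

/-- The space `P_a G` of functions with polynomial singularities of geometric type. -/
def MemPaG (T : IET 𝒜 d) (a : ℝ) (φ : ℝ → ℝ) : Prop :=
  ∃ Cp Cm : 𝒜 → ℝ, T.MemPaWith a φ Cp Cm ∧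
    Cm (T.lastLetter 0) * Cm (T.lastLetter 1) = 0 ∧
    Cp ((T.perm 0).symm 0) * Cp ((T.perm 1).symm 0) = 0

/-- The space of Borel functions `φ : I → ℝ` with singularities of order at most `a`
at the end points, for `0 < a < 1`. -/
def MemPhat (T : IET 𝒜 d) (a : ℝ) (φ : ℝ → ℝ) : Prop :=
  Measurable (fun x : T.base => φ x) ∧
  ∃ K : ℝ, ∀ α,
    (∀ x ∈ Ioc (T.left α) (T.mid α), |φ x * (x - T.left α) ^ a| ≤ K) ∧
    (∀ x ∈ Ico (T.mid α) (T.right α), |φ x * (T.right α - x) ^ a| ≤ K)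

/-! ## Special flows -/

/-- Roof functions `g : I → (0, ∞]` of class `P_a G`: bounded away from zero, finite inside the
exchanged intervals, with polynomial singularities of geometric type. -/
structure IsRoofPaG (T : IET 𝒜 d) (a : ℝ) (g : ℝ → ℝ≥0∞) : Prop where
  lower : ∃ c : ℝ≥0∞, 0 < c ∧ ∀ x ∈ T.base, c ≤ g x
  finite : ∀ α, ∀ x ∈ Ioo (T.left α) (T.right α), g x ≠ ∞
  memPaG : T.MemPaG a (fun x => (g x).toReal)

/-- `I^g = {(x, r) : x ∈ I, 0 ≤ r < g(x)}`. -/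
def suspension (T : IET 𝒜 d) (g : ℝ → ℝ≥0∞) : Set (ℝ × ℝ) :=
  {p | p.1 ∈ T.base ∧ 0 ≤ p.2 ∧ ENNReal.ofReal p.2 < g p.1}

/-- The special flow at times `t ≥ 0`: `T^g_t(x, r) = (T^N x, r + t - g^{(N)}(x))`, where `N` is
the unique natural number with `g^{(N)}(x) ≤ r + t < g^{(N+1)}(x)`. As `g^{(·)}(x)` is increasing,
`N` is the least natural number with `r + t < g^{(N+1)}(x)`. -/
noncomputable def specialFlow (T : IET 𝒜 d) (g : ℝ → ℝ≥0∞) (t : ℝ) (p : ℝ × ℝ) : ℝ × ℝ :=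
  let N := sInf {N : ℕ | ENNReal.ofReal (p.2 + t) < birkhoffSum T.map g (N + 1) p.1}
  (T.map^[N] p.1, p.2 + t - (birkhoffSum T.map g N p.1).toReal)

end IET

/-- `φ_f(x) = ∫_0^{g(x)} f(x, r) dr`. -/
noncomputable def roofIntegral (g : ℝ → ℝ≥0∞) (f : ℝ × ℝ → ℝ) (x : ℝ) : ℝ :=
  ∫ r in {r : ℝ | 0 ≤ r ∧ ENNReal.ofReal r < g x}, f (x, r)

/-!
# Ergodic integrals of special flows over interval exchanges with polynomial singularities

Integrability of the ergodic integrals holds because the special flow does not increase Lebesgue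
measure (`IET.map_specialFlow_le`), so that `f` along the flow is integrable jointly in time and
space.

For the growth in `s`, an orbit segment of length `s` makes at most `s / c + 1` passages through
the base, where `c` is a lower bound of the roof function `g`, and its integral is a Birkhoff sum of
`φ_f` up to two incomplete passages, which are controlled by `φ_|f|`. Segments that stay in one fibre
contribute, by Tonelli, `min s (g x)` times `φ_|f|`. Hence the `L¹` norm is at most twice the integral
over the base of `min s (g x)` times the largest of these bounds over `x`
(`IET.lintegral_ergodic_integral_le`).

Birkhoff sums are estimated through the towers of Rauzy-Veech induction. The floors of a tower are
disjoint translates of its base, so an orbit that climbs it is spaced by the length of the base, and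
the derivative of a special Birkhoff sum of `φ_f` is dominated by the term closest to a singularity.
A special sum therefore differs from its mean by at most a constant times `u ^ (-b)`, where `u` is
the distance to the end points of the base (`IET.IsTower.abs_birkhoffSum_le`). A segment shorter than
the towers of level `k` splits into special sums of the levels `l ≤ k`, at most `‖Z(l + 1)‖` of each
(`IET.abs_birkhoffSum_le_of_acc`), and `u` at level `k` bounds from below the distances at all the
lower levels. With `M` a bound for the means, this gives `(k ‖Z‖ + 1) (M + C u ^ (-b))`.

The integral over the base is then an integral over the base of level `k`, where the weights
`min s (g x)` of a column sum up to about `min s (u ^ (-a)) + q`, with `q` comparable to the height.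
The product of the singularities `u ^ (-a)` of the weight and `u ^ (-b)` of the Birkhoff sum need not
be integrable. The truncation at `s` removes this obstacle:
`min s (u ^ (-a)) ≤ s ^ b * u ^ (-(a * (1 - b)))`, and `a * (1 - b) + b < 1`. The result is a bound
by `M`, `s ^ b` and the power `b` of the height (`IET.exists_level_bound`).

Finally `k` is taken as the first level whose towers are all higher than `s / c + 1`. By the Rokhlin
towers condition and the balance of the lengths all heights of a level are comparable
(`IET.matNorm_le_height`), so at this level `exp (λ₁ k)` is at most a constant times `s`, and the
heights exceed `s` at most by a factor `exp (τ' k)` and a constant (`IET.exists_level`). These losses,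
and the growth `exp (b λ₁ (1 + τ') k)` of the means, amount to
`s ^ ((1 + τ) b)` for a suitable parameter `τ'` (`IET.exists_lintegral_le_rpow`).
-/

set_option linter.unusedSectionVars false

namespace IET

variable {𝒜 : Type*} [Fintype 𝒜] [DecidableEq 𝒜] {d : ℕ}

/-! ### Interval exchanges as invertible maps -/

/-- The inverse interval exchange: the two rows are swapped. -/
def inv (T : IET 𝒜 d) : IET 𝒜 d where
  perm := fun i => T.perm (1 - i)
  len := T.len

theorem inv_inv (T : IET 𝒜 d) : T.inv.inv = T := by
  cases T with
  | mk p l =>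
    simp only [inv, IET.mk.injEq, and_true]
    funext i
    congr 1
    fin_cases i <;> rfl

theorem inv_base (T : IET 𝒜 d) : T.inv.base = T.base := rfl

theorem inv_left (T : IET 𝒜 d) (α : 𝒜) :
    T.inv.left α = ∑ β with T.perm 1 β < T.perm 1 α, T.len β := rfl

theorem right_eq (T : IET 𝒜 d) (α : 𝒜) : T.right α = T.left α + T.len α := by
  have : (Finset.univ.filter fun β => T.perm 0 β ≤ T.perm 0 α) =
      insert α (Finset.univ.filter fun β => T.perm 0 β < T.perm 0 α) := by
    ext β
    simp [le_iff_lt_or_eq, or_comm]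
  rw [right, this, Finset.sum_insert (by simp), left, add_comm]

theorem left_nonneg {T : IET 𝒜 d} (hT : ∀ α, 0 < T.len α) (α : 𝒜) : 0 ≤ T.left α :=
  Finset.sum_nonneg fun β _ => (hT β).le

theorem right_le_total {T : IET 𝒜 d} (hT : ∀ α, 0 < T.len α) (α : 𝒜) : T.right α ≤ T.total :=
  Finset.sum_le_sum_of_subset_of_nonneg (Finset.filter_subset _ _) fun β _ _ => (hT β).le

theorem right_le_left {T : IET 𝒜 d} (hT : ∀ α, 0 < T.len α) {α β : 𝒜}
    (h : T.perm 0 α < T.perm 0 β) : T.right α ≤ T.left β := by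
  refine Finset.sum_le_sum_of_subset_of_nonneg (fun γ hγ => ?_) fun β _ _ => (hT β).le
  simp only [Finset.mem_filter, Finset.mem_univ, true_and] at hγ ⊢
  exact hγ.trans_lt h

theorem left_lt_right {T : IET 𝒜 d} (hT : ∀ α, 0 < T.len α) (α : 𝒜) : T.left α < T.right α := by
  rw [right_eq]
  linarith [hT α]

theorem piece_unique {T : IET 𝒜 d} (hT : ∀ α, 0 < T.len α) {α β : 𝒜} {x : ℝ}
    (hα : x ∈ T.piece α) (hβ : x ∈ T.piece β) : α = β := by
  rcases lt_trichotomy (T.perm 0 α) (T.perm 0 β) with h | h | h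
  · linarith [right_le_left hT h, hα.2, hβ.1]
  · exact (T.perm 0).injective h
  · linarith [right_le_left hT h, hβ.2, hα.1]

theorem piece_subset_base {T : IET 𝒜 d} (hT : ∀ α, 0 < T.len α) (α : 𝒜) : T.piece α ⊆ T.base :=
  fun _ hx => ⟨(left_nonneg hT α).trans hx.1, hx.2.trans_le (right_le_total hT α)⟩

theorem exists_piece {T : IET 𝒜 d} {x : ℝ} (hx : x ∈ T.base) : ∃ α, x ∈ T.piece α := by
  have hne : (Finset.univ.filter fun α => x < T.right α).Nonempty := by
    have hd : Nonempty 𝒜 := by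
      by_contra h
      rw [not_nonempty_iff] at h
      have := hx.1.trans_lt hx.2
      simp [total] at this
    obtain ⟨α, -, hα⟩ := Finset.exists_max_image Finset.univ (fun α => T.perm 0 α)
      Finset.univ_nonempty
    refine ⟨α, ?_⟩
    have : T.right α = T.total := by
      rw [right, total, Finset.filter_true_of_mem fun β _ => hα β (Finset.mem_univ _)]
    simp [this, hx.2]
  obtain ⟨α, hα, hmin⟩ := Finset.exists_min_image _ (fun α => T.perm 0 α) hne
  simp only [Finset.mem_filter, Finset.mem_univ, true_and] at hα hmin
  refine ⟨α, ?_, hα⟩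
  by_contra hlt
  push Not at hlt
  by_cases h0 : (T.perm 0 α : ℕ) = 0
  · have : T.left α = 0 := by
      rw [left, Finset.filter_false_of_mem, Finset.sum_empty]
      intro β _
      rw [Fin.lt_def]; omega
    linarith [hx.1]
  · -- the predecessor of `α` in the top row ends where `α` begins
    let p : Fin d := ⟨(T.perm 0 α : ℕ) - 1, by have := (T.perm 0 α).2; omega⟩
    have hp : T.perm 0 ((T.perm 0).symm p) = p := by simp
    have hr : T.right ((T.perm 0).symm p) = T.left α := by
      rw [right, left, hp]
      congr 1
      ext β
      simp only [Finset.mem_filter, Finset.mem_univ, true_and, Fin.le_def, Fin.lt_def, p]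
      omega
    have := hmin ((T.perm 0).symm p) (by rw [hr]; exact hlt)
    rw [hp, Fin.le_def] at this
    simp only [p] at this
    omega

theorem shift_eq (T : IET 𝒜 d) (α : 𝒜) : T.shift α = T.inv.left α - T.left α := by
  rw [inv_left, left, shift, Matrix.mulVec, dotProduct, Finset.sum_filter, Finset.sum_filter,
    ← Finset.sum_sub_distrib]
  refine Finset.sum_congr rfl fun β _ => ?_
  rcases eq_or_ne α β with rfl | hne
  · simp [Omega]
  · have h0 : T.perm 0 α ≠ T.perm 0 β := fun h => hne ((T.perm 0).injective h)
    have h1 : T.perm 1 α ≠ T.perm 1 β := fun h => hne ((T.perm 1).injective h)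
    rcases lt_or_gt_of_ne h0 with h0 | h0 <;> rcases lt_or_gt_of_ne h1 with h1 | h1 <;>
      simp [Omega, h0, h1, h0.not_gt, h1.not_gt]

theorem map_of_mem {T : IET 𝒜 d} (hT : ∀ α, 0 < T.len α) {α : 𝒜} {x : ℝ} (hx : x ∈ T.piece α) :
    T.map x = x + (T.inv.left α - T.left α) := by
  rw [map, Finset.sum_eq_single α, indicator_of_mem hx, shift_eq]
  · intro β _ hβ
    exact indicator_of_notMem (fun h => hβ (piece_unique hT h hx)) _
  · simp

theorem map_mem_inv_piece {T : IET 𝒜 d} (hT : ∀ α, 0 < T.len α) {α : 𝒜} {x : ℝ}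
    (hx : x ∈ T.piece α) : T.map x ∈ T.inv.piece α := by
  have h1 := T.right_eq α
  have h2 := T.inv.right_eq α
  have h3 : T.inv.len α = T.len α := rfl
  rw [map_of_mem hT hx]
  constructor <;> linarith [hx.1, hx.2]

theorem map_mem_base {T : IET 𝒜 d} (hT : ∀ α, 0 < T.len α) {x : ℝ} (hx : x ∈ T.base) :
    T.map x ∈ T.base := by
  obtain ⟨α, hα⟩ := exists_piece hx
  exact piece_subset_base (T := T.inv) hT α (map_mem_inv_piece hT hα)

theorem inv_map_map {T : IET 𝒜 d} (hT : ∀ α, 0 < T.len α) {x : ℝ} (hx : x ∈ T.base) :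
    T.inv.map (T.map x) = x := by
  obtain ⟨α, hα⟩ := exists_piece hx
  rw [map_of_mem (T := T.inv) hT (map_mem_inv_piece hT hα), map_of_mem hT hα, inv_inv]
  ring

theorem iterate_mem_base {T : IET 𝒜 d} (hT : ∀ α, 0 < T.len α) {x : ℝ} (hx : x ∈ T.base) (n : ℕ) :
    T.map^[n] x ∈ T.base := by
  induction n with
  | zero => exact hx
  | succ n ih => rw [Function.iterate_succ_apply']; exact map_mem_base hT ih

theorem inv_iterate_iterate {T : IET 𝒜 d} (hT : ∀ α, 0 < T.len α) (n : ℕ) {x : ℝ}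
    (hx : x ∈ T.base) : T.inv.map^[n] (T.map^[n] x) = x := by
  induction n with
  | zero => rfl
  | succ n ih =>
    rw [Function.iterate_succ_apply, Function.iterate_succ_apply',
      inv_map_map hT (iterate_mem_base hT hx n), ih]

theorem iterate_inv_iterate {T : IET 𝒜 d} (hT : ∀ α, 0 < T.len α) (n : ℕ) {x : ℝ}
    (hx : x ∈ T.base) : T.map^[n] (T.inv.map^[n] x) = x := by
  have := inv_iterate_iterate (T := T.inv) hT n hx
  rwa [inv_inv] at this

theorem measurableSet_piece (T : IET 𝒜 d) (α : 𝒜) : MeasurableSet (T.piece α) := measurableSet_Ico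

theorem measurableSet_base (T : IET 𝒜 d) : MeasurableSet T.base := measurableSet_Ico

theorem measurable_map (T : IET 𝒜 d) : Measurable T.map := by
  unfold map
  refine measurable_id.add (Finset.measurable_sum _ fun α _ => ?_)
  exact measurable_const.indicator (T.measurableSet_piece α)

theorem iUnion_piece {T : IET 𝒜 d} (hT : ∀ α, 0 < T.len α) : ⋃ α, T.piece α = T.base :=
  Subset.antisymm (iUnion_subset (piece_subset_base hT)) fun _ hx => mem_iUnion.2 (exists_piece hx)

theorem lintegral_base {T : IET 𝒜 d} (hT : ∀ α, 0 < T.len α) (F : ℝ → ℝ≥0∞) :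
    ∫⁻ x in T.base, F x = ∑ α, ∫⁻ x in T.piece α, F x := by
  rw [← iUnion_piece hT, lintegral_iUnion (fun α => T.measurableSet_piece α), tsum_fintype]
  intro α β hne
  exact disjoint_left.2 fun x h1 h2 => hne (piece_unique hT h1 h2)

/-- Change of variables by a translation, without measurability of the integrand. -/
theorem setLIntegral_Ico_add (F : ℝ → ℝ≥0∞) (u v c : ℝ) :
    ∫⁻ x in Ico u v, F (x + c) = ∫⁻ x in Ico (u + c) (v + c), F x := by
  have := (measurePreserving_add_right (volume : Measure ℝ) c).setLIntegral_comp_preimage_emb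
    (measurableEmbedding_addRight c) F (Ico (u + c) (v + c))
  rw [← this, preimage_add_const_Ico]
  simp

theorem lintegral_comp_map {T : IET 𝒜 d} (hT : ∀ α, 0 < T.len α) (F : ℝ → ℝ≥0∞) :
    ∫⁻ x in T.base, F (T.map x) = ∫⁻ x in T.base, F x := by
  rw [lintegral_base hT, ← T.inv_base, lintegral_base (T := T.inv) hT]
  refine Finset.sum_congr rfl fun α _ => ?_
  rw [setLIntegral_congr_fun (T.measurableSet_piece α)
    (g := fun x => F (x + (T.inv.left α - T.left α))) (fun x hx => by
      simp only [map_of_mem hT hx]), piece, setLIntegral_Ico_add, piece]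
  have h1 := T.right_eq α
  have h2 := T.inv.right_eq α
  have h3 : T.inv.len α = T.len α := rfl
  congr 3 <;> linarith

theorem measurePreserving_map {T : IET 𝒜 d} (hT : ∀ α, 0 < T.len α) :
    MeasurePreserving T.map (volume.restrict T.base) (volume.restrict T.base) := by
  refine ⟨T.measurable_map, ?_⟩
  ext s hs
  rw [Measure.map_apply T.measurable_map hs, ← lintegral_indicator_one hs,
    ← lintegral_comp_map hT, ← lintegral_indicator_one (T.measurable_map hs)]
  rfl

/-! ### Towers -/

/-- The function which is constant with value `v α` on each exchanged interval `I_α`. -/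
noncomputable def loc (T : IET 𝒜 d) (v : 𝒜 → ℕ) (x : ℝ) : ℕ :=
  ∑ α, (T.piece α).indicator (fun _ => v α) x

theorem loc_of_mem {T : IET 𝒜 d} (hT : ∀ α, 0 < T.len α) (v : 𝒜 → ℕ) {α : 𝒜} {x : ℝ}
    (hx : x ∈ T.piece α) : T.loc v x = v α := by
  rw [loc, Finset.sum_eq_single α, indicator_of_mem hx]
  · intro β _ hβ
    exact indicator_of_notMem (fun h => hβ (piece_unique hT h hx)) _
  · simp

/-- The row sums of a matrix, which are heights of towers. -/
def rowSum (B : Matrix 𝒜 𝒜 ℕ) (α : 𝒜) : ℕ := ∑ β, B α β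

/-- `S` is induced by `T`, and `B α β` is the number of visits to the interval `I_β` of `T` of the
orbits that start in the interval `I_α` of `S`, until they return to the base of `S`. -/
structure IsTower (T S : IET 𝒜 d) (B : Matrix 𝒜 𝒜 ℕ) : Prop where
  base_subset : S.base ⊆ T.base
  height_pos : ∀ α, 0 < rowSum B α
  map_eq : ∀ α, ∀ x ∈ S.piece α, S.map x = T.map^[rowSum B α] x
  floor : ∀ α, ∀ i < rowSum B α, ∃ β c, ∀ x ∈ S.piece α, T.map^[i] x = x + c ∧ x + c ∈ T.piece β
  count : ∀ v : 𝒜 → ℕ, ∀ α, ∀ x ∈ S.piece α,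
    birkhoffSum T.map (T.loc v) (rowSum B α) x = ∑ β, B α β * v β
  not_mem : ∀ α, ∀ x ∈ S.piece α, ∀ i < rowSum B α, 0 < i → T.map^[i] x ∉ S.base
  cover : ∀ z ∈ T.base, ∃ α, ∃ x ∈ S.piece α, ∃ i < rowSum B α, T.map^[i] x = z

theorem isTower_one {T : IET 𝒜 d} (hT : ∀ α, 0 < T.len α) : IsTower T T 1 := by
  have h1 : ∀ α : 𝒜, rowSum (1 : Matrix 𝒜 𝒜 ℕ) α = 1 := fun α => by
    simp [rowSum, Matrix.one_apply]
  refine ⟨subset_rfl, fun α => by simp [h1], fun α x _ => by simp [h1], fun α i hi => ?_,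
    fun v α x hx => ?_, fun α x _ i hi hi0 => ?_, fun z hz => ?_⟩
  · rw [h1, Nat.lt_one_iff] at hi
    subst hi
    exact ⟨α, 0, fun x hx => by simpa using hx⟩
  · simp [h1, birkhoffSum_one, loc_of_mem hT v hx, Matrix.one_apply]
  · rw [h1] at hi; omega
  · obtain ⟨α, hα⟩ := exists_piece hz
    exact ⟨α, z, hα, 0, by simp [h1], rfl⟩

section Tower

variable {T S R : IET 𝒜 d} {B C : Matrix 𝒜 𝒜 ℕ}

/-- The time for `T` after which an orbit has made `q` returns to the base of `S`. -/
noncomputable def returnTime (S : IET 𝒜 d) (B : Matrix 𝒜 𝒜 ℕ) (q : ℕ) (x : ℝ) : ℕ :=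
  birkhoffSum S.map (S.loc (rowSum B)) q x

theorem returnTime_succ (S : IET 𝒜 d) (B : Matrix 𝒜 𝒜 ℕ) (q : ℕ) (x : ℝ) :
    returnTime S B (q + 1) x = returnTime S B q x + S.loc (rowSum B) (S.map^[q] x) :=
  birkhoffSum_succ _ _ _ _

theorem IsTower.map_eq_loc (h : IsTower T S B) (hS : ∀ α, 0 < S.len α) {x : ℝ} (hx : x ∈ S.base) :
    S.map x = T.map^[S.loc (rowSum B) x] x := by
  obtain ⟨α, hα⟩ := exists_piece hx
  rw [loc_of_mem hS _ hα, h.map_eq α x hα]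

theorem IsTower.iterate_eq (h : IsTower T S B) (hS : ∀ α, 0 < S.len α) {x : ℝ} (hx : x ∈ S.base)
    (q : ℕ) : S.map^[q] x = T.map^[returnTime S B q x] x := by
  induction q with
  | zero => rfl
  | succ q ih =>
    rw [Function.iterate_succ_apply', h.map_eq_loc hS (iterate_mem_base hS hx q), returnTime_succ,
      add_comm, Function.iterate_add_apply, ← ih]

/-- Every time before the `q`-th return lies in one of the first `q` excursions. -/
theorem exists_excursion (S : IET 𝒜 d) (B : Matrix 𝒜 𝒜 ℕ) (x : ℝ) {q i : ℕ}
    (hi : i < returnTime S B q x) :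
    ∃ p < q, ∃ j < S.loc (rowSum B) (S.map^[p] x), i = returnTime S B p x + j := by
  induction q with
  | zero => simp [returnTime] at hi
  | succ q ih =>
    rcases lt_or_ge i (returnTime S B q x) with h | h
    · obtain ⟨p, hp, j, hj, e⟩ := ih h
      exact ⟨p, hp.trans (Nat.lt_succ_self q), j, hj, e⟩
    · rw [returnTime_succ] at hi
      exact ⟨q, Nat.lt_succ_self q, i - returnTime S B q x, by omega, by omega⟩

theorem IsTower.returnTime_eq (h : IsTower S R C) (B : Matrix 𝒜 𝒜 ℕ) {α : 𝒜} {x : ℝ}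
    (hx : x ∈ R.piece α) : returnTime S B (rowSum C α) x = rowSum (C * B) α := by
  rw [returnTime, h.count _ α x hx]
  simp only [rowSum, Matrix.mul_apply, Finset.mul_sum]
  exact Finset.sum_comm

/-- Return times are the same for all points of an exchanged interval. -/
theorem IsTower.returnTime_congr (h : IsTower S R C) (hS : ∀ α, 0 < S.len α) (B : Matrix 𝒜 𝒜 ℕ)
    {α : 𝒜} {x y : ℝ} (hx : x ∈ R.piece α) (hy : y ∈ R.piece α) {q : ℕ} (hq : q ≤ rowSum C α) :
    returnTime S B q x = returnTime S B q y := by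
  induction q with
  | zero => rfl
  | succ q ih =>
    obtain ⟨β, c, hc⟩ := h.floor α q hq
    rw [returnTime_succ, returnTime_succ, ih (by omega), (hc x hx).1, (hc y hy).1,
      loc_of_mem hS _ (hc x hx).2, loc_of_mem hS _ (hc y hy).2]

theorem IsTower.trans (hTS : IsTower T S B) (hSR : IsTower S R C) (hS : ∀ α, 0 < S.len α)
    (hR : ∀ α, 0 < R.len α) : IsTower T R (C * B) := by
  have hbase : ∀ {α x}, x ∈ R.piece α → x ∈ S.base := fun hx =>
    hSR.base_subset (piece_subset_base hR _ hx)
  refine ⟨hSR.base_subset.trans hTS.base_subset, fun α => ?_, fun α x hx => ?_, fun α i hi => ?_,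
    fun v α x hx => ?_, fun α x hx i hi hi0 => ?_, fun z hz => ?_⟩
  · have hmem : R.left α ∈ R.piece α := ⟨le_rfl, left_lt_right hR α⟩
    rw [← hSR.returnTime_eq B hmem]
    obtain ⟨n, hn⟩ := Nat.exists_eq_succ_of_ne_zero (hSR.height_pos α).ne'
    rw [hn, returnTime_succ]
    obtain ⟨β, hβ⟩ := exists_piece (iterate_mem_base hS (hbase hmem) n)
    rw [loc_of_mem hS _ hβ]
    have := hTS.height_pos β
    omega
  · rw [← hSR.returnTime_eq B hx, ← hTS.iterate_eq hS (hbase hx), hSR.map_eq α x hx]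
  · have hmem : R.left α ∈ R.piece α := ⟨le_rfl, left_lt_right hR α⟩
    rw [← hSR.returnTime_eq B hmem] at hi
    obtain ⟨q, hq, j, hj, e⟩ := exists_excursion S B _ hi
    obtain ⟨β, c, hc⟩ := hSR.floor α q hq
    rw [(hc _ hmem).1, loc_of_mem hS _ (hc _ hmem).2] at hj
    obtain ⟨β', c', hc'⟩ := hTS.floor β j hj
    refine ⟨β', c + c', fun x hx => ?_⟩
    have h1 := hc' _ (hc x hx).2
    rw [add_assoc] at h1
    refine ⟨?_, h1.2⟩
    rw [e, hSR.returnTime_congr hS B hmem hx hq.le, add_comm, Function.iterate_add_apply,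
      ← hTS.iterate_eq hS (hbase hx), (hc x hx).1, h1.1]
  · have key : ∀ q, q ≤ rowSum C α → birkhoffSum T.map (T.loc v) (returnTime S B q x) x =
        birkhoffSum S.map (S.loc fun γ => ∑ β, B γ β * v β) q x := by
      intro q hq
      induction q with
      | zero => simp [returnTime]
      | succ q ih =>
        obtain ⟨β, c, hc⟩ := hSR.floor α q hq
        have hmem : S.map^[q] x ∈ S.piece β := (hc x hx).1 ▸ (hc x hx).2
        rw [returnTime_succ, birkhoffSum_add, ← hTS.iterate_eq hS (hbase hx), ih (by omega),
          loc_of_mem hS _ hmem, birkhoffSum_succ, hTS.count v β _ hmem,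
          loc_of_mem hS (fun γ => ∑ β, B γ β * v β) hmem]
    rw [← hSR.returnTime_eq B hx, key _ le_rfl, hSR.count _ α x hx]
    simp only [Matrix.mul_apply, Finset.mul_sum, Finset.sum_mul]
    rw [Finset.sum_comm]
    simp only [mul_assoc]
  · rw [← hSR.returnTime_eq B hx] at hi
    obtain ⟨q, hq, j, hj, e⟩ := exists_excursion S B _ hi
    obtain ⟨β, c, hc⟩ := hSR.floor α q hq
    have hmem : S.map^[q] x ∈ S.piece β := (hc x hx).1 ▸ (hc x hx).2
    rw [e, add_comm, Function.iterate_add_apply, ← hTS.iterate_eq hS (hbase hx)]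
    rcases Nat.eq_zero_or_pos j with rfl | hj0
    · refine hSR.not_mem α x hx q hq ?_
      rcases Nat.eq_zero_or_pos q with rfl | hq0
      · simp [returnTime] at e; omega
      · exact hq0
    · rw [loc_of_mem hS _ hmem] at hj
      exact fun h => hTS.not_mem β _ hmem j hj hj0 (hSR.base_subset h)
  · obtain ⟨β, y, hy, j, hj, rfl⟩ := hTS.cover z hz
    obtain ⟨α, x, hx, q, hq, rfl⟩ := hSR.cover y (piece_subset_base hS β hy)
    refine ⟨α, x, hx, j + returnTime S B q x, ?_, ?_⟩
    · rw [← hSR.returnTime_eq B hx]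
      have hmono : returnTime S B (q + 1) x ≤ returnTime S B (rowSum C α) x :=
        Finset.sum_le_sum_of_subset (Finset.range_mono hq)
      rw [returnTime_succ, loc_of_mem hS _ hy] at hmono
      omega
    · rw [Function.iterate_add_apply, ← hTS.iterate_eq hS (hbase hx)]

/-- Distinct floors of a tower are disjoint. -/
theorem IsTower.iterate_ne (h : IsTower T S B) (hT : ∀ α, 0 < T.len α) (hS : ∀ α, 0 < S.len α)
    {α : 𝒜} {x y : ℝ} (hx : x ∈ S.piece α) (hy : y ∈ S.piece α) {i j : ℕ} (hij : i < j)
    (hj : j < rowSum B α) : T.map^[i] x ≠ T.map^[j] y := by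
  intro e
  have hbx := h.base_subset (piece_subset_base hS α hx)
  have hby := h.base_subset (piece_subset_base hS α hy)
  have e' := congrArg (T.inv.map^[i]) e
  rw [inv_iterate_iterate hT i hbx, show j = i + (j - i) by omega, Function.iterate_add_apply,
    inv_iterate_iterate hT i (iterate_mem_base hT hby _)] at e'
  exact h.not_mem α y hy (j - i) (by omega) (by omega) (e' ▸ piece_subset_base hS α hx)

end Tower

end IET

namespace IET

variable {𝒜 : Type*} [Fintype 𝒜] [DecidableEq 𝒜] {d : ℕ}

/-! ### One step of Rauzy-Veech induction -/

/-- Left end points for the order given by one row `p`. -/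
def rowLeft (p : 𝒜 ≃ Fin d) (l : 𝒜 → ℝ) (α : 𝒜) : ℝ := ∑ β with p β < p α, l β

variable [NeZero d]

theorem rowLeft_last (p : 𝒜 ≃ Fin d) (l : 𝒜 → ℝ) :
    rowLeft p l (p.symm (lastPos d)) = ∑ β, l β - l (p.symm (lastPos d)) := by
  rw [rowLeft, eq_sub_iff_add_eq, add_comm, ← Finset.sum_insert (by simp)]
  congr 1
  ext β
  simp only [Finset.mem_insert, Finset.mem_filter, Finset.mem_univ, true_and, iff_true,
    Equiv.apply_symm_apply, Equiv.eq_symm_apply]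
  have := (p β).2
  rw [Fin.ext_iff, Fin.lt_def]
  simp only [lastPos]
  omega

/-- Shortening the last interval of a row does not change left end points. -/
theorem rowLeft_update_last (p : 𝒜 ≃ Fin d) (l : 𝒜 → ℝ) (s : ℝ) (α : 𝒜) :
    rowLeft p (Function.update l (p.symm (lastPos d)) s) α = rowLeft p l α := by
  refine Finset.sum_congr rfl fun β hβ => Function.update_of_ne ?_ _ _
  rintro rfl
  simp only [Finset.mem_filter, Finset.mem_univ, true_and, Equiv.apply_symm_apply] at hβ
  have := (p α).2
  rw [Fin.lt_def] at hβ
  simp only [lastPos] at hβ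
  omega

theorem move_lt_move_iff {p q r : Fin d} (hq : q ≠ lastPos d) (hr : r ≠ lastPos d) :
    move p q < move p r ↔ q < r := by
  have h1 := p.2
  have h2 := q.2
  have h3 := r.2
  simp only [lastPos, ne_eq, Fin.ext_iff] at hq hr
  simp only [move, Equiv.ofBijective_apply, moveFun, Fin.le_def, Fin.lt_def]
  split_ifs <;> simp only [] <;> omega

theorem move_lt_move_last_iff {p q : Fin d} (hq : q ≠ lastPos d) :
    move p q < move p (lastPos d) ↔ q ≤ p := by
  have h1 := p.2
  have h2 := q.2
  simp only [lastPos, ne_eq, Fin.ext_iff] at hq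
  simp only [move, Equiv.ofBijective_apply, moveFun, Fin.le_def, Fin.lt_def, lastPos]
  split_ifs <;> (try simp only []) <;> omega

theorem move_last_lt_move_iff {p q : Fin d} (hq : q ≠ lastPos d) :
    move p (lastPos d) < move p q ↔ p < q := by
  have h1 := p.2
  have h2 := q.2
  simp only [lastPos, ne_eq, Fin.ext_iff] at hq
  simp only [move, Equiv.ofBijective_apply, moveFun, Fin.le_def, Fin.lt_def, lastPos]
  split_ifs <;> (try simp only []) <;> omega

/-- Cutting a piece of length `l ℓ` from the right of `w` and inserting the last letter `ℓ` there
does not change the left end points of the other letters. -/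
theorem rowLeft_move_of_ne (p : 𝒜 ≃ Fin d) (l : 𝒜 → ℝ) {w α : 𝒜} (hw : w ≠ p.symm (lastPos d))
    (hα : α ≠ p.symm (lastPos d)) :
    rowLeft (p.trans (move (p w))) (Function.update l w (l w - l (p.symm (lastPos d)))) α =
      rowLeft p l α := by
  set ℓ := p.symm (lastPos d) with hℓ
  have hpl : p ℓ = lastPos d := by simp [hℓ]
  have hne : ∀ {β}, β ≠ ℓ → p β ≠ lastPos d := fun hβ h => hβ (by rw [hℓ, ← h]; simp)
  have hb : ∀ β, (if (p.trans (move (p w))) β < (p.trans (move (p w))) α then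
        Function.update l w (l w - l ℓ) β else 0) =
      (if p β < p α then l β else 0) + (if β = ℓ then (if p w < p α then l ℓ else 0) else 0)
        - (if β = w then (if p w < p α then l ℓ else 0) else 0) := by
    intro β
    simp only [Equiv.trans_apply]
    by_cases h1 : β = ℓ
    · have h3 : ¬ p ℓ < p α := by
        rw [hpl, Fin.lt_def]; have := (p α).2; simp only [lastPos]; omega
      have h4 := move_last_lt_move_iff (p := p w) (hne hα)
      rw [← hpl] at h4
      subst h1
      simp only [h3, h4, Function.update_of_ne hw.symm, if_neg hw.symm, if_true, if_false]
      ring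
    · have h5 := move_lt_move_iff (p := p w) (hne h1) (hne hα)
      simp only [h5]
      by_cases h2 : β = w
      · subst h2
        simp only [Function.update_self, if_neg h1, if_true]
        split_ifs <;> ring
      · simp only [Function.update_of_ne h2, if_neg h1, if_neg h2]
        ring
  rw [rowLeft, rowLeft, Finset.sum_filter, Finset.sum_filter, Finset.sum_congr rfl fun β _ => hb β,
    Finset.sum_sub_distrib, Finset.sum_add_distrib]
  simp

/-- The moved letter lands at the right end of the old interval of `w`. -/
theorem rowLeft_move_last (p : 𝒜 ≃ Fin d) (l : 𝒜 → ℝ) {w : 𝒜} (hw : w ≠ p.symm (lastPos d)) :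
    rowLeft (p.trans (move (p w))) (Function.update l w (l w - l (p.symm (lastPos d))))
      (p.symm (lastPos d)) = rowLeft p l w + l w - l (p.symm (lastPos d)) := by
  set ℓ := p.symm (lastPos d) with hℓ
  have hpl : p ℓ = lastPos d := by simp [hℓ]
  have hne : ∀ {β}, β ≠ ℓ → p β ≠ lastPos d := fun hβ h => hβ (by rw [hℓ, ← h]; simp)
  have hb : ∀ β, (if (p.trans (move (p w))) β < (p.trans (move (p w))) ℓ then
        Function.update l w (l w - l ℓ) β else 0) =
      (if p β < p w then l β else 0) + (if β = w then l w - l ℓ else 0) := by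
    intro β
    simp only [Equiv.trans_apply]
    by_cases h1 : β = ℓ
    · have h3 : ¬ p ℓ < p w := by
        rw [hpl, Fin.lt_def]; have := (p w).2; simp only [lastPos]; omega
      subst h1
      simp [h3, hw.symm]
    · have h4 := move_lt_move_last_iff (p := p w) (hne h1)
      rw [← hpl] at h4
      simp only [h4]
      by_cases h2 : β = w
      · subst h2
        simp
      · have : p β ≠ p w := fun h => h2 (p.injective h)
        simp only [Function.update_of_ne h2, if_neg h2, this.le_iff_lt, add_zero]
  rw [rowLeft, rowLeft, Finset.sum_filter, Finset.sum_filter, Finset.sum_congr rfl fun β _ => hb β,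
    Finset.sum_add_distrib]
  simp only [Finset.sum_ite_eq', Finset.mem_univ, if_true]
  ring

/-- Positive lengths, the Keane condition, and at least two intervals. -/
structure Renormalizable (T : IET 𝒜 d) : Prop where
  pos : ∀ α, 0 < T.len α
  keane : T.Keane
  two_le : 2 ≤ d

theorem len_last_ne {T : IET 𝒜 d} (h : T.Renormalizable) :
    T.len (T.lastLetter 0) ≠ T.len (T.lastLetter 1) := by
  intro e
  have h0 : T.left (T.lastLetter 0) = T.total - T.len (T.lastLetter 0) :=
    rowLeft_last (T.perm 0) T.len
  have h1 : T.inv.left (T.lastLetter 1) = T.total - T.len (T.lastLetter 1) :=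
    rowLeft_last (T.perm 1) T.len
  refine h.keane 1 le_rfl (T.lastLetter 1) (T.lastLetter 0) ?_ ?_
  · have := h.two_le
    simp only [lastLetter, Equiv.apply_symm_apply, lastPos]
    omega
  · rw [Function.iterate_one, map_of_mem h.pos ⟨le_rfl, left_lt_right h.pos _⟩, h1, h0, e]
    ring

theorem rauzyType_cases (T : IET 𝒜 d) : T.rauzyType = 0 ∨ T.rauzyType = 1 := by
  unfold rauzyType
  split_ifs <;> simp

theorem loser_lt_winner {T : IET 𝒜 d} (h : T.Renormalizable) :
    T.len T.loser < T.len T.winner := by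
  have hne := len_last_ne h
  unfold loser winner
  by_cases hlt : T.len (T.lastLetter 1) < T.len (T.lastLetter 0)
  · have : T.rauzyType = 0 := if_pos hlt
    rw [this]; exact hlt
  · have : T.rauzyType = 1 := if_neg hlt
    rw [this]; exact lt_of_le_of_ne (not_lt.1 hlt) hne

theorem winner_ne_loser {T : IET 𝒜 d} (h : T.Renormalizable) : T.winner ≠ T.loser := fun e => by
  have := loser_lt_winner h
  rw [e] at this
  exact lt_irrefl _ this

theorem rauzy_len (T : IET 𝒜 d) :
    T.rauzy.len = Function.update T.len T.winner (T.len T.winner - T.len T.loser) := rfl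

theorem rauzy_pos {T : IET 𝒜 d} (h : T.Renormalizable) (α : 𝒜) : 0 < T.rauzy.len α := by
  rw [rauzy_len, Function.update_apply]
  split_ifs
  · linarith [loser_lt_winner h]
  · exact h.pos α

theorem rauzy_total (T : IET 𝒜 d) : T.rauzy.total = T.total - T.len T.loser := by
  rw [total, rauzy_len, Finset.sum_update_of_mem (Finset.mem_univ _), total,
    ← Finset.add_sum_erase _ _ (Finset.mem_univ T.winner), ← Finset.sdiff_singleton_eq_erase]
  ring

theorem sum_rauzyMatrix_transpose (T : IET 𝒜 d) (v : 𝒜 → ℕ) (α : 𝒜) :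
    ∑ β, T.rauzyMatrix.transpose α β * v β = v α + if α = T.loser then v T.winner else 0 := by
  simp only [rauzyMatrix, Matrix.transpose_apply, Matrix.add_apply, Matrix.one_apply,
    Matrix.single_apply, add_mul, Finset.sum_add_distrib, ite_mul, one_mul, zero_mul,
    Finset.sum_ite_eq', Finset.mem_univ, if_true]
  congr 1
  by_cases h : α = T.loser
  · simp [h]
  · simp [h, Ne.symm h]

theorem rowSum_rauzyMatrix_transpose (T : IET 𝒜 d) (α : 𝒜) :
    rowSum T.rauzyMatrix.transpose α = if α = T.loser then 2 else 1 := by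
  have := T.sum_rauzyMatrix_transpose (fun _ => 1) α
  simp only [mul_one] at this
  rw [rowSum, this]
  split_ifs <;> rfl

/-- How the end points of both rows change in a Rauzy step. -/
theorem rauzy_left_cases {T : IET 𝒜 d} (h : T.Renormalizable) :
    (T.left T.winner = T.total - T.len T.winner ∧ T.inv.left T.loser = T.total - T.len T.loser ∧
      (∀ α, T.rauzy.left α = T.left α) ∧ (∀ α ≠ T.loser, T.rauzy.inv.left α = T.inv.left α) ∧
      T.rauzy.inv.left T.loser = T.inv.left T.winner + T.len T.winner - T.len T.loser) ∨
    (T.inv.left T.winner = T.total - T.len T.winner ∧ T.left T.loser = T.total - T.len T.loser ∧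
      (∀ α, T.rauzy.inv.left α = T.inv.left α) ∧ (∀ α ≠ T.loser, T.rauzy.left α = T.left α) ∧
      T.rauzy.left T.loser = T.left T.winner + T.len T.winner - T.len T.loser) := by
  have hne := winner_ne_loser h
  rcases T.rauzyType_cases with ht | ht
  · have hw : T.winner = (T.perm 0).symm (lastPos d) := by rw [winner, ht]; rfl
    have hl : T.loser = (T.perm 1).symm (lastPos d) := by rw [loser, ht]; rfl
    have p0 : T.rauzy.perm 0 = T.perm 0 := by simp [rauzy, ht]
    have p1 : T.rauzy.perm 1 = (T.perm 1).trans (move (T.perm 1 T.winner)) := by simp [rauzy, ht]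
    left
    have q0 : ∀ α, T.rauzy.left α = rowLeft (T.rauzy.perm 0) T.rauzy.len α := fun _ => rfl
    have q1 : ∀ α, T.rauzy.inv.left α = rowLeft (T.rauzy.perm 1) T.rauzy.len α := fun _ => rfl
    have s0 : ∀ α, T.left α = rowLeft (T.perm 0) T.len α := fun _ => rfl
    have s1 : ∀ α, T.inv.left α = rowLeft (T.perm 1) T.len α := fun _ => rfl
    rw [p0, rauzy_len] at q0
    rw [p1, rauzy_len] at q1
    refine ⟨?_, ?_, fun α => ?_, fun α hα => ?_, ?_⟩
    · rw [hw]; exact rowLeft_last _ _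
    · rw [hl]; exact rowLeft_last _ _
    · rw [q0, s0, hw]; exact rowLeft_update_last _ _ _ _
    · rw [q1, s1]; rw [hl] at hα hne ⊢; exact rowLeft_move_of_ne _ _ hne hα
    · rw [q1, s1]; rw [hl] at hne ⊢; exact rowLeft_move_last _ _ hne
  · have hw : T.winner = (T.perm 1).symm (lastPos d) := by rw [winner, ht]; rfl
    have hl : T.loser = (T.perm 0).symm (lastPos d) := by rw [loser, ht]; rfl
    have p1 : T.rauzy.perm 1 = T.perm 1 := by simp [rauzy, ht]
    have p0 : T.rauzy.perm 0 = (T.perm 0).trans (move (T.perm 0 T.winner)) := by simp [rauzy, ht]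
    right
    have q0 : ∀ α, T.rauzy.left α = rowLeft (T.rauzy.perm 0) T.rauzy.len α := fun _ => rfl
    have q1 : ∀ α, T.rauzy.inv.left α = rowLeft (T.rauzy.perm 1) T.rauzy.len α := fun _ => rfl
    have s0 : ∀ α, T.left α = rowLeft (T.perm 0) T.len α := fun _ => rfl
    have s1 : ∀ α, T.inv.left α = rowLeft (T.perm 1) T.len α := fun _ => rfl
    rw [p0, rauzy_len] at q0
    rw [p1, rauzy_len] at q1
    refine ⟨?_, ?_, fun α => ?_, fun α hα => ?_, ?_⟩
    · rw [hw]; exact rowLeft_last _ _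
    · rw [hl]; exact rowLeft_last _ _
    · rw [q1, s1, hw]; exact rowLeft_update_last _ _ _ _
    · rw [q0, s0]; rw [hl] at hα hne ⊢; exact rowLeft_move_of_ne _ _ hne hα
    · rw [q0, s0]; rw [hl] at hne ⊢; exact rowLeft_move_last _ _ hne

theorem rauzy_len_loser {T : IET 𝒜 d} (h : T.Renormalizable) :
    T.rauzy.len T.loser = T.len T.loser := by
  rw [rauzy_len, Function.update_of_ne (winner_ne_loser h).symm]

theorem rauzy_len_le {T : IET 𝒜 d} (h : T.Renormalizable) (α : 𝒜) :
    T.rauzy.len α ≤ T.len α := by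
  rw [rauzy_len, Function.update_apply]
  split_ifs with e
  · rw [e]; linarith [h.pos T.loser]
  · exact le_rfl

/-- Away from the loser, the renormalized map is the old one. -/
theorem rauzy_map_of_ne {T : IET 𝒜 d} (h : T.Renormalizable) {α : 𝒜} (hα : α ≠ T.loser) {x : ℝ}
    (hx : x ∈ T.rauzy.piece α) : x ∈ T.piece α ∧ T.rauzy.map x = T.map x := by
  have hl : T.rauzy.left α = T.left α := by
    rcases rauzy_left_cases h with ⟨-, -, h1, -⟩ | ⟨-, -, -, h1, -⟩
    exacts [h1 α, h1 α hα]
  have hl' : T.rauzy.inv.left α = T.inv.left α := by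
    rcases rauzy_left_cases h with ⟨-, -, -, h1, -⟩ | ⟨-, -, h1, -⟩
    exacts [h1 α hα, h1 α]
  have h1 := T.right_eq α
  have h2 := T.rauzy.right_eq α
  have h3 := rauzy_len_le h α
  have hm : x ∈ T.piece α := ⟨hl ▸ hx.1, by linarith [hx.2]⟩
  exact ⟨hm, by rw [map_of_mem (rauzy_pos h) hx, map_of_mem h.pos hm, hl, hl']⟩

/-- The interval of the loser leaves the new base once, through `I_w` and `I_ℓ` in one of the two
orders, before it returns. -/
theorem rauzy_map_loser {T : IET 𝒜 d} (h : T.Renormalizable) :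
    ∃ β₀ β₁ c, (β₀ = T.loser ∧ β₁ = T.winner ∨ β₀ = T.winner ∧ β₁ = T.loser) ∧
      T.rauzy.left T.loser + c = T.rauzy.total ∧
      ∀ x ∈ T.rauzy.piece T.loser, x ∈ T.piece β₀ ∧ T.map x = x + c ∧ x + c ∈ T.piece β₁ ∧
        T.rauzy.total ≤ x + c ∧ T.rauzy.map x = T.map (x + c) := by
  have h2 := T.rauzy.right_eq T.loser
  have h3 := rauzy_len_loser h
  have h4 := T.right_eq T.loser
  have h5 := T.right_eq T.winner
  have h6 := loser_lt_winner h
  have h7 := T.rauzy_total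
  rcases rauzy_left_cases h with ⟨e1, e2, e3, e4, e5⟩ | ⟨e1, e2, e3, e4, e5⟩
  · have e6 := e3 T.loser
    refine ⟨T.loser, T.winner, T.inv.left T.loser - T.left T.loser, Or.inl ⟨rfl, rfl⟩,
      by linarith, fun x hx => ?_⟩
    obtain ⟨hx1, hx2⟩ := hx
    have m1 : x ∈ T.piece T.loser := ⟨by linarith, by linarith⟩
    have m2 : x + (T.inv.left T.loser - T.left T.loser) ∈ T.piece T.winner :=
      ⟨by linarith, by linarith⟩
    refine ⟨m1, map_of_mem h.pos m1, m2, by linarith, ?_⟩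
    rw [map_of_mem (rauzy_pos h) ⟨hx1, hx2⟩, map_of_mem h.pos m2]
    linarith
  · have e6 := e3 T.loser
    refine ⟨T.winner, T.loser, T.inv.left T.winner - T.left T.winner, Or.inr ⟨rfl, rfl⟩,
      by linarith, fun x hx => ?_⟩
    obtain ⟨hx1, hx2⟩ := hx
    have m1 : x ∈ T.piece T.winner := ⟨by linarith, by linarith⟩
    have m2 : x + (T.inv.left T.winner - T.left T.winner) ∈ T.piece T.loser :=
      ⟨by linarith, by linarith⟩
    refine ⟨m1, map_of_mem h.pos m1, m2, by linarith, ?_⟩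
    rw [map_of_mem (rauzy_pos h) ⟨hx1, hx2⟩, map_of_mem h.pos m2]
    linarith

theorem isTower_rauzy {T : IET 𝒜 d} (h : T.Renormalizable) :
    IsTower T T.rauzy T.rauzyMatrix.transpose := by
  have hpos' := rauzy_pos h
  have htot := T.rauzy_total
  obtain ⟨β₀, β₁, c, hβ, hc, hl⟩ := rauzy_map_loser h
  have hrow := T.rowSum_rauzyMatrix_transpose
  refine ⟨fun x hx => ⟨hx.1, hx.2.trans (by linarith [h.pos T.loser])⟩, fun α => ?_,
    fun α x hx => ?_, fun α i hi => ?_, fun v α x hx => ?_, fun α x hx i hi hi0 => ?_,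
    fun z hz => ?_⟩
  · rw [hrow]; split_ifs <;> norm_num
  · rw [hrow]
    by_cases e : α = T.loser
    · subst e
      obtain ⟨-, h2, -, -, h5⟩ := hl x hx
      rw [if_pos rfl, h5, ← h2]; rfl
    · rw [if_neg e, (rauzy_map_of_ne h e hx).2]; rfl
  · rw [hrow] at hi
    by_cases e : α = T.loser
    · subst e
      rw [if_pos rfl] at hi
      interval_cases i
      · exact ⟨β₀, 0, fun x hx => by simpa using (hl x hx).1⟩
      · exact ⟨β₁, c, fun x hx => ⟨(hl x hx).2.1, (hl x hx).2.2.1⟩⟩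
    · rw [if_neg e, Nat.lt_one_iff] at hi
      subst hi
      exact ⟨α, 0, fun x hx => by simpa using (rauzy_map_of_ne h e hx).1⟩
  · rw [hrow, sum_rauzyMatrix_transpose]
    by_cases e : α = T.loser
    · subst e
      obtain ⟨h1, h2, h3, -⟩ := hl x hx
      rw [if_pos rfl, if_pos rfl, birkhoffSum_succ, birkhoffSum_one, Function.iterate_one, h2,
        loc_of_mem h.pos v h1, loc_of_mem h.pos v h3]
      rcases hβ with ⟨rfl, rfl⟩ | ⟨rfl, rfl⟩
      · rfl
      · exact add_comm _ _
    · rw [if_neg e, if_neg e, birkhoffSum_one, add_zero,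
        loc_of_mem h.pos v (rauzy_map_of_ne h e hx).1]
  · rw [hrow] at hi
    by_cases e : α = T.loser
    · subst e
      rw [if_pos rfl] at hi
      obtain rfl : i = 1 := by omega
      obtain ⟨-, h2, -, h4, -⟩ := hl x hx
      rw [Function.iterate_one, h2]
      exact fun hb => absurd hb.2 (not_lt.2 h4)
    · rw [if_neg e] at hi
      omega
  · rcases lt_or_ge z T.rauzy.total with hz' | hz'
    · obtain ⟨α, hα⟩ := exists_piece (T := T.rauzy) (x := z) ⟨hz.1, hz'⟩
      exact ⟨α, z, hα, 0, by rw [hrow]; split_ifs <;> norm_num, rfl⟩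
    · have hm : z - c ∈ T.rauzy.piece T.loser := by
        have := T.rauzy.right_eq T.loser
        have := rauzy_len_loser h
        exact ⟨by linarith, by linarith [hz.2]⟩
      refine ⟨T.loser, z - c, hm, 1, by rw [hrow, if_pos rfl]; norm_num, ?_⟩
      rw [Function.iterate_one, (hl _ hm).2.1]
      ring

theorem le_returnTime {S : IET 𝒜 d} {B : Matrix 𝒜 𝒜 ℕ} (hS : ∀ α, 0 < S.len α)
    {α : 𝒜} {x : ℝ} (hx : x ∈ S.piece α) {m : ℕ} (hm : 1 ≤ m) :
    rowSum B α ≤ returnTime S B m x := by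
  have h1 : returnTime S B 1 x = rowSum B α := by
    rw [returnTime, birkhoffSum_one, loc_of_mem hS _ hx]
  rw [← h1]
  exact Finset.sum_le_sum_of_subset (f := fun j => S.loc (rowSum B) (S.map^[j] x))
    (Finset.range_mono hm)

theorem rauzy_renormalizable {T : IET 𝒜 d} (h : T.Renormalizable) : T.rauzy.Renormalizable := by
  have hpos' := rauzy_pos h
  have htow := isTower_rauzy h
  have hmem : ∀ α, T.rauzy.left α ∈ T.rauzy.piece α := fun α => ⟨le_rfl, left_lt_right hpos' α⟩
  refine ⟨hpos', fun m hm α β hβ e => ?_, h.two_le⟩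
  -- every old left end point is on the orbit of the new one, before the first return
  have key : ∀ α, ∃ e < rowSum T.rauzyMatrix.transpose α, T.map^[e] (T.rauzy.left α) = T.left α := by
    intro α
    rw [rowSum_rauzyMatrix_transpose]
    rcases rauzy_left_cases h with ⟨-, -, h1, -, -⟩ | ⟨e1, e2, h1, h2, h3⟩
    · exact ⟨0, by split_ifs <;> norm_num, h1 α⟩
    · by_cases hα : α = T.loser
      · subst hα
        refine ⟨1, by simp, ?_⟩
        have hm : T.rauzy.left T.loser ∈ T.piece T.winner := by
          have := T.right_eq T.winner
          have := loser_lt_winner h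
          have := h.pos T.loser
          exact ⟨by linarith, by linarith⟩
        rw [Function.iterate_one, map_of_mem h.pos hm]
        linarith
      · exact ⟨0, by simp [hα], h2 α hα⟩
  obtain ⟨a, ha, ea⟩ := key α
  obtain ⟨b, -, eb⟩ := key β
  rw [htow.iterate_eq hpos' (piece_subset_base hpos' α (hmem α))] at e
  have hM := (le_returnTime (B := T.rauzyMatrix.transpose) hpos' (hmem α) hm)
  set M := returnTime T.rauzy T.rauzyMatrix.transpose m (T.rauzy.left α)
  have haM : a < M := ha.trans_le hM
  refine h.keane (b + (M - a)) (by omega) α β (fun h0 => hβ ?_) ?_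
  · simp only [rauzy]
    split_ifs
    · exact h0
    · rw [Equiv.trans_apply, move, Equiv.ofBijective_apply, moveFun, if_pos (by
        rw [Fin.le_def, h0]; exact Nat.zero_le _), h0]
  · rw [← ea, ← eb, ← e, ← Function.iterate_add_apply,
      show b + (M - a) + a = b + M by omega, Function.iterate_add_apply]

theorem iterate_rauzy_renormalizable {T : IET 𝒜 d} (h : T.Renormalizable) (n : ℕ) :
    (rauzy^[n] T).Renormalizable := by
  induction n with
  | zero => exact h
  | succ n ih => rw [Function.iterate_succ_apply']; exact rauzy_renormalizable ih

theorem isTower_iterate {T : IET 𝒜 d} (h : T.Renormalizable) (n : ℕ) :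
    IsTower T (rauzy^[n] T) (T.kz n).transpose := by
  induction n with
  | zero => simpa [kz] using isTower_one h.pos
  | succ n ih =>
    have hn := iterate_rauzy_renormalizable h n
    rw [Function.iterate_succ_apply', kz, Matrix.transpose_mul]
    exact ih.trans (isTower_rauzy hn) hn.pos (rauzy_renormalizable hn).pos

theorem kz_add (T : IET 𝒜 d) (n m : ℕ) : T.kz (n + m) = T.kz n * (rauzy^[n] T).kz m := by
  induction m with
  | zero => simp [kz]
  | succ m ih =>
    rw [← add_assoc, kz, ih, kz, Matrix.mul_assoc, add_comm n m, Function.iterate_add_apply]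

theorem acc_renormalizable {T : IET 𝒜 d} (h : T.Renormalizable) (n : ℕ → ℕ) (k : ℕ) :
    (T.acc n k).Renormalizable := iterate_rauzy_renormalizable h _

theorem isTower_acc {T : IET 𝒜 d} (h : T.Renormalizable) {n : ℕ → ℕ} (hn : IsAccelerating n)
    {k l : ℕ} (hkl : k ≤ l) : IsTower (T.acc n k) (T.acc n l) (T.Q n k l) := by
  have := isTower_iterate (acc_renormalizable h n k) (n l - n k)
  rwa [acc, ← Function.iterate_add_apply,
    Nat.sub_add_cancel (hn.strictMono.monotone hkl)] at this

theorem Q_mul (T : IET 𝒜 d) {n : ℕ → ℕ} (hn : IsAccelerating n) {j k l : ℕ} (hjk : j ≤ k)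
    (hkl : k ≤ l) : T.Q n j l = T.Q n k l * T.Q n j k := by
  have h1 := hn.strictMono.monotone hjk
  have h2 := hn.strictMono.monotone hkl
  rw [Q, Q, Q, ← Matrix.transpose_mul, acc, acc, show n l - n j = (n k - n j) + (n l - n k) by omega,
    kz_add, ← Function.iterate_add_apply, Nat.sub_add_cancel h1]

theorem acc_zero (T : IET 𝒜 d) {n : ℕ → ℕ} (hn : IsAccelerating n) : T.acc n 0 = T := by
  rw [acc, hn.zero]; rfl

theorem isTower_acc_zero {T : IET 𝒜 d} (h : T.Renormalizable) {n : ℕ → ℕ} (hn : IsAccelerating n)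
    (k : ℕ) : IsTower T (T.acc n k) (T.Q n 0 k) := by
  have := isTower_acc h hn (Nat.zero_le k)
  rwa [acc_zero T hn] at this

/-! ### Areas of the towers -/

theorem sum_rowSum_rauzy {T : IET 𝒜 d} (B : Matrix 𝒜 𝒜 ℕ) (h : T.Renormalizable) :
    ∑ α, (rowSum (T.rauzyMatrix.transpose * B) α : ℝ) * T.rauzy.len α =
      ∑ α, (rowSum B α : ℝ) * T.len α := by
  have hrow : ∀ α, rowSum (T.rauzyMatrix.transpose * B) α =
      rowSum B α + if α = T.loser then rowSum B T.winner else 0 := by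
    intro α
    rw [← T.sum_rauzyMatrix_transpose]
    simp only [rowSum, Matrix.mul_apply, Finset.mul_sum]
    exact Finset.sum_comm
  have hlen : ∀ α, T.rauzy.len α = T.len α - if α = T.winner then T.len T.loser else 0 := by
    intro α
    rw [rauzy_len, Function.update_apply]
    split_ifs with e
    · rw [e]
    · ring
  have : ∀ α, (rowSum (T.rauzyMatrix.transpose * B) α : ℝ) * T.rauzy.len α =
      (rowSum B α : ℝ) * T.len α + (if α = T.loser then rowSum B T.winner * T.len T.loser else 0) -
      (if α = T.winner then rowSum B T.winner * T.len T.loser else 0) := by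
    intro α
    rw [hrow, hlen]
    by_cases h1 : α = T.winner
    · have h2 : α ≠ T.loser := h1 ▸ winner_ne_loser h
      have h2' := winner_ne_loser h
      simp [h1, h2']
      ring
    · by_cases h2 : α = T.loser
      · have h2' := (winner_ne_loser h).symm
        simp [h2, h2']
        ring
      · simp [h1, h2]
  simp only [this, Finset.sum_sub_distrib, Finset.sum_add_distrib, Finset.sum_ite_eq',
    Finset.mem_univ, if_true]
  ring

/-- The towers over the renormalized intervals fill the interval. -/
theorem sum_height_mul_len {T : IET 𝒜 d} (h : T.Renormalizable) {n : ℕ → ℕ}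
    (hn : IsAccelerating n) (k : ℕ) :
    ∑ α, (T.height n k α : ℝ) * (T.acc n k).len α = T.total := by
  have key : ∀ N, ∑ α, (rowSum (T.kz N).transpose α : ℝ) * (rauzy^[N] T).len α = T.total := by
    intro N
    induction N with
    | zero => simp [kz, rowSum, Matrix.one_apply, total]
    | succ N ih =>
      rw [Function.iterate_succ_apply', kz, Matrix.transpose_mul,
        sum_rowSum_rauzy _ (iterate_rauzy_renormalizable h N), ih]
  have := key (n k)
  simpa [height, rowSum, Q, hn.zero, acc] using this

/-- With a single letter, a Rauzy step would leave nothing. -/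
theorem two_le_of_RTC {T : IET 𝒜 d} (hpos : ∀ α, 0 < T.len α) {n : ℕ → ℕ} (hn : IsAccelerating n)
    {δ : ℝ} (hδ : 0 < δ) (h : T.RTC n δ) : 2 ≤ d := by
  by_contra hd
  have hd1 : d = 1 := by have := NeZero.pos d; omega
  have hsub : ∀ α β : 𝒜, α = β := fun α β => (T.perm 0).injective (by
    have h1 := (T.perm 0 α).2
    have h2 := (T.perm 0 β).2
    rw [Fin.ext_iff]; omega)
  have hz : ∀ S : IET 𝒜 d, S.rauzy.total = 0 := by
    intro S
    rw [rauzy_total, total, Finset.sum_eq_single S.loser (fun b _ hb => absurd (hsub b _) hb)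
      (by simp), sub_self]
  have htot : 0 < T.total := Finset.sum_pos (fun α _ => hpos α) ⟨T.lastLetter 0, Finset.mem_univ _⟩
  obtain ⟨p, -, -, -, -, hp⟩ := h 1 le_rfl
  have : (T.acc n 1).total = 0 := by
    have h1 : 0 < n 1 := hn.zero ▸ hn.strictMono Nat.zero_lt_one
    obtain ⟨N, hN⟩ := Nat.exists_eq_succ_of_ne_zero h1.ne'
    rw [acc, hN, Function.iterate_succ_apply', hz]
  rw [this, mul_zero] at hp
  exact absurd hp (not_le.2 (mul_pos hδ htot))

end IET

/-! ### Sums over spaced points -/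

/-- Points spaced by at least `c` have distinct integer parts in units of `c`, so that a sum over
them is bounded by a sum over distinct integers. -/
theorem sum_le_sum_image_floor {s : Finset ℕ} {y f : ℕ → ℝ} {c : ℝ} (hc : 0 < c)
    (hy : ∀ i ∈ s, 0 ≤ y i) (hs : ∀ i ∈ s, ∀ j ∈ s, i ≠ j → c ≤ |y i - y j|) (F : ℕ → ℝ)
    (hF : ∀ i ∈ s, f i ≤ F ⌊y i / c⌋₊) :
    ∑ i ∈ s, f i ≤ ∑ n ∈ s.image fun i => ⌊y i / c⌋₊, F n := by
  rw [Finset.sum_image]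
  · exact Finset.sum_le_sum hF
  · intro i hi j hj e
    by_contra hne
    have h0 := div_nonneg (hy i hi) hc.le
    have h0' := div_nonneg (hy j hj) hc.le
    have h1 := Nat.floor_le h0
    have h2 := Nat.lt_floor_add_one (y i / c)
    have h3 := Nat.floor_le h0'
    have h4 := Nat.lt_floor_add_one (y j / c)
    simp only at e
    rw [e] at h1 h2
    have h5 : |y i / c - y j / c| < 1 := by rw [abs_lt]; constructor <;> linarith
    rw [← sub_div, abs_div, abs_of_pos hc, div_lt_one hc] at h5
    exact absurd (hs i hi j hj hne) (not_le.2 h5)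

/-- The sum `∑ n⁻ᵖ`; the term of `n = 0` vanishes. -/
noncomputable def powSum (p : ℝ) : ℝ := ∑' n : ℕ, (n : ℝ) ^ (-p)

theorem powSum_nonneg (p : ℝ) : 0 ≤ powSum p := tsum_nonneg fun n => by positivity

theorem sum_rpow_le_of_spaced {s : Finset ℕ} {y : ℕ → ℝ} {u p : ℝ} (hu : 0 < u) (hp : 1 < p)
    (hy : ∀ i ∈ s, u ≤ y i) (hs : ∀ i ∈ s, ∀ j ∈ s, i ≠ j → u ≤ |y i - y j|) :
    ∑ i ∈ s, y i ^ (-p) ≤ powSum p * u ^ (-p) := by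
  have h := sum_le_sum_image_floor (f := fun i => y i ^ (-p)) hu (fun i hi => hu.le.trans (hy i hi))
    hs (fun n => (n : ℝ) ^ (-p) * u ^ (-p)) fun i hi => by
      have h1 : 1 ≤ y i / u := (one_le_div hu).2 (hy i hi)
      have h2 : 1 ≤ ⌊y i / u⌋₊ := Nat.one_le_floor_iff _ |>.2 h1
      have h3 : (0 : ℝ) < ⌊y i / u⌋₊ := by exact_mod_cast h2
      rw [← Real.mul_rpow h3.le hu.le]
      refine Real.rpow_le_rpow_of_nonpos (by positivity) ?_ (by linarith)
      have := Nat.floor_le (zero_le_one.trans h1)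
      rwa [le_div_iff₀ hu] at this
  refine h.trans ?_
  rw [← Finset.sum_mul]
  refine mul_le_mul_of_nonneg_right ?_ (by positivity)
  exact (Real.summable_nat_rpow.2 (by linarith)).sum_le_tsum _ fun n _ => by positivity

theorem sum_Icc_rpow_le {a : ℝ} (ha0 : 0 < a) (ha : a < 1) (N : ℕ) :
    ∑ n ∈ Finset.Icc 1 N, (n : ℝ) ^ (-a) ≤ (N : ℝ) ^ (1 - a) / (1 - a) := by
  have h1a : 0 < 1 - a := by linarith
  induction N with
  | zero => simp [Real.zero_rpow h1a.ne']
  | succ N ih =>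
    rw [Finset.sum_Icc_succ_top (by omega)]
    have hN : (0 : ℝ) < (N : ℝ) + 1 := by positivity
    -- Bernoulli's inequality for the exponent `1 - a`
    have key : ((N : ℝ) + 1) ^ (-a) ≤ ((N : ℝ) + 1) ^ (1 - a) / (1 - a) - (N : ℝ) ^ (1 - a) / (1 - a) := by
      have h2 : (N : ℝ) / (N + 1) = 1 + (-(1 / ((N : ℝ) + 1))) := by field_simp; ring
      have h3 : ((N : ℝ) / (N + 1)) ^ (1 - a) ≤ 1 + (1 - a) * (-(1 / ((N : ℝ) + 1))) := by
        rw [h2]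
        refine rpow_one_add_le_one_add_mul_self ?_ h1a.le (by linarith)
        rw [neg_le_neg_iff, div_le_one hN]
        linarith [(Nat.cast_nonneg N : (0 : ℝ) ≤ N)]
      rw [Real.div_rpow (Nat.cast_nonneg N) hN.le, div_le_iff₀ (by positivity)] at h3
      have h4 : ((N : ℝ) + 1) ^ (1 - a) = ((N : ℝ) + 1) ^ (-a) * (N + 1) := by
        rw [← Real.rpow_add_one hN.ne']; congr 1; ring
      rw [← sub_div, le_div_iff₀ h1a]
      have h5 : (1 - a) * (1 / ((N : ℝ) + 1)) * ((N : ℝ) + 1) ^ (1 - a) =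
          ((N : ℝ) + 1) ^ (-a) * (1 - a) := by rw [h4]; field_simp
      nlinarith
    push_cast
    linarith

/-- At most one of the points is below `c`, and its term carries the truncation at `σ`; the other
terms are bounded by a Riemann sum of an integrable power. -/
theorem sum_min_rpow_le_of_spaced {s : Finset ℕ} {y : ℕ → ℝ} {u c L σ a : ℝ} (hu : 0 < u)
    (hc : 0 < c) (hL : 0 ≤ L) (hσ : 0 ≤ σ) (ha0 : 0 < a) (ha : a < 1) (hy : ∀ i ∈ s, u ≤ y i ∧ y i ≤ L)
    (hs : ∀ i ∈ s, ∀ j ∈ s, i ≠ j → c ≤ |y i - y j|) :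
    ∑ i ∈ s, min σ (y i ^ (-a)) ≤ min σ (u ^ (-a)) + L ^ (1 - a) / (1 - a) / c := by
  have h1a : 0 < 1 - a := by linarith
  let F : ℕ → ℝ := fun n => if n = 0 then min σ (u ^ (-a)) else c ^ (-a) * (n : ℝ) ^ (-a)
  have hF0 : ∀ n, 0 ≤ F n := fun n => by
    simp only [F]
    split_ifs
    · exact le_min hσ (by positivity)
    · positivity
  have h := sum_le_sum_image_floor (f := fun i => min σ (y i ^ (-a))) hc
    (fun i hi => hu.le.trans (hy i hi).1) hs F fun i hi => by
      simp only [F]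
      have hyi := hu.trans_le (hy i hi).1
      split_ifs with h0
      · exact min_le_min_left _ (Real.rpow_le_rpow_of_nonpos hu (hy i hi).1 (by linarith))
      · have h3 : (0 : ℝ) < ⌊y i / c⌋₊ := by exact_mod_cast Nat.pos_of_ne_zero h0
        refine (min_le_right _ _).trans ?_
        rw [← Real.mul_rpow hc.le h3.le]
        refine Real.rpow_le_rpow_of_nonpos (by positivity) ?_ (by linarith)
        have := Nat.floor_le (div_nonneg hyi.le hc.le)
        rw [le_div_iff₀ hc] at this
        linarith
  refine h.trans ?_
  set N := ⌊L / c⌋₊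
  have hsub : (s.image fun i => ⌊y i / c⌋₊) ⊆ insert 0 (Finset.Icc 1 N) := by
    intro n hn
    obtain ⟨i, hi, rfl⟩ := Finset.mem_image.1 hn
    have : ⌊y i / c⌋₊ ≤ N := Nat.floor_le_floor (by
      have := (hy i hi).2
      gcongr)
    simp only [Finset.mem_insert, Finset.mem_Icc]
    omega
  refine (Finset.sum_le_sum_of_subset_of_nonneg hsub fun n _ _ => hF0 n).trans ?_
  rw [Finset.sum_insert (by simp)]
  have hF1 : ∑ n ∈ Finset.Icc 1 N, F n = c ^ (-a) * ∑ n ∈ Finset.Icc 1 N, (n : ℝ) ^ (-a) := by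
    rw [Finset.mul_sum]
    refine Finset.sum_congr rfl fun n hn => if_neg ?_
    have := (Finset.mem_Icc.1 hn).1
    omega
  rw [hF1]
  refine add_le_add (by simp [F]) ?_
  calc c ^ (-a) * ∑ n ∈ Finset.Icc 1 N, (n : ℝ) ^ (-a)
      ≤ c ^ (-a) * ((L / c) ^ (1 - a) / (1 - a)) := by
        refine mul_le_mul_of_nonneg_left ((sum_Icc_rpow_le ha0 ha N).trans ?_) (by positivity)
        refine div_le_div_of_nonneg_right ?_ h1a.le
        exact Real.rpow_le_rpow (by positivity) (Nat.floor_le (by positivity)) h1a.le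
    _ = L ^ (1 - a) / (1 - a) / c := by
        rw [Real.div_rpow hL hc.le, Real.rpow_sub hc, Real.rpow_one, Real.rpow_neg hc.le]
        field_simp

/-! ### Functions with power-type derivative bounds -/

theorem abs_sub_le_of_deriv_le_rpow {F : ℝ → ℝ} {l x m C b : ℝ} (hb : 0 < b) (hlx : l < x)
    (hxm : x ≤ m) (hF : ∀ y ∈ Icc x m, DifferentiableAt ℝ F y)
    (hF' : ∀ y ∈ Icc x m, |deriv F y| ≤ C * (y - l) ^ (-(1 + b))) :
    |F x - F m| ≤ C / b * (x - l) ^ (-b) := by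
  have hC : 0 ≤ C := by
    have h1 := (abs_nonneg _).trans (hF' x ⟨le_rfl, hxm⟩)
    exact nonneg_of_mul_nonneg_left h1 (Real.rpow_pos_of_pos (by linarith) _)
  -- `G ± F` is antitone for `G y = C / b * (y - l) ^ (-b)`
  have key : ∀ e : ℝ, |e| = 1 → e * F m - e * F x ≤ C / b * (x - l) ^ (-b) := by
    intro e he
    have hd : ∀ y ∈ Icc x m, HasDerivAt (fun y => e * F y + C / b * (y - l) ^ (-b))
        (e * deriv F y + C / b * (1 * (-b) * (y - l) ^ (-b - 1))) y := by
      intro y hy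
      have h1 : y - l ≠ 0 := by linarith [hy.1]
      exact ((hF y hy).hasDerivAt.const_mul e).add
        ((((hasDerivAt_id y).sub_const l).rpow_const (Or.inl h1)).const_mul _)
    have hanti : AntitoneOn (fun y => e * F y + C / b * (y - l) ^ (-b)) (Icc x m) := by
      refine antitoneOn_of_deriv_nonpos (convex_Icc x m)
        (fun y hy => (hd y hy).continuousAt.continuousWithinAt)
        (fun y hy => (hd y (interior_subset hy)).differentiableAt.differentiableWithinAt)
        fun y hy => ?_
      have hy := interior_subset hy
      rw [(hd y hy).deriv]
      have h2 : e * deriv F y ≤ C * (y - l) ^ (-(1 + b)) := by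
        refine (le_abs_self _).trans ?_
        rw [abs_mul, he, one_mul]
        exact hF' y hy
      have h3 : C / b * (1 * (-b) * (y - l) ^ (-b - 1)) = - (C * (y - l) ^ (-(1 + b))) := by
        rw [show -b - 1 = -(1 + b) by ring]
        field_simp
      linarith
    have h4 := hanti ⟨le_rfl, hxm⟩ ⟨hxm, le_rfl⟩ hxm
    have h5 : 0 ≤ C / b * (m - l) ^ (-b) :=
      mul_nonneg (by positivity) (Real.rpow_nonneg (by linarith) _)
    simp only at h4
    linarith
  have h1 := key 1 (by simp)
  have h2 := key (-1) (by simp)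
  rw [abs_le]
  constructor <;> linarith

/-- A bound on the derivative by the power `-(1 + b)` of the distance to the end points bounds the
function by the power `-b`. -/
theorem abs_sub_mid_le {F : ℝ → ℝ} {l r x C b : ℝ} (hb : 0 < b)
    (hF : ∀ y ∈ Ioo l r, DifferentiableAt ℝ F y)
    (hF' : ∀ y ∈ Ioo l r, |deriv F y| ≤ C * (min (y - l) (r - y)) ^ (-(1 + b)))
    (hx : x ∈ Ioo l r) :
    |F x - F ((l + r) / 2)| ≤ C / b * (min (x - l) (r - x)) ^ (-b) := by
  have hlr := hx.1.trans hx.2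
  rcases le_total x ((l + r) / 2) with h | h
  · rw [min_eq_left (by linarith)]
    refine abs_sub_le_of_deriv_le_rpow hb hx.1 h
      (fun y hy => hF y ⟨by linarith [hy.1, hx.1], by linarith [hy.2]⟩) fun y hy => ?_
    have := hF' y ⟨by linarith [hy.1, hx.1], by linarith [hy.2]⟩
    rwa [min_eq_left (by linarith [hy.2])] at this
  · rw [min_eq_right (by linarith)]
    have hI : ∀ y ∈ Icc (-x) (-((l + r) / 2)), -y ∈ Ioo l r := fun y hy =>
      ⟨by linarith [hy.2], by linarith [hy.1, hx.2]⟩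
    have := abs_sub_le_of_deriv_le_rpow (F := fun y => F (-y)) (l := -r) (x := -x)
      (m := -((l + r) / 2)) (C := C) hb (by linarith [hx.2]) (by linarith) (fun y hy =>
        (hF (-y) (hI y hy)).comp y (differentiable_neg y)) fun y hy => ?_
    · simpa only [neg_neg, show -x - -r = r - x by ring] using this
    · rw [deriv_comp_neg, abs_neg]
      have h1 := hF' (-y) (hI y hy)
      rwa [min_eq_right (by linarith [hy.1, hy.2]), show r - -y = y - -r by ring] at h1

theorem intervalIntegrable_sub_rpow {l r b : ℝ} (hb : b < 1) :
    IntervalIntegrable (fun x => (x - l) ^ (-b)) volume l r := by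
  have := (intervalIntegral.intervalIntegrable_rpow' (a := l - l) (b := r - l) (r := -b)
    (by linarith)).comp_sub_right l
  simpa using this

theorem intervalIntegrable_rpow_sub {l r b : ℝ} (hb : b < 1) :
    IntervalIntegrable (fun x => (r - x) ^ (-b)) volume l r := by
  have := (intervalIntegral.intervalIntegrable_rpow' (a := r - l) (b := r - r) (r := -b)
    (by linarith)).comp_sub_left r
  simpa using this

theorem integral_sub_rpow {l r b : ℝ} (hb : b < 1) :
    ∫ x in l..r, (x - l) ^ (-b) = (r - l) ^ (1 - b) / (1 - b) := by
  have h := intervalIntegral.integral_comp_sub_right (a := l) (b := r) (fun x => x ^ (-b)) l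
  rw [h, sub_self, integral_rpow (Or.inl (by linarith)), Real.zero_rpow (by linarith)]
  ring_nf

theorem integral_rpow_sub {l r b : ℝ} (hb : b < 1) :
    ∫ x in l..r, (r - x) ^ (-b) = (r - l) ^ (1 - b) / (1 - b) := by
  have h := intervalIntegral.integral_comp_sub_left (a := l) (b := r) (fun x => x ^ (-b)) r
  rw [h, sub_self, integral_rpow (Or.inl (by linarith)), Real.zero_rpow (by linarith)]
  ring_nf

theorem min_rpow_neg_le_add {p q b : ℝ} (hp : 0 ≤ p) (hq : 0 ≤ q) :
    (min p q) ^ (-b) ≤ p ^ (-b) + q ^ (-b) := by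
  rcases le_total p q with h | h
  · rw [min_eq_left h]; linarith [Real.rpow_nonneg hq (-b)]
  · rw [min_eq_right h]; linarith [Real.rpow_nonneg hp (-b)]

theorem integrableOn_gap {l r b : ℝ} (hlr : l ≤ r) (hb : b < 1) :
    IntegrableOn (fun x => (x - l) ^ (-b) + (r - x) ^ (-b)) (Ico l r) := by
  have := (intervalIntegrable_sub_rpow (l := l) (r := r) hb).add
    (intervalIntegrable_rpow_sub (l := l) (r := r) hb)
  rw [intervalIntegrable_iff_integrableOn_Ico_of_le hlr] at this
  exact this

theorem integral_gap {l r b : ℝ} (hlr : l ≤ r) (hb : b < 1) :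
    ∫ x in Ico l r, ((x - l) ^ (-b) + (r - x) ^ (-b)) = 2 / (1 - b) * (r - l) ^ (1 - b) := by
  rw [integral_Ico_eq_integral_Ioc, ← intervalIntegral.integral_of_le hlr,
    intervalIntegral.integral_add (intervalIntegrable_sub_rpow hb) (intervalIntegrable_rpow_sub hb),
    integral_sub_rpow hb, integral_rpow_sub hb]
  ring

namespace IET

variable {𝒜 : Type*} [Fintype 𝒜] [DecidableEq 𝒜] {d : ℕ}

/-! ### Birkhoff sums along the floors of a tower -/

/-- The distance from `x` to the end points of the exchanged interval that contains `x`
(and `0` outside of the base). -/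
noncomputable def gap (T : IET 𝒜 d) (x : ℝ) : ℝ :=
  ∑ α, (T.piece α).indicator (fun y => min (y - T.left α) (T.right α - y)) x

theorem gap_of_mem {T : IET 𝒜 d} (hT : ∀ α, 0 < T.len α) {α : 𝒜} {x : ℝ} (hx : x ∈ T.piece α) :
    T.gap x = min (x - T.left α) (T.right α - x) := by
  rw [gap, Finset.sum_eq_single α, indicator_of_mem hx]
  · intro β _ hβ
    exact indicator_of_notMem (fun h => hβ (piece_unique hT h hx)) _
  · simp

theorem gap_pos {T : IET 𝒜 d} (hT : ∀ α, 0 < T.len α) {α : 𝒜} {x : ℝ}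
    (hx : x ∈ Ioo (T.left α) (T.right α)) : 0 < T.gap x := by
  rw [gap_of_mem hT ⟨hx.1.le, hx.2⟩]
  exact lt_min (by linarith [hx.1]) (by linarith [hx.2])

theorem exists_of_gap_pos {T : IET 𝒜 d} (hT : ∀ α, 0 < T.len α) {x : ℝ} (hx : 0 < T.gap x) :
    ∃ α, x ∈ Ioo (T.left α) (T.right α) := by
  obtain ⟨α, -, hα⟩ := Finset.exists_ne_zero_of_sum_ne_zero hx.ne'
  have hm : x ∈ T.piece α := mem_of_indicator_ne_zero hα
  rw [gap_of_mem hT hm, lt_min_iff] at hx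
  exact ⟨α, by linarith, by linarith⟩

theorem gap_nonneg (T : IET 𝒜 d) (x : ℝ) : 0 ≤ T.gap x := by
  refine Finset.sum_nonneg fun α _ => indicator_nonneg (fun y hy => ?_) x
  exact le_min (by linarith [hy.1]) (by linarith [hy.2])

theorem measurable_gap (T : IET 𝒜 d) : Measurable T.gap := by
  refine Finset.measurable_sum _ fun α _ => ?_
  exact ((measurable_id.sub_const _).min (measurable_const.sub measurable_id)).indicator
    (T.measurableSet_piece α)

theorem gap_le_len {T : IET 𝒜 d} (hT : ∀ α, 0 < T.len α) {α : 𝒜} {x : ℝ} (hx : x ∈ T.piece α) :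
    T.gap x ≤ T.len α := by
  rw [gap_of_mem hT hx]
  have := T.right_eq α
  exact (min_le_left _ _).trans (by linarith [hx.2])

theorem total_pos {T : IET 𝒜 d} (hT : ∀ α, 0 < T.len α) [Nonempty 𝒜] : 0 < T.total :=
  Finset.sum_pos (fun α _ => hT α) Finset.univ_nonempty

section Tower

variable {T S : IET 𝒜 d} {B : Matrix 𝒜 𝒜 ℕ}

/-- A floor of a tower is a translate of its base inside an interval exchanged by `T`. -/
theorem IsTower.exists_floor (h : IsTower T S B) (hS : ∀ α, 0 < S.len α) {α : 𝒜} {i : ℕ}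
    (hi : i < rowSum B α) : ∃ β c, T.left β ≤ S.left α + c ∧ S.right α + c ≤ T.right β ∧
      ∀ x ∈ S.piece α, T.map^[i] x = x + c ∧ x + c ∈ T.piece β := by
  obtain ⟨β, c, hc⟩ := h.floor α i hi
  have hlr := left_lt_right hS α
  have hsub : Ico (S.left α + c) (S.right α + c) ⊆ Ico (T.left β) (T.right β) := by
    intro y hy
    have := (hc (y - c) ⟨by linarith [hy.1], by linarith [hy.2]⟩).2
    rwa [sub_add_cancel] at this
  have := (Ico_subset_Ico_iff (by linarith)).1 hsub
  exact ⟨β, c, this.1, this.2, hc⟩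

theorem IsTower.gap_le (h : IsTower T S B) (hT : ∀ α, 0 < T.len α) (hS : ∀ α, 0 < S.len α)
    {α : 𝒜} {x : ℝ} (hx : x ∈ S.piece α) {i : ℕ} (hi : i < rowSum B α) :
    S.gap x ≤ T.gap (T.map^[i] x) := by
  obtain ⟨β, c, h1, h2, hc⟩ := h.exists_floor hS hi
  obtain ⟨h3, h4⟩ := hc x hx
  rw [h3, gap_of_mem hT h4, gap_of_mem hS hx]
  exact min_le_min (by linarith) (by linarith)

theorem IsTower.len_le_abs_sub (h : IsTower T S B) (hT : ∀ α, 0 < T.len α)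
    (hS : ∀ α, 0 < S.len α) {α : 𝒜} {x : ℝ} (hx : x ∈ S.piece α) {i j : ℕ}
    (hi : i < rowSum B α) (hj : j < rowSum B α) (hij : i ≠ j) :
    S.len α ≤ |T.map^[i] x - T.map^[j] x| := by
  by_contra hlt
  push Not at hlt
  obtain ⟨β, c, hc⟩ := h.floor α i hi
  obtain ⟨β', c', hc'⟩ := h.floor α j hj
  rw [(hc x hx).1, (hc' x hx).1, abs_lt] at hlt
  have hne : ∀ y ∈ S.piece α, ∀ z ∈ S.piece α, T.map^[i] y ≠ T.map^[j] z := by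
    intro y hy z hz
    rcases lt_or_gt_of_ne hij with hij | hij
    · exact h.iterate_ne hT hS hy hz hij hj
    · exact (h.iterate_ne hT hS hz hy hij hi).symm
  have hr := S.right_eq α
  have hlen := hS α
  -- two translates of the same interval by less than its length meet
  rcases le_total c c' with hcc | hcc
  · have m1 : S.left α + (c' - c) ∈ S.piece α := ⟨by linarith, by linarith⟩
    have m2 : S.left α ∈ S.piece α := ⟨le_rfl, by linarith⟩
    refine hne _ m1 _ m2 ?_
    rw [(hc _ m1).1, (hc' _ m2).1]; ring
  · have m1 : S.left α + (c - c') ∈ S.piece α := ⟨by linarith, by linarith⟩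
    have m2 : S.left α ∈ S.piece α := ⟨le_rfl, by linarith⟩
    refine hne _ m2 _ m1 ?_
    rw [(hc _ m2).1, (hc' _ m1).1]; ring

/-- Along the floors of a tower, a function `G` of the distance to the singularities is bounded
through sums over spaced points, one for each singularity and each side. -/
theorem IsTower.sum_gap_le (h : IsTower T S B) (hT : ∀ α, 0 < T.len α) (hS : ∀ α, 0 < S.len α)
    {α : 𝒜} {x : ℝ} (hx : x ∈ Ioo (S.left α) (S.right α)) {G : ℝ → ℝ} (hG : ∀ y > 0, 0 ≤ G y)
    {M : ℝ} (hM : ∀ (s : Finset ℕ) (y : ℕ → ℝ), (∀ i ∈ s, S.gap x ≤ y i ∧ y i ≤ T.total) →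
      (∀ i ∈ s, ∀ j ∈ s, i ≠ j → S.len α ≤ |y i - y j|) → ∑ i ∈ s, G (y i) ≤ M) :
    ∑ i ∈ Finset.range (rowSum B α), G (T.gap (T.map^[i] x)) ≤ Fintype.card 𝒜 * (2 * M) := by
  classical
  have hxp : x ∈ S.piece α := ⟨hx.1.le, hx.2⟩
  have hgap := gap_pos hS hx
  let s : 𝒜 → Finset ℕ := fun β =>
    (Finset.range (rowSum B α)).filter fun i => T.map^[i] x ∈ T.piece β
  have hs : ∀ β, ∀ i ∈ s β, i < rowSum B α ∧ T.map^[i] x ∈ T.piece β := fun β i hi => by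
    simpa [s] using hi
  have hb : ∀ β, ∀ i ∈ s β, S.gap x ≤ T.map^[i] x - T.left β ∧
      S.gap x ≤ T.right β - T.map^[i] x ∧ T.map^[i] x - T.left β ≤ T.total ∧
      T.right β - T.map^[i] x ≤ T.total := by
    intro β i hi
    obtain ⟨h1, h2⟩ := hs β i hi
    have h3 := h.gap_le hT hS hxp h1
    rw [gap_of_mem hT h2] at h3
    have h4 := right_le_total hT β
    have h5 := left_nonneg hT β
    exact ⟨h3.trans (min_le_left _ _), h3.trans (min_le_right _ _), by linarith [h2.2],
      by linarith [h2.1]⟩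
  have hsum : ∑ i ∈ Finset.range (rowSum B α), G (T.gap (T.map^[i] x)) ≤
      ∑ β, ∑ i ∈ s β, G (T.gap (T.map^[i] x)) := by
    rw [← Finset.sum_biUnion]
    · refine Finset.sum_le_sum_of_subset_of_nonneg (fun i hi => ?_) fun i hi _ => ?_
      · have hi' := Finset.mem_range.1 hi
        obtain ⟨β, c, hc⟩ := h.floor α i hi'
        simp only [Finset.mem_biUnion, Finset.mem_univ, true_and]
        exact ⟨β, Finset.mem_filter.2 ⟨hi, (hc x hxp).1 ▸ (hc x hxp).2⟩⟩
      · simp only [Finset.mem_biUnion, Finset.mem_univ, true_and] at hi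
        obtain ⟨β, hi⟩ := hi
        exact hG _ (hgap.trans_le (h.gap_le hT hS hxp (hs β i hi).1))
    · intro β _ β' _ hne
      exact Finset.disjoint_left.2 fun i hi hi' => hne (piece_unique hT (hs β i hi).2 (hs β' i hi').2)
  refine hsum.trans ?_
  rw [← nsmul_eq_mul, ← Finset.card_univ]
  refine Finset.sum_le_card_nsmul _ _ _ fun β _ => ?_
  have h1 := hM (s β) (fun i => T.map^[i] x - T.left β) (fun i hi => ⟨(hb β i hi).1, (hb β i hi).2.2.1⟩)
    fun i hi j hj hij => by
      rw [sub_sub_sub_cancel_right]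
      exact h.len_le_abs_sub hT hS hxp (hs β i hi).1 (hs β j hj).1 hij
  have h2 := hM (s β) (fun i => T.right β - T.map^[i] x)
    (fun i hi => ⟨(hb β i hi).2.1, (hb β i hi).2.2.2⟩)
    fun i hi j hj hij => by
      rw [sub_sub_sub_cancel_left, abs_sub_comm]
      exact h.len_le_abs_sub hT hS hxp (hs β i hi).1 (hs β j hj).1 hij
  calc ∑ i ∈ s β, G (T.gap (T.map^[i] x))
      ≤ ∑ i ∈ s β, (G (T.map^[i] x - T.left β) + G (T.right β - T.map^[i] x)) := by
        refine Finset.sum_le_sum fun i hi => ?_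
        have h3 := hG _ (hgap.trans_le (hb β i hi).1)
        have h4 := hG _ (hgap.trans_le (hb β i hi).2.1)
        rw [gap_of_mem hT (hs β i hi).2]
        rcases min_choice (T.map^[i] x - T.left β) (T.right β - T.map^[i] x) with e | e <;>
          rw [e] <;> linarith
    _ ≤ 2 * M := by rw [Finset.sum_add_distrib]; linarith

theorem IsTower.sum_gap_rpow_le (h : IsTower T S B) (hT : ∀ α, 0 < T.len α)
    (hS : ∀ α, 0 < S.len α) {α : 𝒜} {x : ℝ} (hx : x ∈ Ioo (S.left α) (S.right α)) {p : ℝ}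
    (hp : 1 < p) : ∑ i ∈ Finset.range (rowSum B α), T.gap (T.map^[i] x) ^ (-p) ≤
      Fintype.card 𝒜 * (2 * (powSum p * S.gap x ^ (-p))) := by
  refine h.sum_gap_le hT hS hx (G := fun y => y ^ (-p)) (fun y hy => by positivity)
    fun s y hy hs => ?_
  exact sum_rpow_le_of_spaced (gap_pos hS hx) hp (fun i hi => (hy i hi).1)
    fun i hi j hj hij => (gap_le_len hS ⟨hx.1.le, hx.2⟩).trans (hs i hi j hj hij)

theorem IsTower.sum_min_gap_rpow_le (h : IsTower T S B) (hT : ∀ α, 0 < T.len α)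
    (hS : ∀ α, 0 < S.len α) {α : 𝒜} {x : ℝ} (hx : x ∈ Ioo (S.left α) (S.right α)) {a σ : ℝ}
    (ha0 : 0 < a) (ha : a < 1) (hσ : 0 ≤ σ) :
    ∑ i ∈ Finset.range (rowSum B α), min σ (T.gap (T.map^[i] x) ^ (-a)) ≤
      Fintype.card 𝒜 * (2 * (min σ (S.gap x ^ (-a)) + T.total ^ (1 - a) / (1 - a) / S.len α)) := by
  refine h.sum_gap_le hT hS hx (G := fun y => min σ (y ^ (-a)))
    (fun y hy => le_min hσ (by positivity)) fun s y hy hs => ?_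
  exact sum_min_rpow_le_of_spaced (gap_pos hS hx) (hS α)
    (Finset.sum_nonneg fun α _ => (hT α).le) hσ ha0 ha hy hs

/-- `φ` is differentiable inside the exchanged intervals, with derivative bounded by the power
`-(1 + b)` of the distance to the end points. -/
def PowDeriv (T : IET 𝒜 d) (b K : ℝ) (φ : ℝ → ℝ) : Prop :=
  ∀ z, 0 < T.gap z → DifferentiableAt ℝ φ z ∧ |deriv φ z| ≤ K * T.gap z ^ (-(1 + b))

theorem MemPaWith.powDeriv (hT : ∀ α, 0 < T.len α) {b : ℝ} {φ : ℝ → ℝ} {Cp Cm : 𝒜 → ℝ}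
    (h : T.MemPaWith b φ Cp Cm) : ∃ K, 0 ≤ K ∧ T.PowDeriv b K φ := by
  obtain ⟨K, hK⟩ := h.bound
  refine ⟨max K 0, le_max_right _ _, fun z hz => ?_⟩
  obtain ⟨α, hα⟩ := exists_of_gap_pos hT hz
  have hz' := hz
  rw [gap_of_mem hT ⟨hα.1.le, hα.2⟩] at hz ⊢
  have hcd := (h.contDiffOn α).contDiffAt (isOpen_Ioo.mem_nhds hα)
  refine ⟨hcd.differentiableAt (by norm_num), ?_⟩
  have key : ∀ y : ℝ, 0 < y → |deriv φ z * y ^ (1 + b)| ≤ K →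
      |deriv φ z| ≤ max K 0 * y ^ (-(1 + b)) := by
    intro y hy hle
    have hp : 0 < y ^ (1 + b) := Real.rpow_pos_of_pos hy _
    rw [abs_mul, abs_of_pos hp] at hle
    rw [Real.rpow_neg hy.le, ← div_eq_mul_inv, le_div_iff₀ hp]
    exact hle.trans (le_max_left _ _)
  rw [lt_min_iff] at hz
  rcases le_total z (T.mid α) with hm | hm
  · have e : min (z - T.left α) (T.right α - z) = z - T.left α :=
      min_eq_left (by unfold mid at hm; linarith)
    rw [e]
    exact key _ hz.1 ((hK α).1 z ⟨hα.1, hm⟩)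
  · have e : min (z - T.left α) (T.right α - z) = T.right α - z :=
      min_eq_right (by unfold mid at hm; linarith)
    rw [e]
    exact key _ hz.2 ((hK α).2 z ⟨hm, hα.2⟩)

theorem IsTower.hasDerivAt_birkhoffSum (h : IsTower T S B) (hT : ∀ α, 0 < T.len α)
    (hS : ∀ α, 0 < S.len α) {φ : ℝ → ℝ} (hφ : ∀ z, 0 < T.gap z → DifferentiableAt ℝ φ z) {α : 𝒜}
    {x : ℝ} (hx : x ∈ Ioo (S.left α) (S.right α)) :
    HasDerivAt (birkhoffSum T.map φ (rowSum B α))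
      (∑ i ∈ Finset.range (rowSum B α), deriv φ (T.map^[i] x)) x := by
  have hxp : x ∈ S.piece α := ⟨hx.1.le, hx.2⟩
  have hfl : ∀ i, ∃ c, i < rowSum B α → ∀ y ∈ S.piece α, T.map^[i] y = y + c := by
    intro i
    by_cases hi : i < rowSum B α
    · obtain ⟨β, c, hc⟩ := h.floor α i hi
      exact ⟨c, fun _ y hy => (hc y hy).1⟩
    · exact ⟨0, fun hi' => absurd hi' hi⟩
  choose c hc using hfl
  have hev : (fun y => ∑ i ∈ Finset.range (rowSum B α), φ (y + c i)) =ᶠ[𝓝 x]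
      birkhoffSum T.map φ (rowSum B α) := by
    filter_upwards [isOpen_Ioo.mem_nhds hx] with y hy
    refine Finset.sum_congr rfl fun i hi => ?_
    rw [hc i (Finset.mem_range.1 hi) y ⟨hy.1.le, hy.2⟩]
  refine HasDerivAt.congr_of_eventuallyEq ?_ hev.symm
  refine HasDerivAt.fun_sum fun i hi => ?_
  have hi := Finset.mem_range.1 hi
  have h1 := hφ (T.map^[i] x) ((gap_pos hS hx).trans_le (h.gap_le hT hS hxp hi))
  rw [hc i hi x hxp] at h1 ⊢
  exact h1.hasDerivAt.comp_add_const x (c i)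

/-- The constant in the bound of special Birkhoff sums. -/
noncomputable def towerConst (N : ℕ) (b K : ℝ) : ℝ := K * (N * (2 * powSum (1 + b))) / b

theorem towerConst_nonneg (N : ℕ) {b K : ℝ} (hb : 0 < b) (hK : 0 ≤ K) : 0 ≤ towerConst N b K := by
  have := powSum_nonneg (1 + b)
  unfold towerConst
  positivity

/-- Birkhoff sums along a tower vary as little as a single term closest to the singularities. -/
theorem IsTower.abs_birkhoffSum_sub_le (h : IsTower T S B) (hT : ∀ α, 0 < T.len α)
    (hS : ∀ α, 0 < S.len α) {b K : ℝ} (hb : 0 < b) (hK : 0 ≤ K) {φ : ℝ → ℝ}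
    (hφ : T.PowDeriv b K φ) {α : 𝒜} {x : ℝ} (hx : x ∈ Ioo (S.left α) (S.right α)) :
    |birkhoffSum T.map φ (rowSum B α) x - birkhoffSum T.map φ (rowSum B α) (S.mid α)| ≤
      towerConst (Fintype.card 𝒜) b K * S.gap x ^ (-b) := by
  have hd := fun y (hy : y ∈ Ioo (S.left α) (S.right α)) =>
    h.hasDerivAt_birkhoffSum hT hS (fun z hz => (hφ z hz).1) hy
  rw [gap_of_mem hS ⟨hx.1.le, hx.2⟩]
  refine abs_sub_mid_le hb (fun y hy => (hd y hy).differentiableAt) (fun y hy => ?_) hx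
  have hyp : y ∈ S.piece α := ⟨hy.1.le, hy.2⟩
  rw [(hd y hy).deriv, ← gap_of_mem hS hyp]
  calc |∑ i ∈ Finset.range (rowSum B α), deriv φ (T.map^[i] y)|
      ≤ ∑ i ∈ Finset.range (rowSum B α), |deriv φ (T.map^[i] y)| := Finset.abs_sum_le_sum_abs _ _
    _ ≤ ∑ i ∈ Finset.range (rowSum B α), K * T.gap (T.map^[i] y) ^ (-(1 + b)) :=
        Finset.sum_le_sum fun i hi => (hφ _ ((gap_pos hS hy).trans_le
          (h.gap_le hT hS hyp (Finset.mem_range.1 hi)))).2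
    _ ≤ K * (Fintype.card 𝒜 * (2 * (powSum (1 + b) * S.gap y ^ (-(1 + b))))) := by
        rw [← Finset.mul_sum]
        exact mul_le_mul_of_nonneg_left (h.sum_gap_rpow_le hT hS hy (by linarith)) hK
    _ = _ := by ring

theorem gap_rpow_le_add (hS : ∀ α, 0 < S.len α) {b : ℝ} {α : 𝒜} {x : ℝ} (hx : x ∈ S.piece α) :
    S.gap x ^ (-b) ≤ (x - S.left α) ^ (-b) + (S.right α - x) ^ (-b) := by
  rw [gap_of_mem hS hx]
  exact min_rpow_neg_le_add (by linarith [hx.1]) (by linarith [hx.2])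

/-- A special Birkhoff sum is bounded by its mean value and the distance to the singularities. -/
theorem IsTower.abs_birkhoffSum_le (h : IsTower T S B) (hT : ∀ α, 0 < T.len α)
    (hS : ∀ α, 0 < S.len α) {b K : ℝ} (hb : 0 < b) (hb1 : b < 1) (hK : 0 ≤ K) {φ : ℝ → ℝ}
    (hφ : T.PowDeriv b K φ) {α : 𝒜} {x : ℝ} (hx : x ∈ Ioo (S.left α) (S.right α)) :
    |birkhoffSum T.map φ (rowSum B α) x| ≤
      |(∫ y in S.piece α, birkhoffSum T.map φ (rowSum B α) y) / S.len α| +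
        towerConst (Fintype.card 𝒜) b K * (1 + 2 / (1 - b)) * S.gap x ^ (-b) := by
  set F := birkhoffSum T.map φ (rowSum B α)
  set C := towerConst (Fintype.card 𝒜) b K
  have hC : 0 ≤ C := towerConst_nonneg _ hb hK
  have hlen := hS α
  have hlr := left_lt_right hS α
  have hr := S.right_eq α
  have h1b : 0 < 1 - b := by linarith
  have hosc := fun y (hy : y ∈ Ioo (S.left α) (S.right α)) =>
    h.abs_birkhoffSum_sub_le hT hS hb hK hφ hy
  have hD := (integrableOn_gap hlr.le hb1).const_mul C
  have hbound : ∀ᵐ y ∂volume.restrict (S.piece α), ‖F y - F (S.mid α)‖ ≤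
      C * ((y - S.left α) ^ (-b) + (S.right α - y) ^ (-b)) := by
    rw [piece, ← restrict_Ioo_eq_restrict_Ico]
    refine (ae_restrict_iff' measurableSet_Ioo).2 (Eventually.of_forall fun y hy => ?_)
    exact (hosc y hy).trans
      (mul_le_mul_of_nonneg_left (gap_rpow_le_add hS ⟨hy.1.le, hy.2⟩) hC)
  have hmeas : AEStronglyMeasurable (fun y => F y - F (S.mid α)) (volume.restrict (S.piece α)) := by
    rw [piece, ← restrict_Ioo_eq_restrict_Ico]
    refine ContinuousOn.aestronglyMeasurable (fun y hy => ?_) measurableSet_Ioo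
    exact ((h.hasDerivAt_birkhoffSum hT hS (fun z hz => (hφ z hz).1)
      hy).continuousAt.sub continuousAt_const).continuousWithinAt
  have hint : IntegrableOn (fun y => F y - F (S.mid α)) (S.piece α) := Integrable.mono' hD hmeas hbound
  have hvol : (volume.restrict (S.piece α)).real univ = S.len α := by
    rw [measureReal_restrict_apply_univ, piece, Real.volume_real_Ico_of_le hlr.le]; linarith
  have hfin : IsFiniteMeasure (volume.restrict (S.piece α)) := by
    unfold piece; infer_instance
  have hmean : ∫ y in S.piece α, (F y - F (S.mid α)) =
      (∫ y in S.piece α, F y) - S.len α * F (S.mid α) := by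
    have hF : IntegrableOn F (S.piece α) := by
      have := hint.add (integrable_const (F (S.mid α)))
      refine this.congr (Eventually.of_forall fun y => ?_)
      simp
    rw [integral_sub hF (integrable_const _), integral_const, hvol, smul_eq_mul]
  have hle : |(∫ y in S.piece α, F y) - S.len α * F (S.mid α)| ≤
      C * (2 / (1 - b) * (S.len α) ^ (1 - b)) := by
    rw [← hmean, ← Real.norm_eq_abs]
    refine (norm_integral_le_of_norm_le hD hbound).trans ?_
    rw [integral_const_mul, integral_gap hlr.le hb1, hr, add_sub_cancel_left]
  have hle2 : |(∫ y in S.piece α, F y) / S.len α - F (S.mid α)| ≤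
      C * (2 / (1 - b)) * S.gap x ^ (-b) := by
    have e : (∫ y in S.piece α, F y) / S.len α - F (S.mid α) =
        ((∫ y in S.piece α, F y) - S.len α * F (S.mid α)) / S.len α := by field_simp
    rw [e, abs_div, abs_of_pos hlen, div_le_iff₀ hlen]
    refine hle.trans ?_
    have h3 : (S.len α) ^ (1 - b) = (S.len α) ^ (-b) * S.len α := by
      rw [← Real.rpow_add_one hlen.ne']; congr 1; ring
    have h4 : (S.len α) ^ (-b) ≤ S.gap x ^ (-b) :=
      Real.rpow_le_rpow_of_nonpos (gap_pos hS hx) (gap_le_len hS ⟨hx.1.le, hx.2⟩) (by linarith)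
    rw [h3]
    have h5 : 0 ≤ C * (2 / (1 - b)) := by positivity
    calc C * (2 / (1 - b) * (S.len α ^ (-b) * S.len α))
        = C * (2 / (1 - b)) * S.len α ^ (-b) * S.len α := by ring
      _ ≤ C * (2 / (1 - b)) * S.gap x ^ (-b) * S.len α := by gcongr
  have h6 := hosc x hx
  have h7 : |F x| ≤ |F x - F (S.mid α)| +
      |(∫ y in S.piece α, F y) / S.len α - F (S.mid α)| + |(∫ y in S.piece α, F y) / S.len α| := by
    have e : F x = (F x - F (S.mid α)) - ((∫ y in S.piece α, F y) / S.len α - F (S.mid α)) +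
      (∫ y in S.piece α, F y) / S.len α := by ring
    calc |F x| = _ := congrArg _ e
      _ ≤ _ := (abs_add_le _ _).trans (add_le_add_left (abs_sub _ _) _)
  nlinarith

end Tower

end IET

namespace IET

variable {𝒜 : Type*} [Fintype 𝒜] [DecidableEq 𝒜] {d : ℕ}

/-! ### Birkhoff sums of intermediate length -/

section

variable {T S R : IET 𝒜 d} {B C : Matrix 𝒜 𝒜 ℕ}

theorem IsTower.birkhoffSum_returnTime (h : IsTower T S B) (hS : ∀ α, 0 < S.len α) (φ : ℝ → ℝ)
    {x : ℝ} (hx : x ∈ S.base) (q : ℕ) : birkhoffSum T.map φ (returnTime S B q x) x =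
      ∑ p ∈ Finset.range q,
        birkhoffSum T.map φ (S.loc (rowSum B) (S.map^[p] x)) (S.map^[p] x) := by
  induction q with
  | zero => simp [returnTime]
  | succ q ih =>
    rw [returnTime_succ, birkhoffSum_add, ih, Finset.sum_range_succ, ← h.iterate_eq hS hx]

/-- Passing from bounds at the level of `S` to bounds at the level of `R`: an orbit segment that
starts in the base of `R`, and does not exceed the tower over `R`, consists of at most `rowSum C α`
full excursions from the base of `S`, and of an initial part of another one. -/
theorem IsTower.abs_birkhoffSum_le_of_level (hTS : IsTower T S B) (hSR : IsTower S R C)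
    (hS : ∀ α, 0 < S.len α) (hR : ∀ α, 0 < R.len α) {φ : ℝ → ℝ} {u V W : ℝ}
    (hV : ∀ α, ∀ x ∈ S.piece α, u ≤ S.gap x → |birkhoffSum T.map φ (rowSum B α) x| ≤ V)
    (hW : ∀ α, ∀ x ∈ S.piece α, u ≤ S.gap x → ∀ j ≤ rowSum B α, |birkhoffSum T.map φ j x| ≤ W)
    {α : 𝒜} {x : ℝ} (hx : x ∈ R.piece α) (hu : u ≤ R.gap x) {j : ℕ} (hj : j ≤ rowSum (C * B) α) :
    |birkhoffSum T.map φ j x| ≤ rowSum C α * V + W := by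
  have hxS : x ∈ S.base := hSR.base_subset (piece_subset_base hR _ hx)
  have hlev : ∀ p < rowSum C α, ∃ β, S.map^[p] x ∈ S.piece β ∧ u ≤ S.gap (S.map^[p] x) := by
    intro p hp
    obtain ⟨β, c, hc⟩ := hSR.floor α p hp
    exact ⟨β, (hc x hx).1 ▸ (hc x hx).2, hu.trans (hSR.gap_le hS hR hx hp)⟩
  have hV0 : 0 ≤ V := by
    obtain ⟨β, h1, h2⟩ := hlev 0 (hSR.height_pos α)
    exact (abs_nonneg _).trans (hV β _ h1 h2)
  have hW0 : 0 ≤ W := by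
    obtain ⟨β, h1, h2⟩ := hlev 0 (hSR.height_pos α)
    exact (abs_nonneg _).trans (hW β _ h1 h2 0 (Nat.zero_le _))
  have hfull : ∀ q ≤ rowSum C α, |birkhoffSum T.map φ (returnTime S B q x) x| ≤ rowSum C α * V := by
    intro q hq
    rw [hTS.birkhoffSum_returnTime hS φ hxS]
    refine (Finset.abs_sum_le_sum_abs _ _).trans ?_
    refine (Finset.sum_le_card_nsmul _ _ V fun p hp => ?_).trans ?_
    · obtain ⟨β, h1, h2⟩ := hlev p ((Finset.mem_range.1 hp).trans_le hq)
      rw [loc_of_mem hS _ h1]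
      exact hV β _ h1 h2
    · rw [Finset.card_range, nsmul_eq_mul]
      exact mul_le_mul_of_nonneg_right (by exact_mod_cast hq) hV0
  rw [← hSR.returnTime_eq B hx] at hj
  rcases hj.eq_or_lt with rfl | hj
  · linarith [hfull _ le_rfl]
  · obtain ⟨p, hp, i, hi, rfl⟩ := exists_excursion S B x hj
    obtain ⟨β, h1, h2⟩ := hlev p hp
    rw [loc_of_mem hS _ h1] at hi
    rw [birkhoffSum_add, ← hTS.iterate_eq hS hxS]
    exact (abs_add_le _ _).trans (add_le_add (hfull p hp.le) (hW β _ h1 h2 i hi.le))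

/-- Birkhoff sums of length below all heights, from any starting point: the orbit segment stays in
one column of the tower or enters one more. -/
theorem IsTower.abs_birkhoffSum_le_of_column (h : IsTower T S B) (hT : ∀ α, 0 < T.len α)
    (hS : ∀ α, 0 < S.len α) {φ : ℝ → ℝ}
    {α α' : 𝒜} {y : ℝ} (hy : y ∈ S.piece α) (hy' : S.map y ∈ S.piece α') {W W' : ℝ}
    (hW : ∀ j ≤ rowSum B α, |birkhoffSum T.map φ j y| ≤ W)
    (hW' : ∀ j ≤ rowSum B α', |birkhoffSum T.map φ j (S.map y)| ≤ W') {j N : ℕ}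
    (hj : j < rowSum B α) (hN : N ≤ rowSum B α') :
    |birkhoffSum T.map φ N (T.map^[j] y)| ≤ 2 * W + W' ∧
      min (S.gap y) (S.gap (S.map y)) ≤ T.gap (T.map^[N] (T.map^[j] y)) := by
  have hW0' : 0 ≤ W' := (abs_nonneg _).trans (hW' 0 (Nat.zero_le _))
  have key : ∀ i, j + i ≤ rowSum B α → |birkhoffSum T.map φ i (T.map^[j] y)| ≤ 2 * W := by
    intro i hi
    have e := birkhoffSum_add T.map φ j i y
    have h1 := hW (j + i) hi
    have h2 := hW j hj.le
    rw [abs_le] at h1 h2 ⊢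
    constructor <;> linarith [h1.1, h1.2, h2.1, h2.2]
  rw [← Function.iterate_add_apply]
  rcases lt_or_ge (j + N) (rowSum B α) with hlt | hge
  · refine ⟨by linarith [key N hlt.le], (min_le_left _ _).trans ?_⟩
    rw [add_comm]
    exact h.gap_le hT hS hy hlt
  · obtain ⟨i, hi⟩ := Nat.exists_eq_add_of_le hge
    have hy2 : T.map^[i] (S.map y) = T.map^[N + j] y := by
      rw [h.map_eq α y hy, ← Function.iterate_add_apply]
      congr 1; omega
    constructor
    · have e : N = (rowSum B α - j) + i := by omega
      rw [e, birkhoffSum_add, ← Function.iterate_add_apply, Nat.sub_add_cancel hj.le,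
        ← h.map_eq α y hy]
      refine (abs_add_le _ _).trans (add_le_add (key _ (by omega)) (hW' i (by omega)))
    · rw [← hy2]
      exact (min_le_right _ _).trans (h.gap_le hT hS hy' (by omega))

end

theorem rowSum_le_matNorm (B : Matrix 𝒜 𝒜 ℕ) (α : 𝒜) : (rowSum B α : ℝ) ≤ matNorm B := by
  unfold matNorm
  exact_mod_cast Finset.le_sup (f := fun α => ∑ β, B α β) (Finset.mem_univ α)

variable [NeZero d]

/-- The mean values of the special Birkhoff sums of `φ`. -/
noncomputable def towerMean (T : IET 𝒜 d) (n : ℕ → ℕ) (φ : ℝ → ℝ) (k : ℕ) (α : 𝒜) : ℝ :=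
  (∫ y in (T.acc n k).piece α, birkhoffSum T.map φ (T.height n k α) y) / (T.acc n k).len α

/-- The bound for Birkhoff sums that start in the base of level `k` and do not exceed the towers. -/
theorem abs_birkhoffSum_le_of_acc {T : IET 𝒜 d} (h : T.Renormalizable) {n : ℕ → ℕ}
    (hn : IsAccelerating n) {b K : ℝ} (hb : 0 < b) (hb1 : b < 1) (hK : 0 ≤ K) {φ : ℝ → ℝ}
    (hφ : T.PowDeriv b K φ) {k : ℕ} {M Z u : ℝ} (hM : ∀ l ≤ k, ∀ α, |T.towerMean n φ l α| ≤ M)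
    (hZ : ∀ l < k, matNorm (T.Q n l (l + 1)) ≤ Z) (hu : 0 < u) {α : 𝒜} {x : ℝ}
    (hx : x ∈ (T.acc n k).piece α) (hux : u ≤ (T.acc n k).gap x) {j : ℕ}
    (hj : j ≤ rowSum (T.Q n 0 k) α) :
    |birkhoffSum T.map φ j x| ≤ (k * Z + 1) *
      (M + towerConst (Fintype.card 𝒜) b K * (1 + 2 / (1 - b)) * u ^ (-b)) := by
  set V := M + towerConst (Fintype.card 𝒜) b K * (1 + 2 / (1 - b)) * u ^ (-b)
  have h1b : 0 < 1 - b := by linarith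
  have hC := towerConst_nonneg (Fintype.card 𝒜) hb hK
  have hM0 : 0 ≤ M := (abs_nonneg _).trans (hM 0 (Nat.zero_le _) α)
  have hV0 : 0 ≤ V := by positivity
  have hV : ∀ l ≤ k, ∀ α, ∀ x ∈ (T.acc n l).piece α, u ≤ (T.acc n l).gap x →
      |birkhoffSum T.map φ (rowSum (T.Q n 0 l) α) x| ≤ V := by
    intro l hl α x hx hux
    have hpos := (acc_renormalizable h n l).pos
    have hx' : x ∈ Ioo ((T.acc n l).left α) ((T.acc n l).right α) := by
      have := hu.trans_le hux
      rw [gap_of_mem hpos hx, lt_min_iff] at this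
      exact ⟨by linarith, hx.2⟩
    refine ((isTower_acc_zero h hn l).abs_birkhoffSum_le h.pos hpos hb hb1 hK hφ hx').trans ?_
    refine add_le_add (hM l hl α) (mul_le_mul_of_nonneg_left ?_ (by positivity))
    exact Real.rpow_le_rpow_of_nonpos hu hux (by linarith)
  have main : ∀ l ≤ k, ∀ α, ∀ x ∈ (T.acc n l).piece α, u ≤ (T.acc n l).gap x →
      ∀ j ≤ rowSum (T.Q n 0 l) α, |birkhoffSum T.map φ j x| ≤ (l * Z + 1) * V := by
    intro l
    induction l with
    | zero =>
      intro _ α x hx hux j hj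
      have h1 : rowSum (T.Q n 0 0) α = 1 := by simp [Q, kz, rowSum, Matrix.one_apply]
      have h2 := hV 0 (Nat.zero_le _) α x hx hux
      rw [h1] at hj h2
      simp only [Nat.cast_zero, zero_mul, zero_add, one_mul]
      interval_cases j
      · simpa using hV0
      · exact h2
    | succ l ih =>
      intro hl α x hx hux j hj
      rw [Q_mul T hn (Nat.zero_le l) (Nat.le_succ l)] at hj
      have h1 := (isTower_acc_zero h hn l).abs_birkhoffSum_le_of_level
        (isTower_acc h hn (Nat.le_succ l)) (acc_renormalizable h n l).pos
        (acc_renormalizable h n (l + 1)).pos (hV l (by omega)) (ih (by omega)) hx hux hj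
      have h2 : (rowSum (T.Q n l (l + 1)) α : ℝ) * V ≤ Z * V :=
        mul_le_mul_of_nonneg_right ((rowSum_le_matNorm _ α).trans (hZ l hl)) hV0
      push_cast
      linarith
  exact main k le_rfl α x hx hux j hj

end IET

namespace IET

variable {𝒜 : Type*} [Fintype 𝒜] [DecidableEq 𝒜] {d : ℕ}

/-! ### The special flow does not increase the measure -/

section Flow

variable {T : IET 𝒜 d} {g : ℝ → ℝ≥0∞} {c : ℝ}

/-- The number of passages through the base up to time `u`, on the orbit of `(x, 0)`. -/
noncomputable def crossings (T : IET 𝒜 d) (g : ℝ → ℝ≥0∞) (u x : ℝ) : ℕ :=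
  sInf {N : ℕ | ENNReal.ofReal u < birkhoffSum T.map g (N + 1) x}

theorem specialFlow_eq (T : IET 𝒜 d) (g : ℝ → ℝ≥0∞) (t : ℝ) (p : ℝ × ℝ) :
    T.specialFlow g t p = (T.map^[crossings T g (p.2 + t) p.1] p.1,
      p.2 + t - (birkhoffSum T.map g (crossings T g (p.2 + t) p.1) p.1).toReal) := rfl

theorem birkhoffSum_mono (T : IET 𝒜 d) (g : ℝ → ℝ≥0∞) (x : ℝ) :
    Monotone fun n => birkhoffSum T.map g n x := by
  refine monotone_nat_of_le_succ fun n => ?_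
  rw [birkhoffSum_succ]
  exact le_self_add

theorem nsmul_le_birkhoffSum (hc : ∀ x, ENNReal.ofReal c ≤ g x) (n : ℕ) (x : ℝ) :
    n • ENNReal.ofReal c ≤ birkhoffSum T.map g n x := by
  have := Finset.card_nsmul_le_sum (Finset.range n) (fun i => g (T.map^[i] x)) (ENNReal.ofReal c)
    fun i _ => hc _
  rwa [Finset.card_range] at this

theorem exists_lt_birkhoffSum (hc0 : 0 < c) (hc : ∀ x, ENNReal.ofReal c ≤ g x) (u x : ℝ) :
    ∃ N : ℕ, ENNReal.ofReal u < birkhoffSum T.map g (N + 1) x := by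
  obtain ⟨N, hN⟩ := exists_nat_gt (u / c)
  refine ⟨N, lt_of_lt_of_le ?_ (nsmul_le_birkhoffSum hc (N + 1) x)⟩
  rw [← ENNReal.ofReal_nsmul, nsmul_eq_mul]
  rw [div_lt_iff₀ hc0] at hN
  refine (ENNReal.ofReal_lt_ofReal_iff (by positivity)).2 ?_
  push_cast
  linarith

theorem lt_birkhoffSum_crossings (hc0 : 0 < c) (hc : ∀ x, ENNReal.ofReal c ≤ g x) (u x : ℝ) :
    ENNReal.ofReal u < birkhoffSum T.map g (crossings T g u x + 1) x :=
  Nat.sInf_mem (exists_lt_birkhoffSum hc0 hc u x)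

theorem birkhoffSum_crossings_le (T : IET 𝒜 d) (g : ℝ → ℝ≥0∞) (u x : ℝ) :
    birkhoffSum T.map g (crossings T g u x) x ≤ ENNReal.ofReal u := by
  rcases Nat.eq_zero_or_pos (crossings T g u x) with h | h
  · rw [h, birkhoffSum_zero]; exact zero_le
  · obtain ⟨k, hk⟩ := Nat.exists_eq_succ_of_ne_zero h.ne'
    have : k ∉ {N : ℕ | ENNReal.ofReal u < birkhoffSum T.map g (N + 1) x} :=
      Nat.notMem_of_lt_sInf (show k < crossings T g u x by omega)
    rw [hk]
    exact not_lt.1 this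

theorem crossings_eq {u x : ℝ} {n : ℕ} (h1 : birkhoffSum T.map g n x ≤ ENNReal.ofReal u)
    (h2 : ENNReal.ofReal u < birkhoffSum T.map g (n + 1) x) : crossings T g u x = n := by
  refine le_antisymm (Nat.sInf_le h2) (le_csInf ⟨n, h2⟩ fun N hN => ?_)
  by_contra hlt
  push Not at hlt
  exact absurd (hN.trans_le ((birkhoffSum_mono T g x (Nat.succ_le_of_lt hlt)).trans h1)) (lt_irrefl _)

theorem measurable_birkhoffSum (T : IET 𝒜 d) (hg : Measurable g) (n : ℕ) :
    Measurable (birkhoffSum T.map g n) :=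
  Finset.measurable_sum _ fun i _ => hg.comp (T.measurable_map.iterate i)

theorem measurable_crossings (hg : Measurable g) (hc0 : 0 < c) (hc : ∀ x, ENNReal.ofReal c ≤ g x) :
    Measurable fun q : ℝ × ℝ => crossings T g q.1 q.2 := by
  classical
  have := measurable_find (p := fun (q : ℝ × ℝ) N =>
    ENNReal.ofReal q.1 < birkhoffSum T.map g (N + 1) q.2)
    (fun q => exists_lt_birkhoffSum hc0 hc q.1 q.2) fun N =>
      measurableSet_lt (ENNReal.measurable_ofReal.comp measurable_fst)
        ((measurable_birkhoffSum T hg _).comp measurable_snd)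
  convert this using 2 with q
  have hex := exists_lt_birkhoffSum (T := T) hc0 hc q.1 q.2
  exact le_antisymm (Nat.sInf_le (Nat.find_spec hex))
    (Nat.find_min' hex (lt_birkhoffSum_crossings hc0 hc q.1 q.2))

theorem measurable_specialFlow (hg : Measurable g) (hc0 : 0 < c)
    (hc : ∀ x, ENNReal.ofReal c ≤ g x) :
    Measurable fun q : ℝ × (ℝ × ℝ) => T.specialFlow g q.1 q.2 := by
  have hN : Measurable fun q : ℝ × (ℝ × ℝ) => crossings T g (q.2.2 + q.1) q.2.1 :=
    (measurable_crossings hg hc0 hc).comp (f := fun q : ℝ × (ℝ × ℝ) => (q.2.2 + q.1, q.2.1))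
      (by fun_prop)
  have h1 : Measurable fun q : ℕ × ℝ => T.map^[q.1] q.2 :=
    measurable_from_prod_countable_right fun n => T.measurable_map.iterate n
  have h2 : Measurable fun q : ℕ × ℝ => birkhoffSum T.map g q.1 q.2 :=
    measurable_from_prod_countable_right fun n => measurable_birkhoffSum T hg n
  have h3 : Measurable fun q : ℝ × (ℝ × ℝ) => (crossings T g (q.2.2 + q.1) q.2.1, q.2.1) :=
    hN.prodMk (by fun_prop)
  exact (h1.comp h3).prodMk ((by fun_prop : Measurable fun q : ℝ × (ℝ × ℝ) => q.2.2 + q.1).sub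
    (h2.comp h3).ennreal_toReal)

theorem measurableSet_suspension (T : IET 𝒜 d) (hg : Measurable g) :
    MeasurableSet (T.suspension g) := by
  refine (measurable_fst T.measurableSet_base).inter
    ((measurableSet_le measurable_const measurable_snd).inter ?_)
  exact measurableSet_lt (ENNReal.measurable_ofReal.comp measurable_snd) (hg.comp measurable_fst)

/-- The special flow does not increase Lebesgue measure: on the points with `n` passages it is a
measure-preserving skew product over `T^n`, and these pieces have disjoint images. -/
theorem map_specialFlow_le (hT : ∀ α, 0 < T.len α) (hg : Measurable g) (hc0 : 0 < c)
    (hc : ∀ x, ENNReal.ofReal c ≤ g x) {t : ℝ} (ht : 0 ≤ t) :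
    (volume.restrict (T.suspension g)).map (T.specialFlow g t) ≤
      volume.restrict (T.suspension g) := by
  have hF : Measurable (T.specialFlow g t) :=
    (measurable_specialFlow hg hc0 hc).comp (measurable_const.prodMk measurable_id)
  have hsusp := T.measurableSet_suspension hg
  set ν : Measure (ℝ × ℝ) := (volume.restrict T.base).prod volume with hν
  have hν' : ν = volume.restrict (T.base ×ˢ univ) := by
    rw [hν, Measure.volume_eq_prod, ← Measure.prod_restrict, Measure.restrict_univ]
  have hle : volume.restrict (T.suspension g) ≤ ν := by
    rw [hν']
    exact Measure.restrict_mono (fun p (hp : p ∈ T.suspension g) => mk_mem_prod hp.1 (mem_univ _)) le_rfl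
  -- the flow after `n` passages through the base is a skew product `Ψ n`, with inverse `Θ n`
  let Ψ : ℕ → ℝ × ℝ → ℝ × ℝ := fun n p =>
    (T.map^[n] p.1, p.2 + (t - (birkhoffSum T.map g n p.1).toReal))
  let Θ : ℕ → ℝ × ℝ → ℝ × ℝ := fun n q =>
    (T.inv.map^[n] q.1, q.2 - (t - (birkhoffSum T.map g n (T.inv.map^[n] q.1)).toReal))
  have hΨ : ∀ n, MeasurePreserving (Ψ n) ν ν := by
    intro n
    refine ((measurePreserving_map hT).iterate n).skew_product
      (g := fun x r => r + (t - (birkhoffSum T.map g n x).toReal)) ?_ ?_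
    · exact measurable_snd.add (measurable_const.sub
        ((measurable_birkhoffSum T hg n).comp measurable_fst).ennreal_toReal)
    · exact Eventually.of_forall fun x =>
        (measurePreserving_add_right volume (t - (birkhoffSum T.map g n x).toReal)).map_eq
  have hΘ : ∀ n, Measurable (Θ n) := by
    intro n
    have h1 : Measurable fun q : ℝ × ℝ => T.inv.map^[n] q.1 :=
      (T.inv.measurable_map.iterate n).comp measurable_fst
    exact h1.prodMk (measurable_snd.sub (measurable_const.sub
      ((measurable_birkhoffSum T hg n).comp h1).ennreal_toReal))
  let A : ℕ → Set (ℝ × ℝ) := fun n =>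
    T.suspension g ∩ (fun p => crossings T g (p.2 + t) p.1) ⁻¹' {n}
  have hA : ∀ n, MeasurableSet (A n) := fun n => hsusp.inter
    (((measurable_crossings hg hc0 hc).comp (f := fun p : ℝ × ℝ => (p.2 + t, p.1)) (by fun_prop))
      (measurableSet_singleton n))
  let D : ℕ → Set (ℝ × ℝ) := fun n => (T.base ×ˢ univ) ∩ Θ n ⁻¹' A n
  have hD : ∀ n, MeasurableSet (D n) := fun n =>
    (T.measurableSet_base.prod MeasurableSet.univ).inter (hΘ n (hA n))
  have hfin : ∀ n, ∀ p ∈ A n, birkhoffSum T.map g n p.1 ≤ ENNReal.ofReal (p.2 + t) ∧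
      birkhoffSum T.map g n p.1 ≠ ∞ := by
    rintro n p ⟨-, hp⟩
    have h := birkhoffSum_crossings_le T g (p.2 + t) p.1
    rw [show crossings T g (p.2 + t) p.1 = n from hp] at h
    exact ⟨h, ne_top_of_le_ne_top ENNReal.ofReal_ne_top h⟩
  have hsub : ∀ n, D n ⊆ T.suspension g := by
    rintro n q ⟨hq, hA'⟩
    obtain ⟨h1, h2⟩ := hfin n _ hA'
    have h3 := lt_birkhoffSum_crossings (T := T) hc0 hc ((Θ n q).2 + t) (Θ n q).1
    rw [show crossings T g ((Θ n q).2 + t) (Θ n q).1 = n from hA'.2, birkhoffSum_succ] at h3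
    have h4 : T.map^[n] (Θ n q).1 = q.1 := iterate_inv_iterate hT n hq.1
    have h5 : 0 ≤ (Θ n q).2 := hA'.1.2.1
    have h6 : (Θ n q).2 + t = q.2 + (birkhoffSum T.map g n (Θ n q).1).toReal := by
      simp only [Θ]; ring
    rw [h4] at h3
    have h7 : 0 ≤ q.2 := by
      have := ENNReal.toReal_mono ENNReal.ofReal_ne_top h1
      rw [ENNReal.toReal_ofReal (by positivity), h6] at this
      linarith
    refine ⟨hq.1, h7, ?_⟩
    rw [h6, ENNReal.ofReal_add h7 ENNReal.toReal_nonneg, ENNReal.ofReal_toReal h2, add_comm] at h3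
    exact lt_of_add_lt_add_left h3
  have hdisj' : ∀ n m, n < m → Disjoint (D n) (D m) := by
    intro n m hnm
    refine disjoint_left.2 fun q hn hm => ?_
    obtain ⟨hq, hAn⟩ := hn
    obtain ⟨-, hAm⟩ := hm
    obtain ⟨k, rfl⟩ := Nat.exists_eq_add_of_le hnm.le
    have hk : 0 < k := by omega
    have hbn : (Θ n q).1 ∈ T.base := hAn.1.1
    have hm1 : (Θ (n + k) q).1 = T.inv.map^[k] (Θ n q).1 := by
      simp only [Θ]; rw [add_comm, Function.iterate_add_apply]
    have h4 : T.map^[k] (Θ (n + k) q).1 = (Θ n q).1 := by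
      rw [hm1]; exact iterate_inv_iterate hT k hbn
    have h5 : birkhoffSum T.map g (n + k) (Θ (n + k) q).1 =
        birkhoffSum T.map g k (Θ (n + k) q).1 + birkhoffSum T.map g n (Θ n q).1 := by
      rw [add_comm n k, birkhoffSum_add, add_comm k n, h4]
    have h6 := (hfin _ _ hAm).2
    have h7 := (hfin _ _ hAn).2
    have h8 : birkhoffSum T.map g k (Θ (n + k) q).1 ≠ ∞ := by
      rw [h5] at h6
      exact (ENNReal.add_ne_top.1 h6).1
    have h9 : (Θ (n + k) q).2 = (Θ n q).2 + (birkhoffSum T.map g k (Θ (n + k) q).1).toReal := by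
      have : (birkhoffSum T.map g (n + k) (Θ (n + k) q).1).toReal =
          (birkhoffSum T.map g k (Θ (n + k) q).1).toReal +
            (birkhoffSum T.map g n (Θ n q).1).toReal := by
        rw [h5, ENNReal.toReal_add h8 h7]
      change q.2 - (t - (birkhoffSum T.map g (n + k) (Θ (n + k) q).1).toReal) =
        q.2 - (t - (birkhoffSum T.map g n (Θ n q).1).toReal) + _
      rw [this]; ring
    have h10 : g (Θ (n + k) q).1 ≤ birkhoffSum T.map g k (Θ (n + k) q).1 := by
      have := birkhoffSum_mono T g (Θ (n + k) q).1 hk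
      simpa only [birkhoffSum_one] using this
    have h11 : ENNReal.ofReal (Θ (n + k) q).2 < g (Θ (n + k) q).1 := hAm.1.2.2
    have h12 : 0 ≤ (Θ n q).2 := hAn.1.2.1
    refine absurd (h11.trans_le h10) (not_lt.2 ?_)
    rw [h9, ENNReal.ofReal_add h12 ENNReal.toReal_nonneg, ENNReal.ofReal_toReal h8]
    exact le_add_self
  have hdisj : Pairwise (Function.onFun Disjoint D) := by
    intro n m hne
    rcases lt_or_gt_of_ne hne with h | h
    exacts [hdisj' n m h, (hdisj' m n h).symm]
  refine Measure.le_iff.2 fun B hB => ?_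
  rw [Measure.map_apply hF hB]
  calc volume.restrict (T.suspension g) (T.specialFlow g t ⁻¹' B)
      = volume (T.specialFlow g t ⁻¹' B ∩ T.suspension g) := Measure.restrict_apply (hF hB)
    _ ≤ volume (⋃ n, (A n ∩ T.specialFlow g t ⁻¹' B)) := by
        refine measure_mono fun p hp => mem_iUnion.2 ⟨crossings T g (p.2 + t) p.1, ⟨hp.2, rfl⟩, hp.1⟩
    _ ≤ ∑' n, volume (A n ∩ T.specialFlow g t ⁻¹' B) := measure_iUnion_le _
    _ ≤ ∑' n, ν (D n ∩ B) := by
        refine ENNReal.tsum_le_tsum fun n => ?_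
        rw [← (hΨ n).measure_preimage ((hD n).inter hB).nullMeasurableSet, hν',
          Measure.restrict_apply ((hΨ n).measurable ((hD n).inter hB))]
        refine measure_mono fun p hp => ?_
        obtain ⟨hpA, hpB⟩ := hp
        have hpb : p.1 ∈ T.base := hpA.1.1
        have hΘΨ : Θ n (Ψ n p) = p := by
          simp only [Θ, Ψ, inv_iterate_iterate hT n hpb]
          ext <;> simp
        have hfl : T.specialFlow g t p = Ψ n p := by
          rw [specialFlow_eq, show crossings T g (p.2 + t) p.1 = n from hpA.2]
          simp only [Ψ, add_sub_assoc]
        refine ⟨⟨⟨⟨iterate_mem_base hT hpb n, mem_univ _⟩, ?_⟩, ?_⟩, hpb, mem_univ _⟩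
        · rw [mem_preimage, hΘΨ]; exact hpA
        · rw [← hfl]; exact hpB
    _ = ν (⋃ n, (D n ∩ B)) := by
        refine (measure_iUnion (fun n m hne => ?_) fun n => (hD n).inter hB).symm
        exact (hdisj hne).mono inter_subset_left inter_subset_left
    _ ≤ volume.restrict (T.suspension g) B := by
        rw [hν', Measure.restrict_apply hB,
          Measure.restrict_apply (MeasurableSet.iUnion fun n => (hD n).inter hB)]
        refine measure_mono fun p hp => ?_
        obtain ⟨n, hn, hpB⟩ := mem_iUnion.1 hp.1
        exact ⟨hpB, hsub n hn⟩

/-- Integrability of `f` along the flow, jointly in time and space. -/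
theorem integrable_comp_specialFlow (hT : ∀ α, 0 < T.len α) (hg : Measurable g) (hc0 : 0 < c)
    (hc : ∀ x, ENNReal.ofReal c ≤ g x) {f : ℝ × ℝ → ℝ} (hf : IntegrableOn f (T.suspension g))
    (s : ℝ) : Integrable (fun q : ℝ × (ℝ × ℝ) => f (T.specialFlow g q.1 q.2))
      ((volume.restrict (Ioc 0 s)).prod (volume.restrict (T.suspension g))) := by
  have hF := measurable_specialFlow (T := T) hg hc0 hc
  have hle : ((volume.restrict (Ioc 0 s)).prod (volume.restrict (T.suspension g))).map
      (fun q : ℝ × (ℝ × ℝ) => T.specialFlow g q.1 q.2) ≤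
        ENNReal.ofReal s • volume.restrict (T.suspension g) := by
    refine Measure.le_iff.2 fun B hB => ?_
    rw [Measure.map_apply hF hB, Measure.prod_apply (hF hB)]
    calc ∫⁻ t in Ioc 0 s, volume.restrict (T.suspension g)
          (Prod.mk t ⁻¹' ((fun q : ℝ × (ℝ × ℝ) => T.specialFlow g q.1 q.2) ⁻¹' B))
        ≤ ∫⁻ t in Ioc 0 s, volume.restrict (T.suspension g) B := by
          refine setLIntegral_mono' measurableSet_Ioc fun t ht => ?_
          have hm : Measurable (T.specialFlow g t) :=
            hF.comp (measurable_const.prodMk measurable_id)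
          have := map_specialFlow_le hT hg hc0 hc ht.1.le B
          rwa [Measure.map_apply hm hB] at this
      _ = (ENNReal.ofReal s • volume.restrict (T.suspension g)) B := by
          rw [setLIntegral_const, Real.volume_Ioc, sub_zero, mul_comm]; rfl
  exact ((hf.smul_measure ENNReal.ofReal_ne_top).mono_measure hle).comp_measurable hF

end Flow

/-! ### Ergodic integrals and Birkhoff sums -/

/-- The fibre of the suspension over `x`. -/
def fibre (g : ℝ → ℝ≥0∞) (x : ℝ) : Set ℝ := {r : ℝ | 0 ≤ r ∧ ENNReal.ofReal r < g x}

theorem fibre_eq {g : ℝ → ℝ≥0∞} {x : ℝ} (hx : g x ≠ ∞) : fibre g x = Ico 0 (g x).toReal := by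
  ext r
  refine and_congr_right fun hr => ?_
  rw [ENNReal.ofReal_lt_iff_lt_toReal hr hx]

/-- The orbit of `x` stays in the base and away from the poles of `g`, and `f` is integrable on
the fibres over it. -/
structure IsGoodPoint (T : IET 𝒜 d) (g : ℝ → ℝ≥0∞) (f : ℝ × ℝ → ℝ) (x : ℝ) : Prop where
  ne_top : ∀ n, g (T.map^[n] x) ≠ ∞
  integrableOn : ∀ n, IntegrableOn (fun r => f (T.map^[n] x, r)) (fibre g (T.map^[n] x))

section Orbit

variable {T : IET 𝒜 d} {g : ℝ → ℝ≥0∞} {c : ℝ} {f : ℝ × ℝ → ℝ} {x : ℝ}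

theorem measurableSet_fibre (g : ℝ → ℝ≥0∞) (x : ℝ) : MeasurableSet (fibre g x) :=
  measurableSet_Ici.inter (measurableSet_lt ENNReal.measurable_ofReal measurable_const)

theorem IsGoodPoint.abs (h : IsGoodPoint T g f x) : IsGoodPoint T g (fun p => |f p|) x :=
  ⟨h.ne_top, fun n => (h.integrableOn n).abs⟩

/-- The time at which the orbit of `(x, 0)` returns for the `n`-th time to the base. -/
noncomputable def roofSum (T : IET 𝒜 d) (g : ℝ → ℝ≥0∞) (x : ℝ) (n : ℕ) : ℝ :=
  (birkhoffSum T.map g n x).toReal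

theorem IsGoodPoint.birkhoffSum_ne_top (h : IsGoodPoint T g f x) (n : ℕ) :
    birkhoffSum T.map g n x ≠ ∞ :=
  ENNReal.sum_ne_top.2 fun i _ => h.ne_top i

theorem roofSum_zero (T : IET 𝒜 d) (g : ℝ → ℝ≥0∞) (x : ℝ) : roofSum T g x 0 = 0 := by
  simp [roofSum]

theorem IsGoodPoint.roofSum_succ (h : IsGoodPoint T g f x) (n : ℕ) :
    roofSum T g x (n + 1) = roofSum T g x n + (g (T.map^[n] x)).toReal := by
  rw [roofSum, birkhoffSum_succ, ENNReal.toReal_add (h.birkhoffSum_ne_top n) (h.ne_top n), roofSum]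

theorem IsGoodPoint.roofSum_mono (h : IsGoodPoint T g f x) : Monotone (roofSum T g x) :=
  monotone_nat_of_le_succ fun n => by
    rw [h.roofSum_succ]
    linarith [(ENNReal.toReal_nonneg : 0 ≤ (g (T.map^[n] x)).toReal)]

theorem IsGoodPoint.crossings_eq (h : IsGoodPoint T g f x) {n : ℕ} {u : ℝ}
    (h1 : roofSum T g x n ≤ u) (h2 : u < roofSum T g x (n + 1)) : crossings T g u x = n := by
  have h0 : 0 ≤ u := ENNReal.toReal_nonneg.trans h1
  refine IET.crossings_eq ?_ ?_
  · exact (ENNReal.le_ofReal_iff_toReal_le (h.birkhoffSum_ne_top n) h0).2 h1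
  · exact (ENNReal.ofReal_lt_iff_lt_toReal h0 (h.birkhoffSum_ne_top _)).2 h2

theorem IsGoodPoint.roofSum_crossings (h : IsGoodPoint T g f x) (hc0 : 0 < c)
    (hc : ∀ x, ENNReal.ofReal c ≤ g x) {u : ℝ} (hu : 0 ≤ u) :
    roofSum T g x (crossings T g u x) ≤ u ∧ u < roofSum T g x (crossings T g u x + 1) :=
  ⟨(ENNReal.le_ofReal_iff_toReal_le (h.birkhoffSum_ne_top _) hu).1
      (birkhoffSum_crossings_le T g u x),
    (ENNReal.ofReal_lt_iff_lt_toReal hu (h.birkhoffSum_ne_top _)).1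
      (lt_birkhoffSum_crossings hc0 hc u x)⟩

theorem IsGoodPoint.flow_eq (h : IsGoodPoint T g f x) {n : ℕ} {u : ℝ}
    (hu : u ∈ Ico (roofSum T g x n) (roofSum T g x (n + 1))) :
    T.specialFlow g u (x, 0) = (T.map^[n] x, u - roofSum T g x n) := by
  rw [specialFlow_eq]
  simp only [zero_add]
  rw [h.crossings_eq hu.1 hu.2]
  rfl

/-- Between two returns to the base, the integral of `f` along the flow is `φ_f`. -/
theorem IsGoodPoint.integral_between (h : IsGoodPoint T g f x) (n : ℕ) :
    IntervalIntegrable (fun u => f (T.specialFlow g u (x, 0))) volume (roofSum T g x n)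
      (roofSum T g x (n + 1)) ∧
    ∫ u in (roofSum T g x n)..(roofSum T g x (n + 1)), f (T.specialFlow g u (x, 0)) =
      roofIntegral g f (T.map^[n] x) := by
  have hle := h.roofSum_mono (Nat.le_succ n)
  have hG : (0 : ℝ) ≤ (g (T.map^[n] x)).toReal := ENNReal.toReal_nonneg
  have hfib : IntervalIntegrable (fun r => f (T.map^[n] x, r)) volume 0 (g (T.map^[n] x)).toReal := by
    rw [intervalIntegrable_iff_integrableOn_Ico_of_le hG, ← fibre_eq (h.ne_top n)]
    exact h.integrableOn n
  have heq : EqOn (fun u => f (T.map^[n] x, u - roofSum T g x n))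
      (fun u => f (T.specialFlow g u (x, 0))) (Ico (roofSum T g x n) (roofSum T g x (n + 1))) :=
    fun u hu => by simp only [h.flow_eq hu]
  constructor
  · have h1 := hfib.comp_sub_right (roofSum T g x n)
    rw [zero_add, add_comm, ← h.roofSum_succ,
      intervalIntegrable_iff_integrableOn_Ico_of_le hle] at h1
    rw [intervalIntegrable_iff_integrableOn_Ico_of_le hle]
    exact h1.congr_fun heq measurableSet_Ico
  · rw [intervalIntegral.integral_of_le hle, ← integral_Ico_eq_integral_Ioc,
      ← setIntegral_congr_fun measurableSet_Ico heq, integral_Ico_eq_integral_Ioc,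
      ← intervalIntegral.integral_of_le hle,
      intervalIntegral.integral_comp_sub_right (fun r => f (T.map^[n] x, r)), sub_self,
      h.roofSum_succ, add_sub_cancel_left, intervalIntegral.integral_of_le hG,
      ← integral_Ico_eq_integral_Ioc, ← fibre_eq (h.ne_top n)]
    rfl

theorem IsGoodPoint.integral_zero_roofSum (h : IsGoodPoint T g f x) (n : ℕ) :
    IntervalIntegrable (fun u => f (T.specialFlow g u (x, 0))) volume 0 (roofSum T g x n) ∧
    ∫ u in (0 : ℝ)..(roofSum T g x n), f (T.specialFlow g u (x, 0)) =
      birkhoffSum T.map (roofIntegral g f) n x := by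
  induction n with
  | zero => simp [roofSum_zero]
  | succ n ih =>
    obtain ⟨h1, h2⟩ := h.integral_between n
    refine ⟨ih.1.trans h1, ?_⟩
    rw [← intervalIntegral.integral_add_adjacent_intervals ih.1 h1, ih.2, h2, birkhoffSum_succ]

theorem IsGoodPoint.abs_integral_le (h : IsGoodPoint T g f x) {n : ℕ} {u : ℝ}
    (hu : u ∈ Icc (roofSum T g x n) (roofSum T g x (n + 1))) :
    IntervalIntegrable (fun u => f (T.specialFlow g u (x, 0))) volume (roofSum T g x n) u ∧
    |∫ v in (roofSum T g x n)..u, f (T.specialFlow g v (x, 0))| ≤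
      roofIntegral g (fun p => |f p|) (T.map^[n] x) := by
  obtain ⟨h1, -⟩ := h.integral_between n
  obtain ⟨h2, h3⟩ := h.abs.integral_between n
  refine ⟨h1.mono_set (uIcc_subset_uIcc left_mem_uIcc (mem_uIcc_of_le hu.1 hu.2)), ?_⟩
  rw [← h3]
  refine (intervalIntegral.abs_integral_le_integral_abs hu.1).trans ?_
  exact intervalIntegral.integral_mono_interval le_rfl hu.1 hu.2
    (Eventually.of_forall fun v => abs_nonneg _) h2

/-- The ergodic integral is a Birkhoff sum of `φ_f` up to incomplete passages at both ends. -/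
theorem IsGoodPoint.abs_ergodic_integral_le (h : IsGoodPoint T g f x) (hc0 : 0 < c)
    (hc : ∀ x, ENNReal.ofReal c ≤ g x) {r s : ℝ} (hr : r ∈ Ico 0 (g x).toReal) (hs : 0 ≤ s) :
    |∫ t in (0 : ℝ)..s, f (T.specialFlow g t (x, r))| ≤
      |birkhoffSum T.map (roofIntegral g f) (crossings T g (r + s) x) x| +
        roofIntegral g (fun p => |f p|) x +
        roofIntegral g (fun p => |f p|) (T.map^[crossings T g (r + s) x] x) := by
  set N := crossings T g (r + s) x
  have hshift : ∫ t in (0 : ℝ)..s, f (T.specialFlow g t (x, r)) =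
      ∫ u in r..(r + s), f (T.specialFlow g u (x, 0)) := by
    have := intervalIntegral.integral_comp_add_left (a := 0) (b := s)
      (fun u => f (T.specialFlow g u (x, 0))) r
    rw [add_zero] at this
    rw [← this]
    refine intervalIntegral.integral_congr fun t _ => ?_
    simp only [specialFlow_eq, zero_add]
  obtain ⟨hN1, hN2⟩ := h.roofSum_crossings hc0 hc (add_nonneg hr.1 hs)
  obtain ⟨i1, e1⟩ := h.integral_zero_roofSum N
  obtain ⟨i2, e2⟩ := h.abs_integral_le ⟨hN1, hN2.le⟩
  have hr1 : r ∈ Icc (roofSum T g x 0) (roofSum T g x (0 + 1)) := by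
    rw [h.roofSum_succ, roofSum_zero, zero_add]
    exact ⟨hr.1, hr.2.le⟩
  obtain ⟨i3, e3⟩ := h.abs_integral_le hr1
  rw [roofSum_zero] at i3 e3
  have e4 := intervalIntegral.integral_interval_sub_left (i1.trans i2) i3
  rw [← intervalIntegral.integral_add_adjacent_intervals i1 i2, e1] at e4
  rw [hshift, ← e4]
  rw [Function.iterate_zero, id] at e3
  have := abs_sub (birkhoffSum T.map (roofIntegral g f) N x +
    ∫ v in (roofSum T g x N)..(r + s), f (T.specialFlow g v (x, 0)))
    (∫ v in (0 : ℝ)..r, f (T.specialFlow g v (x, 0)))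
  have := abs_add_le (birkhoffSum T.map (roofIntegral g f) N x)
    (∫ v in (roofSum T g x N)..(r + s), f (T.specialFlow g v (x, 0)))
  linarith

/-- An orbit segment of length `s` that starts over `x` crosses the base at most `s / c + 1`
times. -/
theorem IsGoodPoint.crossings_le (h : IsGoodPoint T g f x) (hc0 : 0 < c)
    (hc : ∀ x, ENNReal.ofReal c ≤ g x) {r s : ℝ} (hr : r ∈ Ico 0 (g x).toReal) (hs : 0 ≤ s) :
    (crossings T g (r + s) x : ℝ) ≤ s / c + 1 := by
  obtain ⟨hN1, -⟩ := h.roofSum_crossings hc0 hc (add_nonneg hr.1 hs)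
  have key : ∀ n : ℕ, (g x).toReal + n * c ≤ roofSum T g x (n + 1) := by
    intro n
    induction n with
    | zero => rw [h.roofSum_succ, roofSum_zero]; simp
    | succ n ih =>
      rw [h.roofSum_succ (n + 1)]
      have := (ENNReal.ofReal_le_iff_le_toReal (h.ne_top (n + 1))).1 (hc _)
      push_cast
      linarith
  rcases Nat.eq_zero_or_pos (crossings T g (r + s) x) with h0 | h0
  · rw [h0]; push_cast; positivity
  · obtain ⟨k, hk⟩ := Nat.exists_eq_succ_of_ne_zero h0.ne'
    rw [hk] at hN1 ⊢
    have h1 := key k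
    have h2 : (k : ℝ) * c ≤ s := by
      rw [Nat.succ_eq_add_one] at hN1
      linarith [hr.2]
    rw [← le_div_iff₀ hc0] at h2
    push_cast
    linarith

/-- A window of length `s` sliding over `[0, G)`, by Tonelli. -/
theorem lintegral_window_le {G s : ℝ} {k : ℝ → ℝ≥0∞}
    (hk : AEMeasurable k (volume.restrict (Ico 0 G))) :
    ∫⁻ r in Ico 0 G, ∫⁻ u in Ico 0 G, (Ioc r (r + s)).indicator k u ≤
      min (ENNReal.ofReal s) (ENNReal.ofReal G) * ∫⁻ u in Ico 0 G, k u := by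
  have hS : MeasurableSet {q : ℝ × ℝ | q.1 < q.2 ∧ q.2 ≤ q.1 + s} :=
    (measurableSet_lt measurable_fst measurable_snd).inter
      (measurableSet_le measurable_snd (measurable_fst.add_const s))
  have hae : AEMeasurable (Function.uncurry fun r u => (Ioc r (r + s)).indicator k u)
      ((volume.restrict (Ico 0 G)).prod (volume.restrict (Ico 0 G))) := by
    have h1 : AEMeasurable (fun q : ℝ × ℝ => k q.2)
      ((volume.restrict (Ico 0 G)).prod (volume.restrict (Ico 0 G))) :=
      hk.comp_quasiMeasurePreserving Measure.quasiMeasurePreserving_snd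
    refine (h1.indicator hS).congr (Eventually.of_forall fun q => ?_)
    simp only [Function.uncurry, indicator, mem_ofPred_eq, mem_Ioc]
  rw [lintegral_lintegral_swap hae, ← lintegral_const_mul'' _ hk]
  refine lintegral_mono fun u => ?_
  have h2 : ∀ r, (Ioc r (r + s)).indicator k u = (Ico (u - s) u).indicator (fun _ => k u) r := by
    intro r
    simp only [indicator, mem_Ioc, mem_Ico]
    congr 1
    rw [eq_iff_iff]
    constructor <;> rintro ⟨h1, h2⟩ <;> constructor <;> linarith
  simp only [h2]
  rw [lintegral_indicator_const measurableSet_Ico, mul_comm, Measure.restrict_apply measurableSet_Ico]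
  gcongr
  refine le_min ((measure_mono inter_subset_left).trans ?_)
    ((measure_mono inter_subset_right).trans ?_)
  · rw [Real.volume_Ico, sub_sub_cancel]
  · rw [Real.volume_Ico, sub_zero]

/-- The integral over one fibre. Over the points that do not reach the next passage, the ergodic
integral is an integral of `f` over a window of length `s` in the same fibre. -/
theorem IsGoodPoint.lintegral_fibre_le (h : IsGoodPoint T g f x) (hc0 : 0 < c)
    (hc : ∀ x, ENNReal.ofReal c ≤ g x) {s : ℝ} (hs : 0 ≤ s) {H : ℝ≥0∞}
    (hH : ∀ N : ℕ, 1 ≤ N → (N : ℝ) ≤ s / c + 1 →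
      ENNReal.ofReal (|birkhoffSum T.map (roofIntegral g f) N x| +
        roofIntegral g (fun p => |f p|) x +
        roofIntegral g (fun p => |f p|) (T.map^[N] x)) ≤ H) :
    ∫⁻ r in fibre g x, ‖∫ t in (0 : ℝ)..s, f (T.specialFlow g t (x, r))‖ₑ ≤
      2 * (min (ENNReal.ofReal s) (g x) * H) := by
  have hx : g x ≠ ∞ := h.ne_top 0
  set G := (g x).toReal with hGdef
  have hgG : g x = ENNReal.ofReal G := (ENNReal.ofReal_toReal hx).symm
  have hint : IntegrableOn (fun r => f (x, r)) (Ico 0 G) := by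
    rw [← fibre_eq hx]; exact h.integrableOn 0
  have hk := hint.aestronglyMeasurable.enorm
  have hψ : ∫⁻ u in Ico 0 G, ‖f (x, u)‖ₑ = ENNReal.ofReal (roofIntegral g (fun p => |f p|) x) := by
    have : roofIntegral g (fun p => |f p|) x = ∫ u in Ico 0 G, ‖f (x, u)‖ := by
      rw [← fibre_eq hx]; rfl
    rw [this, ofReal_integral_norm_eq_lintegral_enorm hint]
  have hψ0 : ∀ y, 0 ≤ roofIntegral g (fun p => |f p|) y := fun y =>
    integral_nonneg fun r => abs_nonneg _
  have hψH : ENNReal.ofReal (roofIntegral g (fun p => |f p|) x) ≤ H := by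
    refine le_trans (ENNReal.ofReal_le_ofReal ?_) (hH 1 le_rfl ?_)
    · have := hψ0 (T.map^[1] x)
      have := abs_nonneg (birkhoffSum T.map (roofIntegral g f) 1 x)
      linarith
    · have : 0 ≤ s / c := by positivity
      push_cast; linarith
  have hR1 : roofSum T g x (0 + 1) = G := by rw [h.roofSum_succ, roofSum_zero, zero_add]; rfl
  have hpt : ∀ r ∈ Ico 0 G, ‖∫ t in (0 : ℝ)..s, f (T.specialFlow g t (x, r))‖ₑ ≤
      (∫⁻ u in Ico 0 G, (Ioc r (r + s)).indicator (fun u => ‖f (x, u)‖ₑ) u) +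
        (Ico (G - s) G).indicator (fun _ => H) r := by
    intro r hr
    rcases Nat.eq_zero_or_pos (crossings T g (r + s) x) with h0 | h0
    · refine le_trans ?_ le_self_add
      obtain ⟨-, hN2⟩ := h.roofSum_crossings hc0 hc (add_nonneg hr.1 hs)
      rw [h0, hR1] at hN2
      have e : ∫ t in (0 : ℝ)..s, f (T.specialFlow g t (x, r)) = ∫ u in r..(r + s), f (x, u) := by
        have := intervalIntegral.integral_comp_add_left (a := 0) (b := s) (fun u => f (x, u)) r
        rw [add_zero] at this
        rw [← this]
        refine intervalIntegral.integral_congr fun t ht => ?_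
        rw [uIcc_of_le hs] at ht
        have hcr : crossings T g (r + t) x = 0 := by
          refine h.crossings_eq ?_ ?_
          · rw [roofSum_zero]; linarith [hr.1, ht.1]
          · rw [hR1]; linarith [ht.2]
        simp only [specialFlow_eq, hcr]
        simp
      rw [e, intervalIntegral.integral_of_le (by linarith)]
      refine (enorm_integral_le_lintegral_enorm _).trans ?_
      rw [lintegral_indicator measurableSet_Ioc, Measure.restrict_restrict measurableSet_Ioc]
      refine lintegral_mono_set fun u hu => ⟨hu, ?_, ?_⟩
      · linarith [hr.1, hu.1]
      · linarith [hu.2]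
    · refine le_trans ?_ le_add_self
      obtain ⟨hN1, -⟩ := h.roofSum_crossings hc0 hc (add_nonneg hr.1 hs)
      have h1 := h.roofSum_mono h0
      rw [show (0 : ℕ).succ = 0 + 1 from rfl, hR1] at h1
      rw [indicator_of_mem (show r ∈ Ico (G - s) G from ⟨by linarith, hr.2⟩),
        ← ofReal_norm, Real.norm_eq_abs]
      exact (ENNReal.ofReal_le_ofReal (h.abs_ergodic_integral_le hc0 hc hr hs)).trans
        (hH _ h0 (h.crossings_le hc0 hc hr hs))
  rw [fibre_eq hx]
  calc ∫⁻ r in Ico 0 G, ‖∫ t in (0 : ℝ)..s, f (T.specialFlow g t (x, r))‖ₑ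
      ≤ ∫⁻ r in Ico 0 G, ((∫⁻ u in Ico 0 G, (Ioc r (r + s)).indicator (fun u => ‖f (x, u)‖ₑ) u) +
          (Ico (G - s) G).indicator (fun _ => H) r) := setLIntegral_mono' measurableSet_Ico hpt
    _ = (∫⁻ r in Ico 0 G, ∫⁻ u in Ico 0 G, (Ioc r (r + s)).indicator (fun u => ‖f (x, u)‖ₑ) u) +
          ∫⁻ r in Ico 0 G, (Ico (G - s) G).indicator (fun _ => H) r :=
        lintegral_add_right _ (measurable_const.indicator measurableSet_Ico)
    _ ≤ min (ENNReal.ofReal s) (g x) * H + min (ENNReal.ofReal s) (g x) * H := by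
        refine add_le_add ?_ ?_
        · refine (lintegral_window_le hk).trans ?_
          rw [hψ, ← hgG]
          gcongr
        · rw [lintegral_indicator_const measurableSet_Ico, mul_comm,
            Measure.restrict_apply measurableSet_Ico]
          gcongr
          refine le_min ((measure_mono inter_subset_left).trans ?_)
            ((measure_mono inter_subset_right).trans ?_)
          · rw [Real.volume_Ico, sub_sub_cancel]
          · rw [Real.volume_Ico, sub_zero, ← hgG]
    _ = 2 * (min (ENNReal.ofReal s) (g x) * H) := by rw [two_mul]

theorem lintegral_suspension {F : ℝ × ℝ → ℝ≥0∞} (hg : Measurable g)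
    (hF : AEMeasurable F (volume.restrict (T.suspension g))) :
    ∫⁻ p in T.suspension g, F p = ∫⁻ x in T.base, ∫⁻ r in fibre g x, F (x, r) := by
  have hsusp := T.measurableSet_suspension hg
  rw [← lintegral_indicator hsusp, Measure.volume_eq_prod, lintegral_prod,
    ← lintegral_indicator T.measurableSet_base]
  · refine lintegral_congr fun x => ?_
    by_cases hx : x ∈ T.base
    · rw [indicator_of_mem hx, ← lintegral_indicator]
      · refine lintegral_congr fun r => ?_
        simp only [indicator, suspension, fibre, mem_ofPred_eq, hx, true_and]
        congr
      · exact measurableSet_fibre g x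
    · rw [indicator_of_notMem hx, lintegral_eq_zero_of_ae_eq_zero]
      exact Eventually.of_forall fun r => indicator_of_notMem (fun h => hx h.1) _
  · rw [← Measure.volume_eq_prod]
    exact (aemeasurable_indicator_iff hsusp).2 hF

theorem ae_isGoodPoint (hT : ∀ α, 0 < T.len α) (hg : Measurable g)
    (hfin : ∀ᵐ x ∂volume.restrict T.base, g x ≠ ∞) (hf : IntegrableOn f (T.suspension g)) :
    ∀ᵐ x ∂volume.restrict T.base, IsGoodPoint T g f x := by
  have hsusp := T.measurableSet_suspension hg
  have h1 : ∀ᵐ x ∂volume.restrict T.base, IntegrableOn (fun r => f (x, r)) (fibre g x) := by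
    rw [ae_restrict_iff' T.measurableSet_base]
    have h2 := (integrable_indicator_iff hsusp).2 hf
    rw [Measure.volume_eq_prod] at h2
    filter_upwards [h2.prod_right_ae] with x hx hxb
    rw [← integrable_indicator_iff (measurableSet_fibre g x)]
    refine hx.congr (Eventually.of_forall fun r => ?_)
    simp only [indicator, suspension, fibre, mem_ofPred_eq, hxb, true_and]
    congr
  have h3 : ∀ n : ℕ, ∀ᵐ x ∂volume.restrict T.base, g (T.map^[n] x) ≠ ∞ ∧
      IntegrableOn (fun r => f (T.map^[n] x, r)) (fibre g (T.map^[n] x)) := fun n =>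
    ((measurePreserving_map hT).iterate n).quasiMeasurePreserving.ae (hfin.and h1)
  filter_upwards [ae_all_iff.2 h3] with x hx
  exact ⟨fun n => (hx n).1, fun n => (hx n).2⟩

/-- The `L¹` norm of ergodic integrals is controlled on the base. -/
theorem lintegral_ergodic_integral_le (hT : ∀ α, 0 < T.len α) (hg : Measurable g) (hc0 : 0 < c)
    (hc : ∀ x, ENNReal.ofReal c ≤ g x) (hfin : ∀ᵐ x ∂volume.restrict T.base, g x ≠ ∞)
    (hf : IntegrableOn f (T.suspension g)) {s : ℝ} (hs : 0 ≤ s) {H : ℝ → ℝ≥0∞}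
    (hH : ∀ᵐ x ∂volume.restrict T.base, ∀ N : ℕ, 1 ≤ N → (N : ℝ) ≤ s / c + 1 →
      ENNReal.ofReal (|birkhoffSum T.map (roofIntegral g f) N x| +
        roofIntegral g (fun p => |f p|) x +
        roofIntegral g (fun p => |f p|) (T.map^[N] x)) ≤ H x) :
    ∫⁻ p in T.suspension g, ‖∫ t in (0 : ℝ)..s, f (T.specialFlow g t p)‖ₑ ≤
      ∫⁻ x in T.base, 2 * (min (ENNReal.ofReal s) (g x) * H x) := by
  have hmeas : AEMeasurable (fun p => ‖∫ t in (0 : ℝ)..s, f (T.specialFlow g t p)‖ₑ)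
      (volume.restrict (T.suspension g)) := by
    have := (integrable_comp_specialFlow hT hg hc0 hc hf s).integral_prod_right
    simp only [intervalIntegral.integral_of_le hs]
    exact this.aestronglyMeasurable.enorm
  rw [lintegral_suspension hg hmeas]
  refine lintegral_mono_ae ?_
  filter_upwards [hH, ae_isGoodPoint hT hg hfin hf] with x hx hgood
  exact hgood.lintegral_fibre_le hc0 hc hs hx

end Orbit

end IET

namespace IET

variable {𝒜 : Type*} [Fintype 𝒜] [DecidableEq 𝒜] {d : ℕ}

/-! ### Integration over towers -/

section

variable {T S : IET 𝒜 d} {B : Matrix 𝒜 𝒜 ℕ}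

/-- The floors of the towers cover the base. -/
theorem IsTower.lintegral_le (h : IsTower T S B) (F : ℝ → ℝ≥0∞) :
    ∫⁻ x in T.base, F x ≤
      ∑ α, ∑ j ∈ Finset.range (rowSum B α), ∫⁻ y in S.piece α, F (T.map^[j] y) := by
  choose β c hc using fun (α : 𝒜) (j : Fin (rowSum B α)) => h.floor α j j.2
  have hcov : T.base ⊆ ⋃ q : Σ α, Fin (rowSum B α),
      Ico (S.left q.1 + c q.1 q.2) (S.right q.1 + c q.1 q.2) := by
    intro z hz
    obtain ⟨α, x, hx, j, hj, rfl⟩ := h.cover z hz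
    refine mem_iUnion.2 ⟨⟨α, ⟨j, hj⟩⟩, ?_⟩
    have := (hc α ⟨j, hj⟩ x hx).1
    simp only at this
    rw [this]
    exact ⟨by linarith [hx.1], by linarith [hx.2]⟩
  refine (lintegral_mono_set hcov).trans ((lintegral_iUnion_le _ _).trans ?_)
  rw [tsum_fintype, Fintype.sum_sigma]
  refine Finset.sum_le_sum fun α _ => ?_
  rw [Finset.sum_range]
  refine Finset.sum_le_sum fun j _ => ?_
  rw [← setLIntegral_Ico_add]
  refine le_of_eq (setLIntegral_congr_fun measurableSet_Ico fun y hy => ?_)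
  simp only [(hc α j y hy).1]

theorem lintegral_gap_rpow_le (hS : ∀ α, 0 < S.len α) {θ : ℝ} (hθ : θ < 1) :
    ∫⁻ y in S.base, ENNReal.ofReal (S.gap y ^ (-θ)) ≤
      ENNReal.ofReal (Fintype.card 𝒜 * (2 / (1 - θ) * S.total ^ (1 - θ))) := by
  have h1 : 0 < 1 - θ := by linarith
  have htot : 0 ≤ S.total := Finset.sum_nonneg fun α _ => (hS α).le
  rw [lintegral_base hS, ENNReal.ofReal_mul (by positivity), ENNReal.ofReal_natCast,
    ← nsmul_eq_mul, ← Finset.card_univ]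
  refine Finset.sum_le_card_nsmul _ _ _ fun α _ => ?_
  have hlr := left_lt_right hS α
  have hlen := hS α
  calc ∫⁻ y in S.piece α, ENNReal.ofReal (S.gap y ^ (-θ))
      ≤ ∫⁻ y in S.piece α, ENNReal.ofReal ((y - S.left α) ^ (-θ) + (S.right α - y) ^ (-θ)) :=
        setLIntegral_mono' (S.measurableSet_piece α) fun y hy =>
          ENNReal.ofReal_le_ofReal (gap_rpow_le_add hS hy)
    _ = ENNReal.ofReal (∫ y in S.piece α, ((y - S.left α) ^ (-θ) + (S.right α - y) ^ (-θ))) := by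
        refine (ofReal_integral_eq_lintegral_ofReal (integrableOn_gap hlr.le hθ) ?_).symm
        refine (ae_restrict_iff' (S.measurableSet_piece α)).2 (Eventually.of_forall fun y hy => ?_)
        exact add_nonneg (Real.rpow_nonneg (by linarith [hy.1]) _)
          (Real.rpow_nonneg (by linarith [hy.2]) _)
    _ ≤ ENNReal.ofReal (2 / (1 - θ) * S.total ^ (1 - θ)) := by
        rw [piece, integral_gap hlr.le hθ]
        refine ENNReal.ofReal_le_ofReal ?_
        have h2 : S.right α - S.left α ≤ S.total := by
          linarith [right_le_total hS α, left_nonneg hS α]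
        gcongr

theorem ae_gap_pos (hS : ∀ α, 0 < S.len α) : ∀ᵐ y ∂volume.restrict S.base, 0 < S.gap y := by
  have hfin : (range S.left).Finite := finite_range _
  have h1 : ∀ᵐ y ∂(volume : Measure ℝ), y ∉ range S.left :=
    measure_eq_zero_iff_ae_notMem.1 (hfin.measure_zero _)
  rw [ae_restrict_iff' S.measurableSet_base]
  filter_upwards [h1] with y hy hb
  obtain ⟨α, hα⟩ := exists_piece hb
  exact gap_pos hS ⟨lt_of_le_of_ne hα.1 fun e => hy ⟨α, e⟩, hα.2⟩

end

/-- The weight `min s u⁻ᵃ + q` of a column against the bound `M + u⁻ᵇ + v⁻ᵇ` for Birkhoff sums.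
The product of the two singularities is made integrable by `min s x ≤ sᵇ x¹⁻ᵇ`. -/
theorem weight_mul_bound_le {a b s q M u v : ℝ} (ha0 : 0 < a) (hb : 0 < b) (hb1 : b < 1)
    (hs : 0 ≤ s) (hM : 0 ≤ M) (hu : 0 < u) (hv : 0 < v) :
    (min s (u ^ (-a)) + q) * (M + (u ^ (-b) + v ^ (-b))) ≤
      M * u ^ (-a) + q * M + q * (u ^ (-b) + v ^ (-b)) +
        2 * s ^ b * (u ^ (-(a * (1 - b) + b)) + v ^ (-(a * (1 - b) + b))) := by
  set θ := a * (1 - b) + b with hθ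
  have hua : 0 < u ^ (-a) := Real.rpow_pos_of_pos hu _
  have h1b : 0 < 1 - b := by linarith
  have ha1 : 0 < a * (1 - b) := by positivity
  have hmin : min s (u ^ (-a)) ≤ s ^ b * u ^ (-(a * (1 - b))) := by
    have h0 : 0 ≤ min s (u ^ (-a)) := le_min hs hua.le
    calc min s (u ^ (-a)) = min s (u ^ (-a)) ^ b * min s (u ^ (-a)) ^ (1 - b) := by
          rw [← Real.rpow_add_of_nonneg h0 hb.le h1b.le]; simp
      _ ≤ s ^ b * (u ^ (-a)) ^ (1 - b) := by
          gcongr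
          · exact min_le_left _ _
          · exact min_le_right _ _
      _ = s ^ b * u ^ (-(a * (1 - b))) := by rw [← Real.rpow_mul hu.le]; ring_nf
  have hsb : 0 ≤ s ^ b := Real.rpow_nonneg hs _
  have huθ : 0 < u ^ (-θ) := Real.rpow_pos_of_pos hu _
  have hvθ : 0 < v ^ (-θ) := Real.rpow_pos_of_pos hv _
  have huu : u ^ (-(a * (1 - b))) * u ^ (-b) = u ^ (-θ) := by
    rw [← Real.rpow_add hu]; congr 1; rw [hθ]; ring
  have huv : u ^ (-(a * (1 - b))) * v ^ (-b) ≤ u ^ (-θ) + v ^ (-θ) := by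
    have hw : 0 < min u v := lt_min hu hv
    calc u ^ (-(a * (1 - b))) * v ^ (-b)
        ≤ (min u v) ^ (-(a * (1 - b))) * (min u v) ^ (-b) := by
          gcongr ?_ * ?_
          · exact Real.rpow_le_rpow_of_nonpos hw (min_le_left _ _) (by linarith)
          · exact Real.rpow_le_rpow_of_nonpos hw (min_le_right _ _) (by linarith)
      _ = (min u v) ^ (-θ) := by rw [← Real.rpow_add hw]; congr 1; rw [hθ]; ring
      _ ≤ _ := min_rpow_neg_le_add hu.le hv.le
  have hub : 0 < u ^ (-b) := Real.rpow_pos_of_pos hu _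
  have hvb : 0 < v ^ (-b) := Real.rpow_pos_of_pos hv _
  have h1 : min s (u ^ (-a)) * M ≤ u ^ (-a) * M := by gcongr; exact min_le_right _ _
  have h2 : min s (u ^ (-a)) * (u ^ (-b) + v ^ (-b)) ≤ s ^ b * (2 * (u ^ (-θ) + v ^ (-θ))) := by
    calc min s (u ^ (-a)) * (u ^ (-b) + v ^ (-b))
        ≤ s ^ b * u ^ (-(a * (1 - b))) * (u ^ (-b) + v ^ (-b)) := by gcongr
      _ = s ^ b * (u ^ (-(a * (1 - b))) * u ^ (-b) + u ^ (-(a * (1 - b))) * v ^ (-b)) := by ring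
      _ ≤ s ^ b * (2 * (u ^ (-θ) + v ^ (-θ))) := by
          rw [huu]
          gcongr
          linarith
  nlinarith

section

variable {S : IET 𝒜 d}

theorem lintegral_weight_mul_bound_le (hS : ∀ α, 0 < S.len α) {a b s q M : ℝ} (ha0 : 0 < a)
    (ha : a < 1) (hb : 0 < b) (hb1 : b < 1) (hs : 0 ≤ s) (hM : 0 ≤ M) (hq : 0 ≤ q) :
    ∫⁻ y in S.base, ENNReal.ofReal ((min s (S.gap y ^ (-a)) + q) *
        (M + (S.gap y ^ (-b) + S.gap (S.map y) ^ (-b)))) ≤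
      ENNReal.ofReal (M * (Fintype.card 𝒜 * (2 / (1 - a) * S.total ^ (1 - a))) + q * M * S.total +
        2 * q * (Fintype.card 𝒜 * (2 / (1 - b) * S.total ^ (1 - b))) +
        4 * s ^ b * (Fintype.card 𝒜 * (2 / (1 - (a * (1 - b) + b)) *
          S.total ^ (1 - (a * (1 - b) + b))))) := by
  set θ := a * (1 - b) + b with hθ
  have hθ1 : θ < 1 := by
    have : a * (1 - b) < 1 * (1 - b) := by
      apply mul_lt_mul_of_pos_right ha; linarith
    rw [hθ]; linarith
  have htot : 0 ≤ S.total := Finset.sum_nonneg fun α _ => (hS α).le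
  have h1a : 0 < 1 - a := by linarith
  have h1b : 0 < 1 - b := by linarith
  have h1θ : 0 < 1 - θ := by linarith
  have hsb : 0 ≤ s ^ b := Real.rpow_nonneg hs _
  have hg0 : ∀ (p y : ℝ), 0 ≤ S.gap y ^ p := fun p y => Real.rpow_nonneg (S.gap_nonneg y) _
  have hmg : ∀ p : ℝ, Measurable fun y => ENNReal.ofReal (S.gap y ^ p) := fun p =>
    ENNReal.measurable_ofReal.comp (S.measurable_gap.pow_const p)
  have hmg' : ∀ p : ℝ, Measurable fun y => ENNReal.ofReal (S.gap (S.map y) ^ p) := fun p =>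
    (hmg p).comp S.measurable_map
  have hms : ∀ p : ℝ, Measurable fun y =>
      ENNReal.ofReal (S.gap y ^ p) + ENNReal.ofReal (S.gap (S.map y) ^ p) := fun p =>
    (hmg p).add (hmg' p)
  have hmc : ∀ (r : ℝ≥0∞) (p : ℝ), Measurable fun y =>
      r * (ENNReal.ofReal (S.gap y ^ p) + ENNReal.ofReal (S.gap (S.map y) ^ p)) := fun r p =>
    (hms p).const_mul r
  have hpt : ∀ᵐ y ∂volume.restrict S.base, ENNReal.ofReal ((min s (S.gap y ^ (-a)) + q) *
        (M + (S.gap y ^ (-b) + S.gap (S.map y) ^ (-b)))) ≤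
      ENNReal.ofReal M * ENNReal.ofReal (S.gap y ^ (-a)) + ENNReal.ofReal (q * M) +
        ENNReal.ofReal q * (ENNReal.ofReal (S.gap y ^ (-b)) +
          ENNReal.ofReal (S.gap (S.map y) ^ (-b))) +
        ENNReal.ofReal (2 * s ^ b) * (ENNReal.ofReal (S.gap y ^ (-θ)) +
          ENNReal.ofReal (S.gap (S.map y) ^ (-θ))) := by
    filter_upwards [ae_gap_pos hS,
      (measurePreserving_map hS).quasiMeasurePreserving.ae (ae_gap_pos hS)] with y hy hy'
    refine (ENNReal.ofReal_le_ofReal (weight_mul_bound_le ha0 hb hb1 hs hM hy hy')).trans ?_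
    have e1 := hg0 (-a) y
    have e2 := hg0 (-b) y
    have e3 := hg0 (-b) (S.map y)
    have e4 := hg0 (-θ) y
    have e5 := hg0 (-θ) (S.map y)
    rw [ENNReal.ofReal_add (by positivity) (by positivity),
      ENNReal.ofReal_add (by positivity) (by positivity),
      ENNReal.ofReal_add (by positivity) (by positivity), ENNReal.ofReal_mul hM,
      ENNReal.ofReal_mul (p := q) (q := S.gap y ^ (-b) + S.gap (S.map y) ^ (-b)) hq,
      ENNReal.ofReal_mul (p := 2 * s ^ b) (by positivity), ENNReal.ofReal_add e2 e3,
      ENNReal.ofReal_add e4 e5]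
  refine (lintegral_mono_ae hpt).trans ?_
  have hI := fun (p : ℝ) => lintegral_comp_map hS fun y => ENNReal.ofReal (S.gap y ^ p)
  rw [lintegral_add_right _ (hmc _ _), lintegral_add_right _ (hmc _ _),
    lintegral_add_right _ measurable_const, lintegral_const_mul _ (hmg _),
    lintegral_const_mul _ (hms _), lintegral_const_mul _ (hms _),
    lintegral_add_left (hmg _), lintegral_add_left (hmg _), hI, hI, setLIntegral_const,
    show volume S.base = ENNReal.ofReal S.total by rw [base, Real.volume_Ico, sub_zero],
    ← two_mul, ← two_mul]
  have ba := lintegral_gap_rpow_le hS ha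
  have bb := lintegral_gap_rpow_le hS hb1
  have bθ := lintegral_gap_rpow_le hS hθ1
  refine (add_le_add (add_le_add (add_le_add (mul_le_mul_right ba _) le_rfl)
    (mul_le_mul_right (mul_le_mul_right bb _) _))
    (mul_le_mul_right (mul_le_mul_right bθ _) _)).trans ?_
  have h2 : (2 : ℝ≥0∞) = ENNReal.ofReal 2 := by simp
  have ta : 0 ≤ S.total ^ (1 - a) := Real.rpow_nonneg htot _
  have tb : 0 ≤ S.total ^ (1 - b) := Real.rpow_nonneg htot _
  have tθ : 0 ≤ S.total ^ (1 - θ) := Real.rpow_nonneg htot _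
  rw [h2, ← ENNReal.ofReal_mul hM, ← ENNReal.ofReal_mul (by positivity),
    ← ENNReal.ofReal_mul (by positivity), ← ENNReal.ofReal_mul hq,
    ← ENNReal.ofReal_mul (by positivity), ← ENNReal.ofReal_mul (by positivity),
    ← ENNReal.ofReal_add (by positivity) (by positivity),
    ← ENNReal.ofReal_add (by positivity) (by positivity),
    ← ENNReal.ofReal_add (by positivity) (by positivity)]
  refine ENNReal.ofReal_le_ofReal (le_of_eq ?_)
  ring

end

/-- Comparison of the integral over the base with an integral over the base of a tower, when the
second factor is bounded on each column. -/
theorem IsTower.lintegral_min_mul_le {T S : IET 𝒜 d} {B : Matrix 𝒜 𝒜 ℕ} (h : IsTower T S B)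
    (hT : ∀ α, 0 < T.len α) (hS : ∀ α, 0 < S.len α) {g : ℝ → ℝ≥0∞} (hg : Measurable g)
    {a s q Kg : ℝ} (ha0 : 0 < a) (ha : a < 1) (hs : 0 ≤ s) (hKg : 1 ≤ Kg)
    (hgK : ∀ x, 0 < T.gap x → g x ≤ ENNReal.ofReal (Kg * T.gap x ^ (-a)))
    (hq : ∀ α, T.total ^ (1 - a) / (1 - a) / S.len α ≤ q) {H : ℝ → ℝ≥0∞} {V : ℝ → ℝ}
    (hV : ∀ᵐ y ∂volume.restrict S.base, ∀ α, y ∈ S.piece α → ∀ j < rowSum B α,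
      H (T.map^[j] y) ≤ ENNReal.ofReal (V y)) :
    ∫⁻ x in T.base, min (ENNReal.ofReal s) (g x) * H x ≤
      ENNReal.ofReal (Fintype.card 𝒜 * 2 * Kg) *
        ∫⁻ y in S.base, ENNReal.ofReal ((min s (S.gap y ^ (-a)) + q) * V y) := by
  refine (h.lintegral_le _).trans ?_
  rw [lintegral_base hS, Finset.mul_sum]
  refine Finset.sum_le_sum fun α _ => ?_
  have hsub := piece_subset_base hS α
  have hmeas : ∀ j, Measurable fun y => min (ENNReal.ofReal s) (g (T.map^[j] y)) := fun j =>
    measurable_const.min (hg.comp (T.measurable_map.iterate j))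
  calc ∑ j ∈ Finset.range (rowSum B α), ∫⁻ y in S.piece α,
        min (ENNReal.ofReal s) (g (T.map^[j] y)) * H (T.map^[j] y)
      ≤ ∑ j ∈ Finset.range (rowSum B α), ∫⁻ y in S.piece α,
        min (ENNReal.ofReal s) (g (T.map^[j] y)) * ENNReal.ofReal (V y) := by
        refine Finset.sum_le_sum fun j hj => lintegral_mono_ae ?_
        filter_upwards [ae_restrict_of_ae_restrict_of_subset hsub hV,
          ae_restrict_mem (S.measurableSet_piece α)] with y hy hyα
        gcongr
        exact hy α hyα j (Finset.mem_range.1 hj)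
    _ ≤ ∫⁻ y in S.piece α, ∑ j ∈ Finset.range (rowSum B α),
        min (ENNReal.ofReal s) (g (T.map^[j] y)) * ENNReal.ofReal (V y) := by
        induction Finset.range (rowSum B α) using Finset.induction_on with
        | empty => simp
        | insert j t hj ih =>
          simp only [Finset.sum_insert hj]
          exact (add_le_add_right ih _).trans (le_lintegral_add _ _)
    _ ≤ ∫⁻ y in S.piece α, ENNReal.ofReal (Fintype.card 𝒜 * 2 * Kg) *
        ENNReal.ofReal ((min s (S.gap y ^ (-a)) + q) * V y) := by
        refine lintegral_mono_ae ?_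
        filter_upwards [ae_restrict_of_ae_restrict_of_subset hsub (ae_gap_pos hS),
          ae_restrict_mem (S.measurableSet_piece α)] with y hy hyα
        have hy' : y ∈ Ioo (S.left α) (S.right α) := by
          rw [gap_of_mem hS hyα, lt_min_iff] at hy
          exact ⟨by linarith, hyα.2⟩
        rw [← Finset.sum_mul, ENNReal.ofReal_mul (p := min s (S.gap y ^ (-a)) + q), ← mul_assoc]
        swap
        · have h0 : 0 ≤ T.total := Finset.sum_nonneg fun α _ => (hT α).le
          have h1 : 0 ≤ T.total ^ (1 - a) / (1 - a) / S.len α :=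
            div_nonneg (div_nonneg (Real.rpow_nonneg h0 _) (by linarith)) (hS α).le
          exact add_nonneg (le_min hs (Real.rpow_nonneg hy.le _)) (h1.trans (hq α))
        gcongr
        rw [← ENNReal.ofReal_mul (by positivity)]
        have hterm : ∀ j ∈ Finset.range (rowSum B α), min (ENNReal.ofReal s) (g (T.map^[j] y)) ≤
            ENNReal.ofReal (Kg * min s (T.gap (T.map^[j] y) ^ (-a))) := by
          intro j hj
          have hgap := hy.trans_le (h.gap_le hT hS hyα (Finset.mem_range.1 hj))
          rw [mul_min_of_nonneg _ _ (by linarith), ENNReal.ofReal_min]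
          refine min_le_min (ENNReal.ofReal_le_ofReal ?_) (hgK _ hgap)
          nlinarith
        refine (Finset.sum_le_sum hterm).trans ?_
        rw [← ENNReal.ofReal_sum_of_nonneg fun j _ => mul_nonneg (by linarith)
          (le_min hs (Real.rpow_nonneg (T.gap_nonneg _) _)), ← Finset.mul_sum]
        refine ENNReal.ofReal_le_ofReal ?_
        have h2 := h.sum_min_gap_rpow_le hT hS hy' ha0 ha hs
        have h3 := hq α
        calc Kg * ∑ j ∈ Finset.range (rowSum B α), min s (T.gap (T.map^[j] y) ^ (-a))
            ≤ Kg * (Fintype.card 𝒜 * (2 * (min s (S.gap y ^ (-a)) +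
                T.total ^ (1 - a) / (1 - a) / S.len α))) := by gcongr
          _ ≤ Kg * (Fintype.card 𝒜 * (2 * (min s (S.gap y ^ (-a)) + q))) := by gcongr
          _ = Fintype.card 𝒜 * 2 * Kg * (min s (S.gap y ^ (-a)) + q) := by ring
    _ = ENNReal.ofReal (Fintype.card 𝒜 * 2 * Kg) *
        ∫⁻ y in S.piece α, ENNReal.ofReal ((min s (S.gap y ^ (-a)) + q) * V y) :=
        lintegral_const_mul' _ _ ENNReal.ofReal_ne_top

end IET

namespace IET

variable {𝒜 : Type*} [Fintype 𝒜] [DecidableEq 𝒜] {d : ℕ} [NeZero d]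

/-! ### The ergodic integral at a given level of renormalization -/

theorem matNorm_le {B : Matrix 𝒜 𝒜 ℕ} [Nonempty 𝒜] {r : ℝ} (h : ∀ α, (rowSum B α : ℝ) ≤ r) :
    matNorm B ≤ r := by
  obtain ⟨α, -, hα⟩ := Finset.exists_mem_eq_sup Finset.univ Finset.univ_nonempty
    (fun α => ∑ β, B α β)
  rw [matNorm, hα]
  exact h α

theorem matNorm_mul_le [Nonempty 𝒜] (B C : Matrix 𝒜 𝒜 ℕ) :
    matNorm (C * B) ≤ matNorm C * matNorm B := by
  refine matNorm_le fun α => ?_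
  have e : rowSum (C * B) α = ∑ β, C α β * rowSum B β := by
    simp only [rowSum, Matrix.mul_apply, Finset.mul_sum]
    exact Finset.sum_comm
  rw [e]
  push_cast
  have hB0 : 0 ≤ matNorm B := Nat.cast_nonneg _
  calc ∑ β, (C α β : ℝ) * rowSum B β ≤ ∑ β, (C α β : ℝ) * matNorm B :=
        Finset.sum_le_sum fun β _ => mul_le_mul_of_nonneg_left (rowSum_le_matNorm B β)
          (Nat.cast_nonneg _)
    _ = (rowSum C α : ℝ) * matNorm B := by rw [← Finset.sum_mul, rowSum]; push_cast; rfl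
    _ ≤ matNorm C * matNorm B := mul_le_mul_of_nonneg_right (rowSum_le_matNorm C α) hB0

theorem matNorm_one [Nonempty 𝒜] : matNorm (1 : Matrix 𝒜 𝒜 ℕ) ≤ 1 :=
  matNorm_le fun α => by simp [rowSum, Matrix.one_apply]

theorem Q_zero_zero (T : IET 𝒜 d) (n : ℕ → ℕ) : T.Q n 0 0 = 1 := by simp [Q, kz]

theorem nonempty_alphabet (T : IET 𝒜 d) : Nonempty 𝒜 := ⟨T.lastLetter 0⟩

theorem total_le_matNorm_mul {T : IET 𝒜 d} (h : T.Renormalizable) {n : ℕ → ℕ}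
    (hn : IsAccelerating n) (k : ℕ) : T.total ≤ matNorm (T.Q n 0 k) * (T.acc n k).total := by
  rw [← sum_height_mul_len h hn k, total, Finset.mul_sum]
  exact Finset.sum_le_sum fun α _ => mul_le_mul_of_nonneg_right (rowSum_le_matNorm _ α)
    ((acc_renormalizable h n k).pos α).le

theorem acc_total_le {T : IET 𝒜 d} (h : T.Renormalizable) {n : ℕ → ℕ} (hn : IsAccelerating n)
    (k : ℕ) : (T.acc n k).total ≤ T.total := by
  rw [← sum_height_mul_len h hn k, total]
  refine Finset.sum_le_sum fun α _ => ?_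
  have h1 : (1 : ℝ) ≤ T.height n k α := by
    exact_mod_cast (isTower_acc_zero h hn k).height_pos α
  have h2 := (acc_renormalizable h n k).pos α
  nlinarith

/-- The bounds for the Birkhoff sum and for the two incomplete passages, collected in one factor;
`x` and `z` stand for the singularities of the columns that the orbit segment meets. -/
theorem column_bound_le {P M C Kψ x z : ℝ} (hP : 1 ≤ P) (hC : 0 ≤ C) (hK : 0 ≤ Kψ) (hM : 0 ≤ M)
    (hx : 0 ≤ x) (hz : 0 ≤ z) :
    2 * (P * (M + C * x)) + P * (M + C * z) + Kψ * x + Kψ * (x + z) ≤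
      P * (3 * (1 + C) + 2 * Kψ) * (M + (x + z)) := by
  have e1 : Kψ * x + Kψ * (x + z) ≤ P * (Kψ * (2 * (x + z))) := by
    have h1 : 0 ≤ Kψ * (2 * (x + z)) := by positivity
    have h2 : Kψ * x + Kψ * (x + z) ≤ Kψ * (2 * (x + z)) := by
      have := mul_nonneg hK hz
      linarith
    exact h2.trans (le_mul_of_one_le_left h1 hP)
  have e2 : P * (2 * (M + C * x) + (M + C * z)) ≤ P * (3 * (1 + C) * (M + (x + z))) := by
    refine mul_le_mul_of_nonneg_left ?_ (by linarith)
    have := mul_nonneg hC hM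
    have := mul_nonneg hC hx
    have := mul_nonneg hC hz
    linarith
  have e3 : P * (Kψ * (2 * (x + z))) ≤ P * (2 * Kψ * (M + (x + z))) := by
    refine mul_le_mul_of_nonneg_left ?_ (by linarith)
    have := mul_nonneg hK hM
    linarith
  linarith

/-- The integral over a base of length `ℓ` of the weighted bound, in terms of the maximal height
`m` of the towers. -/
theorem level_integral_le {κ L' L ℓ a b θ N M m s : ℝ} (hκ : 1 ≤ κ) (ha : a < 1) (hb1 : b < 1)
    (hb : 0 < b) (hθ : 0 < 1 - θ) (hN : 0 ≤ N) (hM : 0 ≤ M) (hs : 0 ≤ s) (hL : 0 < L)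
    (hL' : 0 < L') (hℓ : 0 < ℓ) (hℓL : ℓ ≤ L) (hm : 0 ≤ m) (hmL : L ≤ m * ℓ) :
    M * (N * (2 / (1 - a) * ℓ ^ (1 - a))) + κ * L' / ℓ * M * ℓ +
        2 * (κ * L' / ℓ) * (N * (2 / (1 - b) * ℓ ^ (1 - b))) +
        4 * s ^ b * (N * (2 / (1 - θ) * ℓ ^ (1 - θ))) ≤
      (N * (2 / (1 - a) * L ^ (1 - a)) + κ * L' + 2 * (κ * L') * (N * (2 / (1 - b))) * L ^ (-b) +
        4 * (N * (2 / (1 - θ) * L ^ (1 - θ)))) * (M + m ^ b + s ^ b) := by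
  have h1a : 0 < 1 - a := by linarith
  have h1b : 0 < 1 - b := by linarith
  have hm0 : 0 < m := pos_of_mul_pos_left (hL.trans_le hmL) hℓ.le
  have hsb : 0 ≤ s ^ b := Real.rpow_nonneg hs _
  have hmb : 0 < m ^ b := Real.rpow_pos_of_pos hm0 _
  have t1 : M * (N * (2 / (1 - a) * ℓ ^ (1 - a))) ≤ M * (N * (2 / (1 - a) * L ^ (1 - a))) := by
    gcongr
  have t2 : κ * L' / ℓ * M * ℓ = κ * L' * M := by field_simp
  have t3 : ℓ ^ (-b) ≤ L ^ (-b) * m ^ b := by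
    rw [Real.rpow_neg hℓ.le, Real.rpow_neg hL.le, inv_mul_eq_div, inv_eq_one_div,
      div_le_div_iff₀ (Real.rpow_pos_of_pos hℓ _) (Real.rpow_pos_of_pos hL _), one_mul,
      ← Real.mul_rpow hm hℓ.le]
    exact Real.rpow_le_rpow hL.le hmL hb.le
  have t4 : 2 * (κ * L' / ℓ) * (N * (2 / (1 - b) * ℓ ^ (1 - b))) =
      2 * (κ * L') * (N * (2 / (1 - b))) * ℓ ^ (-b) := by
    have : ℓ ^ (1 - b) = ℓ ^ (-b) * ℓ := by
      rw [← Real.rpow_add_one hℓ.ne']; congr 1; ring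
    rw [this]
    field_simp
  have t5 : 2 * (κ * L') * (N * (2 / (1 - b))) * ℓ ^ (-b) ≤
      2 * (κ * L') * (N * (2 / (1 - b))) * (L ^ (-b) * m ^ b) := by gcongr
  have t6 : 4 * s ^ b * (N * (2 / (1 - θ) * ℓ ^ (1 - θ))) ≤
      4 * s ^ b * (N * (2 / (1 - θ) * L ^ (1 - θ))) := by gcongr
  rw [t2, t4]
  refine (add_le_add (add_le_add (add_le_add t1 le_rfl) t5) t6).trans ?_
  have p1 : 0 ≤ N * (2 / (1 - a) * L ^ (1 - a)) := by positivity
  have p2 : 0 ≤ κ * L' := by positivity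
  have p3 : 0 ≤ 2 * (κ * L') * (N * (2 / (1 - b))) * L ^ (-b) := by positivity
  have p4 : 0 ≤ N * (2 / (1 - θ) * L ^ (1 - θ)) := by positivity
  rw [← mul_assoc (2 * (κ * L') * (N * (2 / (1 - b))))]
  generalize 2 * (κ * L') * (N * (2 / (1 - b))) * L ^ (-b) = d₃ at p3 ⊢
  generalize N * (2 / (1 - a) * L ^ (1 - a)) = d₁ at p1 ⊢
  generalize κ * L' = d₂ at p2 ⊢
  generalize N * (2 / (1 - θ) * L ^ (1 - θ)) = d₄ at p4 ⊢
  linarith [mul_nonneg p1 hmb.le, mul_nonneg p1 hsb, mul_nonneg p2 hmb.le, mul_nonneg p2 hsb,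
    mul_nonneg p3 hM, mul_nonneg p3 hsb, mul_nonneg p4 hM, mul_nonneg p4 hmb.le]

/-- At a level `k` whose towers are all higher than the number `s / c + 1` of passages up to time `s`,
the `L¹` norm of the ergodic integral is controlled by the means of the special Birkhoff sums, the
heights and `s`. The constant depends neither on `k` nor on `s`. -/
theorem exists_level_bound {T : IET 𝒜 d} (hT : T.Renormalizable) {n : ℕ → ℕ}
    (hn : IsAccelerating n) {κ : ℝ} (hκ : 1 ≤ κ)
    (hbal : ∀ k α, (T.acc n k).total / (T.acc n k).len α ≤ κ) {g : ℝ → ℝ≥0∞} (hg : Measurable g)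
    {c : ℝ} (hc0 : 0 < c) (hc : ∀ x, ENNReal.ofReal c ≤ g x) {a b Kg K Kψ : ℝ} (hb : 0 < b)
    (ha0 : 0 < a) (ha : a < 1) (hb1 : b < 1) (hKg : 1 ≤ Kg)
    (hgK : ∀ x, 0 < T.gap x → g x ≤ ENNReal.ofReal (Kg * T.gap x ^ (-a))) {f : ℝ × ℝ → ℝ}
    (hf : IntegrableOn f (T.suspension g)) (hK : 0 ≤ K) {φ ψ : ℝ → ℝ} (hφK : T.PowDeriv b K φ)
    (hφ : φ =ᵐ[volume.restrict T.base] roofIntegral g f) (hKψ : 0 ≤ Kψ)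
    (hψK : ∀ x, 0 < T.gap x → |ψ x| ≤ Kψ * T.gap x ^ (-b))
    (hψ : ψ =ᵐ[volume.restrict T.base] roofIntegral g (fun p => |f p|)) :
    ∃ C, 0 < C ∧ ∀ (k : ℕ) (s M Z : ℝ), 0 ≤ s → 0 ≤ Z →
      (∀ l ≤ k, ∀ α, |T.towerMean n φ l α| ≤ M) →
      (∀ l < k, matNorm (T.Q n l (l + 1)) ≤ Z) → (∀ α, s / c + 1 ≤ T.height n k α) →
      ∫⁻ p in T.suspension g, ‖∫ t in (0 : ℝ)..s, f (T.specialFlow g t p)‖ₑ ≤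
        ENNReal.ofReal (C * (k * Z + 1) * (M + matNorm (T.Q n 0 k) ^ b + s ^ b)) := by
  have hne := T.nonempty_alphabet
  have hL : 0 < T.total := total_pos hT.pos
  have h1a : 0 < 1 - a := by linarith
  have h1b : 0 < 1 - b := by linarith
  set θ := a * (1 - b) + b with hθ
  have h1θ : 0 < 1 - θ := by
    have : a * (1 - b) < 1 * (1 - b) := mul_lt_mul_of_pos_right ha h1b
    rw [hθ]; linarith
  set L := T.total with hLdef
  set C₀ := towerConst (Fintype.card 𝒜) b K * (1 + 2 / (1 - b)) with hC₀
  have hC₀0 : 0 ≤ C₀ := by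
    have := towerConst_nonneg (Fintype.card 𝒜) hb hK
    positivity
  set A₀ := 3 * (1 + C₀) + 2 * Kψ with hA₀
  set L' := L ^ (1 - a) / (1 - a) with hL'
  have hL'0 : 0 < L' := by positivity
  set D := Fintype.card 𝒜 * (2 / (1 - a) * L ^ (1 - a)) + κ * L' +
    2 * (κ * L') * (Fintype.card 𝒜 * (2 / (1 - b))) * L ^ (-b) +
    4 * (Fintype.card 𝒜 * (2 / (1 - θ) * L ^ (1 - θ))) with hD
  have hD0 : 0 < D := by positivity
  have hcard : 0 < (Fintype.card 𝒜 : ℝ) := by exact_mod_cast Fintype.card_pos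
  refine ⟨2 * (Fintype.card 𝒜 * 2 * Kg) * A₀ * D, by positivity, fun k s M Z hs hZ0 hM hZ hk => ?_⟩
  set S := T.acc n k with hSdef
  have hS : ∀ α, 0 < S.len α := (acc_renormalizable hT n k).pos
  have htow := isTower_acc_zero hT hn k
  rw [← hSdef] at htow
  have hℓ : 0 < S.total := total_pos hS
  have hM0 : 0 ≤ M := (abs_nonneg _).trans (hM 0 (Nat.zero_le _) (T.lastLetter 0))
  have hfin : ∀ᵐ x ∂volume.restrict T.base, g x ≠ ∞ := by
    filter_upwards [ae_gap_pos hT.pos] with x hx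
    exact ne_top_of_le_ne_top ENNReal.ofReal_ne_top (hgK x hx)
  let J : ℕ → ℝ → ℝ := fun N x => |birkhoffSum T.map (roofIntegral g f) N x| +
        roofIntegral g (fun p => |f p|) x + roofIntegral g (fun p => |f p|) (T.map^[N] x)
  let H : ℝ → ℝ≥0∞ := fun x =>
    ⨆ (N : ℕ) (_ : 1 ≤ N ∧ (N : ℝ) ≤ s / c + 1), ENNReal.ofReal (J N x)
  have hflow := lintegral_ergodic_integral_le hT.pos hg hc0 hc hfin hf hs (H := H)
    (Eventually.of_forall fun x N h1 h2 => le_iSup₂_of_le N ⟨h1, h2⟩ le_rfl)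
  set P := (k : ℝ) * Z + 1 with hP
  have hP1 : 1 ≤ P := by
    have : 0 ≤ (k : ℝ) * Z := by positivity
    linarith
  let V : ℝ → ℝ := fun y => P * A₀ * (M + (S.gap y ^ (-b) + S.gap (S.map y) ^ (-b)))
  have hae : ∀ᵐ x ∂volume.restrict T.base, ∀ i : ℕ,
      φ (T.map^[i] x) = roofIntegral g f (T.map^[i] x) ∧
      ψ (T.map^[i] x) = roofIntegral g (fun p => |f p|) (T.map^[i] x) := by
    refine ae_all_iff.2 fun i => ?_
    exact ((measurePreserving_map hT.pos).iterate i).quasiMeasurePreserving.ae (hφ.and hψ)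
  have hV : ∀ᵐ y ∂volume.restrict S.base, ∀ α, y ∈ S.piece α → ∀ j < rowSum (T.Q n 0 k) α,
      H (T.map^[j] y) ≤ ENNReal.ofReal (V y) := by
    filter_upwards [ae_gap_pos hS,
      (measurePreserving_map hS).quasiMeasurePreserving.ae (ae_gap_pos hS),
      ae_restrict_of_ae_restrict_of_subset htow.base_subset hae] with y hu hu' heq α hα j hj
    obtain ⟨α', hα'⟩ := exists_piece (map_mem_base hS (piece_subset_base hS α hα))
    refine iSup₂_le fun N hN => ENNReal.ofReal_le_ofReal ?_
    have hNle : ∀ β, N ≤ rowSum (T.Q n 0 k) β := fun β => by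
      have := hN.2.trans (hk β)
      exact_mod_cast this
    have hW := fun (j : ℕ) (hj : j ≤ rowSum (T.Q n 0 k) α) =>
      abs_birkhoffSum_le_of_acc hT hn hb hb1 hK hφK hM hZ hu hα le_rfl hj
    have hW' := fun (j : ℕ) (hj : j ≤ rowSum (T.Q n 0 k) α') =>
      abs_birkhoffSum_le_of_acc hT hn hb hb1 hK hφK hM hZ hu' hα' le_rfl hj
    obtain ⟨h1, h2⟩ := htow.abs_birkhoffSum_le_of_column hT.pos hS hα hα' hW hW' hj (hNle α')
    have hbs : birkhoffSum T.map (roofIntegral g f) N (T.map^[j] y) =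
        birkhoffSum T.map φ N (T.map^[j] y) := by
      refine Finset.sum_congr rfl fun i _ => ?_
      rw [← Function.iterate_add_apply]
      exact (heq (i + j)).1.symm
    have h3 : roofIntegral g (fun p => |f p|) (T.map^[j] y) ≤ Kψ * S.gap y ^ (-b) := by
      rw [← (heq j).2]
      have h4 := htow.gap_le hT.pos hS hα hj
      refine (le_abs_self _).trans ((hψK _ (hu.trans_le h4)).trans ?_)
      exact mul_le_mul_of_nonneg_left (Real.rpow_le_rpow_of_nonpos hu h4 (by linarith)) hKψ
    have h5 : roofIntegral g (fun p => |f p|) (T.map^[N] (T.map^[j] y)) ≤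
        Kψ * (S.gap y ^ (-b) + S.gap (S.map y) ^ (-b)) := by
      have hm : 0 < min (S.gap y) (S.gap (S.map y)) := lt_min hu hu'
      have h6 := hψK _ (hm.trans_le h2)
      rw [← Function.iterate_add_apply] at h2 h6 ⊢
      rw [← (heq (N + j)).2]
      refine (le_abs_self _).trans (h6.trans (mul_le_mul_of_nonneg_left ?_ hKψ))
      exact (Real.rpow_le_rpow_of_nonpos hm h2 (by linarith)).trans
        (min_rpow_neg_le_add hu.le hu'.le)
    have hub : 0 < S.gap y ^ (-b) := Real.rpow_pos_of_pos hu _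
    have hvb : 0 < S.gap (S.map y) ^ (-b) := Real.rpow_pos_of_pos hu' _
    simp only [J, V]
    rw [hbs]
    refine (add_le_add (add_le_add h1 h3) h5).trans ?_
    exact column_bound_le hP1 hC₀0 hKψ hM0 hub.le hvb.le
  set q := κ * L' / S.total with hq
  have hq' : ∀ α, L ^ (1 - a) / (1 - a) / S.len α ≤ q := by
    intro α
    rw [hq, div_le_div_iff₀ (hS α) hℓ]
    have := hbal k α
    rw [div_le_iff₀ (hS α)] at this
    calc L' * S.total ≤ L' * (κ * S.len α) := mul_le_mul_of_nonneg_left this hL'0.le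
      _ = κ * L' * S.len α := by ring
  have hmain := htow.lintegral_min_mul_le hT.pos hS hg ha0 ha hs hKg hgK hq' hV
  have hA0 : 0 ≤ A₀ := by positivity
  have hPA : 0 ≤ P * A₀ := by positivity
  have hVint : ∫⁻ y in S.base, ENNReal.ofReal ((min s (S.gap y ^ (-a)) + q) * V y) ≤
      ENNReal.ofReal (P * A₀) * ENNReal.ofReal (D * (M + matNorm (T.Q n 0 k) ^ b + s ^ b)) := by
    have e : ∀ y, ENNReal.ofReal ((min s (S.gap y ^ (-a)) + q) * V y) =
        ENNReal.ofReal (P * A₀) * ENNReal.ofReal ((min s (S.gap y ^ (-a)) + q) *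
          (M + (S.gap y ^ (-b) + S.gap (S.map y) ^ (-b)))) := by
      intro y
      rw [← ENNReal.ofReal_mul hPA]
      congr 1
      simp only [V]
      ring
    simp only [e]
    rw [lintegral_const_mul' _ _ ENNReal.ofReal_ne_top]
    refine mul_le_mul_right ((lintegral_weight_mul_bound_le hS ha0 ha hb hb1 hs hM0
      (by positivity)).trans (ENNReal.ofReal_le_ofReal ?_)) _
    exact level_integral_le hκ ha hb1 hb h1θ hcard.le hM0 hs hL hL'0 hℓ (acc_total_le hT hn k)
      (Nat.cast_nonneg _) (total_le_matNorm_mul hT hn k)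
  refine hflow.trans ?_
  have h2 : (2 : ℝ≥0∞) = ENNReal.ofReal 2 := by simp
  rw [h2, lintegral_const_mul' _ _ ENNReal.ofReal_ne_top]
  refine (mul_le_mul_right (hmain.trans (mul_le_mul_right hVint _)) _).trans ?_
  rw [← ENNReal.ofReal_mul hPA, ← ENNReal.ofReal_mul (by positivity),
    ← ENNReal.ofReal_mul (by norm_num)]
  refine ENNReal.ofReal_le_ofReal (le_of_eq ?_)
  ring

/-! ### The choice of the level -/

/-- By the Rokhlin towers condition and the balance of the lengths, all heights are comparable. -/
theorem matNorm_le_height {T : IET 𝒜 d} (hT : T.Renormalizable) {n : ℕ → ℕ}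
    (hn : IsAccelerating n) {κ δ : ℝ} (hκ : 1 ≤ κ) (hδ0 : 0 < δ) (hδ1 : δ < 1) (hR : T.RTC n δ)
    (hbal : ∀ k α, (T.acc n k).total / (T.acc n k).len α ≤ κ) (k : ℕ) (α : 𝒜) :
    matNorm (T.Q n 0 k) ≤ κ / δ * T.height n k α := by
  have hne := T.nonempty_alphabet
  have hκδ : 1 ≤ κ / δ := by rw [le_div_iff₀ hδ0]; linarith
  rcases Nat.eq_zero_or_pos k with rfl | hk
  · have h1 : (1 : ℝ) ≤ T.height n 0 α := by
      exact_mod_cast (isTower_acc_zero hT hn 0).height_pos α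
    rw [Q_zero_zero]
    refine matNorm_one.trans ?_
    nlinarith
  · refine matNorm_le fun β => ?_
    obtain ⟨p, -, hp, -, -, hpt⟩ := hR k hk
    have hS := (acc_renormalizable hT n k).pos
    have hℓ : 0 < (T.acc n k).total := total_pos hS
    have h1 := hbal k β
    rw [div_le_iff₀ (hS β)] at h1
    have h2 : (T.height n k β : ℝ) * (T.acc n k).len β ≤ T.total := by
      rw [← sum_height_mul_len hT hn k]
      exact Finset.single_le_sum (f := fun α => (T.height n k α : ℝ) * (T.acc n k).len α)
        (fun γ _ => mul_nonneg (Nat.cast_nonneg _) (hS γ).le) (Finset.mem_univ β)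
    have h3 : (p : ℝ) ≤ T.height n k α := by exact_mod_cast hp α
    have h4 : δ * ((T.height n k β : ℝ) * (T.acc n k).total) ≤
        κ * T.height n k α * (T.acc n k).total := by
      calc δ * ((T.height n k β : ℝ) * (T.acc n k).total)
          ≤ δ * ((T.height n k β : ℝ) * (κ * (T.acc n k).len β)) := by gcongr
        _ = κ * (δ * ((T.height n k β : ℝ) * (T.acc n k).len β)) := by ring
        _ ≤ κ * (δ * T.total) := by gcongr
        _ ≤ κ * (p * (T.acc n k).total) := by gcongr
        _ ≤ κ * (T.height n k α * (T.acc n k).total) := by gcongr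
        _ = _ := by ring
    rw [← mul_assoc] at h4
    have h5 := le_of_mul_le_mul_right h4 hℓ
    change (T.height n k β : ℝ) ≤ _
    rw [div_mul_eq_mul_div, le_div_iff₀ hδ0]
    linarith

/-- The first level at which all heights exceed `X`. -/
theorem exists_level {T : IET 𝒜 d} (hT : T.Renormalizable) {n : ℕ → ℕ}
    (hn : IsAccelerating n) {κ δ : ℝ} (hκ : 1 ≤ κ) (hδ0 : 0 < δ) (hδ1 : δ < 1) (hR : T.RTC n δ)
    (hbal : ∀ k α, (T.acc n k).total / (T.acc n k).len α ≤ κ) {c C l τ : ℝ} (hc : 0 < c)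
    (hl : 0 < l) (hτ : 0 < τ) (hC : 1 ≤ C)
    (hZ : ∀ k : ℕ, matNorm (T.Q n k (k + 1)) ≤ C * Real.exp (τ * k))
    (hQ : ∀ k : ℕ, c * Real.exp (l * k) ≤ matNorm (T.Q n 0 k)) :
    ∃ D, 1 ≤ D ∧ ∀ X : ℝ, 1 ≤ X → ∃ k : ℕ, (∀ α, X ≤ T.height n k α) ∧
      Real.exp (l * k) ≤ D * X ∧ matNorm (T.Q n 0 k) ≤ D * X * Real.exp (τ * k) := by
  classical
  have hne := T.nonempty_alphabet
  have hcmp := matNorm_le_height hT hn hκ hδ0 hδ1 hR hbal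
  set r := κ / δ
  have hr : 0 < r := by positivity
  refine ⟨1 + Real.exp l / c * r + C * r, by
    have : 0 ≤ Real.exp l / c * r + C * r := by positivity
    linarith, fun X hX => ?_⟩
  set D := 1 + Real.exp l / c * r + C * r
  have hD1 : 1 ≤ D := by
    have : 0 ≤ Real.exp l / c * r + C * r := by positivity
    linarith
  have hD2 : Real.exp l / c * r ≤ D := by
    have : 0 ≤ C * r := by positivity
    linarith
  have hD3 : C * r ≤ D := by
    have : 0 ≤ Real.exp l / c * r := by positivity
    linarith
  have hex : ∃ k : ℕ, ∀ α, X ≤ T.height n k α := by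
    obtain ⟨k, hk⟩ := exists_nat_gt (r * X / c / l)
    refine ⟨k, fun α => ?_⟩
    rw [div_lt_iff₀ hl, div_lt_iff₀ hc] at hk
    have h1 : r * X ≤ r * T.height n k α := by
      calc r * X ≤ k * l * c := hk.le
        _ ≤ c * Real.exp (l * k) := by
            have := Real.add_one_le_exp (l * k)
            nlinarith
        _ ≤ _ := (hQ k).trans (hcmp k α)
    exact le_of_mul_le_mul_left h1 hr
  refine ⟨Nat.find hex, Nat.find_spec hex, ?_⟩
  rcases Nat.eq_zero_or_pos (Nat.find hex) with h0 | h0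
  · rw [h0, Q_zero_zero]
    have hDX : 1 ≤ D * X := by nlinarith
    simp only [Nat.cast_zero, mul_zero, Real.exp_zero, mul_one]
    exact ⟨hDX, matNorm_one.trans hDX⟩
  · obtain ⟨k, hk⟩ := Nat.exists_eq_succ_of_ne_zero h0.ne'
    have hmin := Nat.find_min hex (show k < Nat.find hex by omega)
    push Not at hmin
    obtain ⟨α, hα⟩ := hmin
    have h1 : matNorm (T.Q n 0 k) ≤ r * X := (hcmp k α).trans (by gcongr)
    rw [hk, Nat.succ_eq_add_one]
    constructor
    · have e : Real.exp (l * ((k + 1 : ℕ) : ℝ)) = Real.exp l * Real.exp (l * k) := by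
        rw [← Real.exp_add]; congr 1; push_cast; ring
      have h2 : Real.exp (l * k) ≤ r * X / c := by
        rw [le_div_iff₀ hc]
        linarith [hQ k]
      rw [e]
      calc Real.exp l * Real.exp (l * k) ≤ Real.exp l * (r * X / c) := by gcongr
        _ = Real.exp l / c * r * X := by ring
        _ ≤ D * X := by gcongr
    · rw [Q_mul T hn (Nat.zero_le k) (Nat.le_succ k)]
      refine (matNorm_mul_le _ _).trans ?_
      have h3 : Real.exp (τ * k) ≤ Real.exp (τ * ((k + 1 : ℕ) : ℝ)) := by
        refine Real.exp_le_exp.2 ?_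
        push_cast
        nlinarith
      calc matNorm (T.Q n k (k + 1)) * matNorm (T.Q n 0 k)
          ≤ (C * Real.exp (τ * k)) * (r * X) :=
            mul_le_mul (hZ k) h1 (Nat.cast_nonneg _) (by positivity)
        _ = C * r * X * Real.exp (τ * k) := by ring
        _ ≤ D * X * Real.exp (τ * ((k + 1 : ℕ) : ℝ)) := by gcongr

end IET

namespace IET

variable {𝒜 : Type*} [Fintype 𝒜] [DecidableEq 𝒜] {d : ℕ}

/-! ### Growth in `s` -/

/-- The bound at the level `k` chosen for `s`, expressed through `Y`, which is comparable to `s`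
and to `exp (l k)`. -/
theorem level_bound_le_rpow {l τ b C M₀ k s Y m : ℝ} (hl : 0 < l) (hτ : 0 < τ) (hb : 0 < b)
    (hC : 1 ≤ C) (hM₀ : 0 ≤ M₀) (hk : 0 ≤ k) (hs : 0 ≤ s) (hsY : s ≤ Y) (hY : 1 ≤ Y)
    (hkY : Real.exp (l * k) ≤ Y) (hm0 : 0 ≤ m) (hm : m ≤ Y * Real.exp (τ * k)) :
    (k * (C * Real.exp (τ * k)) + 1) * (M₀ * Real.exp (b * l * (1 + τ) * k) + m ^ b + s ^ b) ≤
      (C / τ + 1) * (M₀ + 2) * Y ^ (2 * (τ / l) + b * (1 + τ + τ / l)) := by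
  have hY0 : 0 < Y := by linarith
  set σ := τ / l with hσ
  have hσ0 : 0 < σ := by positivity
  have hexp : ∀ r, 0 ≤ r → Real.exp (r * k) ≤ Y ^ (r / l) := by
    intro r hr
    calc Real.exp (r * k) = Real.exp (l * k) ^ (r / l) := by
          rw [← Real.exp_mul]; congr 1; field_simp
      _ ≤ Y ^ (r / l) := Real.rpow_le_rpow (Real.exp_pos _).le hkY (by positivity)
  have hE : Real.exp (τ * k) ≤ Y ^ σ := hexp τ hτ.le
  have hE1 : 1 ≤ Real.exp (τ * k) := Real.one_le_exp (by positivity)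
  have hkE : k ≤ Real.exp (τ * k) / τ := by
    rw [le_div_iff₀ hτ]
    linarith [Real.add_one_le_exp (τ * k)]
  have h1 : k * (C * Real.exp (τ * k)) + 1 ≤ (C / τ + 1) * Y ^ (2 * σ) := by
    have e2 : Real.exp (τ * k) * Real.exp (τ * k) ≤ Y ^ (2 * σ) := by
      rw [two_mul, Real.rpow_add hY0]
      gcongr
    calc k * (C * Real.exp (τ * k)) + 1
        ≤ Real.exp (τ * k) / τ * (C * Real.exp (τ * k)) + Real.exp (τ * k) * Real.exp (τ * k) := by
          gcongr
          nlinarith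
      _ = (C / τ + 1) * (Real.exp (τ * k) * Real.exp (τ * k)) := by field_simp
      _ ≤ _ := by gcongr
  set p := b * (1 + τ + σ) with hp
  have h2 : M₀ * Real.exp (b * l * (1 + τ) * k) ≤ M₀ * Y ^ p := by
    refine mul_le_mul_of_nonneg_left ((hexp _ (by positivity)).trans ?_) hM₀
    refine Real.rpow_le_rpow_of_exponent_le hY ?_
    have : b * l * (1 + τ) / l = b * (1 + τ) := by field_simp
    rw [this, hp]
    nlinarith
  have h3 : m ^ b ≤ Y ^ p := by
    calc m ^ b ≤ (Y * Y ^ σ) ^ b := by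
          refine Real.rpow_le_rpow hm0 (hm.trans ?_) hb.le
          gcongr
      _ = Y ^ ((1 + σ) * b) := by
          rw [Real.rpow_mul hY0.le, Real.rpow_add hY0, Real.rpow_one]
      _ ≤ Y ^ p := by
          refine Real.rpow_le_rpow_of_exponent_le hY ?_
          rw [hp]
          nlinarith
  have h4 : s ^ b ≤ Y ^ p := by
    refine (Real.rpow_le_rpow hs hsY hb.le).trans (Real.rpow_le_rpow_of_exponent_le hY ?_)
    rw [hp]
    nlinarith [mul_pos hb hτ, mul_pos hb hσ0]
  rw [Real.rpow_add hY0]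
  have hm' : 0 ≤ m ^ b := Real.rpow_nonneg hm0 _
  have hs' : 0 ≤ s ^ b := Real.rpow_nonneg hs _
  have hYp : 0 ≤ Y ^ p := by positivity
  calc (k * (C * Real.exp (τ * k)) + 1) * (M₀ * Real.exp (b * l * (1 + τ) * k) + m ^ b + s ^ b)
      ≤ ((C / τ + 1) * Y ^ (2 * σ)) * (M₀ * Y ^ p + Y ^ p + Y ^ p) := by
        gcongr
    _ = (C / τ + 1) * (M₀ + 2) * (Y ^ (2 * σ) * Y ^ p) := by ring

/-! ### Reduction to a measurable roof function -/

theorem suspension_congr {T : IET 𝒜 d} {g g' : ℝ → ℝ≥0∞} (h : EqOn g g' T.base) :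
    T.suspension g = T.suspension g' := by
  ext p
  refine and_congr_right fun hp => and_congr_right fun _ => ?_
  rw [h hp]

theorem specialFlow_congr {T : IET 𝒜 d} (hT : ∀ α, 0 < T.len α) {g g' : ℝ → ℝ≥0∞}
    (h : EqOn g g' T.base) (t : ℝ) {p : ℝ × ℝ} (hp : p.1 ∈ T.base) :
    T.specialFlow g t p = T.specialFlow g' t p := by
  have hb : ∀ N, birkhoffSum T.map g N p.1 = birkhoffSum T.map g' N p.1 := fun N =>
    Finset.sum_congr rfl fun i _ => h (iterate_mem_base hT hp i)
  simp only [specialFlow, hb]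

theorem roofIntegral_congr {g g' : ℝ → ℝ≥0∞} (f : ℝ × ℝ → ℝ) {x : ℝ} (h : g x = g' x) :
    roofIntegral g f x = roofIntegral g' f x := by
  rw [roofIntegral, roofIntegral, h]

/-- A roof function that is continuous inside the exchanged intervals, extended by `∞` outside of
the base, is measurable. -/
theorem measurable_piecewise_roof [NeZero d] {T : IET 𝒜 d} (hT : ∀ α, 0 < T.len α) {g : ℝ → ℝ≥0∞} {a : ℝ}
    (hg : T.IsRoofPaG a g) [DecidablePred (· ∈ T.base)] :
    Measurable (T.base.piecewise g fun _ => ∞) := by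
  classical
  obtain ⟨Cp, Cm, hP, -, -⟩ := hg.memPaG
  have hcont : ∀ α, ContinuousOn g (Ioo (T.left α) (T.right α)) := by
    intro α
    have h1 := ENNReal.continuous_ofReal.comp_continuousOn (hP.contDiffOn α).continuousOn
    exact h1.congr fun x hx => (ENNReal.ofReal_toReal (hg.finite α x hx)).symm
  have hU : MeasurableSet (⋃ α, Ioo (T.left α) (T.right α)) :=
    MeasurableSet.iUnion fun α => measurableSet_Ioo
  have hgU : ContinuousOn g (⋃ α, Ioo (T.left α) (T.right α)) :=
    fun x hx => by
      obtain ⟨α, hα⟩ := mem_iUnion.1 hx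
      exact ((hcont α).continuousAt (isOpen_Ioo.mem_nhds hα)).continuousWithinAt
  have h2 : Measurable ((⋃ α, Ioo (T.left α) (T.right α)).piecewise g fun _ => ∞) :=
    hgU.measurable_piecewise continuousOn_const hU
  refine h2.measurable_of_countable_ne ((finite_range T.left).countable.mono fun x hx => ?_)
  by_contra hr
  refine hx ?_
  by_cases hb : x ∈ T.base
  · obtain ⟨α, hα⟩ := exists_piece hb
    have hα' : x ∈ Ioo (T.left α) (T.right α) :=
      ⟨lt_of_le_of_ne hα.1 fun e => hr ⟨α, e⟩, hα.2⟩
    rw [piecewise_eq_of_mem _ _ _ hb, piecewise_eq_of_mem _ _ _ (mem_iUnion.2 ⟨α, hα'⟩)]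
  · rw [piecewise_eq_of_notMem _ _ _ hb, piecewise_eq_of_notMem]
    intro h
    obtain ⟨α, hα⟩ := mem_iUnion.1 h
    exact hb (piece_subset_base hT α ⟨hα.1.le, hα.2⟩)

theorem MemPhat.abs_le {T : IET 𝒜 d} (hT : ∀ α, 0 < T.len α) {b : ℝ} {ψ : ℝ → ℝ}
    (h : T.MemPhat b ψ) : ∃ K, 0 ≤ K ∧ ∀ x, 0 < T.gap x → |ψ x| ≤ K * T.gap x ^ (-b) := by
  obtain ⟨-, K, hK⟩ := h
  refine ⟨max K 0, le_max_right _ _, fun z hz => ?_⟩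
  obtain ⟨α, hα⟩ := exists_of_gap_pos hT hz
  rw [gap_of_mem hT ⟨hα.1.le, hα.2⟩]
  have key : ∀ y : ℝ, 0 < y → |ψ z * y ^ b| ≤ K → |ψ z| ≤ max K 0 * y ^ (-b) := by
    intro y hy hle
    have hp : 0 < y ^ b := Real.rpow_pos_of_pos hy _
    rw [abs_mul, abs_of_pos hp] at hle
    rw [Real.rpow_neg hy.le, ← div_eq_mul_inv, le_div_iff₀ hp]
    exact hle.trans (le_max_left _ _)
  rcases le_total z (T.mid α) with hm | hm
  · have e : min (z - T.left α) (T.right α - z) = z - T.left α :=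
      min_eq_left (by unfold mid at hm; linarith)
    rw [e]
    exact key _ (by linarith [hα.1]) ((hK α).1 z ⟨hα.1, hm⟩)
  · have e : min (z - T.left α) (T.right α - z) = T.right α - z :=
      min_eq_right (by unfold mid at hm; linarith)
    rw [e]
    exact key _ (by linarith [hα.2]) ((hK α).2 z ⟨hm, hα.2⟩)

theorem PowDeriv.abs_le {T : IET 𝒜 d} (hT : ∀ α, 0 < T.len α) [Nonempty 𝒜] {a K : ℝ}
    (ha : 0 < a) (hK : 0 ≤ K) {φ : ℝ → ℝ} (h : T.PowDeriv a K φ) :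
    ∃ C, 1 ≤ C ∧ ∀ x, 0 < T.gap x → |φ x| ≤ C * T.gap x ^ (-a) := by
  have hL := total_pos hT
  set m := ∑ α, |φ (T.mid α)| with hm
  have hm0 : 0 ≤ m := Finset.sum_nonneg fun α _ => abs_nonneg _
  refine ⟨K / a + m * T.total ^ a + 1, by
    have : 0 ≤ K / a + m * T.total ^ a := by positivity
    linarith, fun x hx => ?_⟩
  obtain ⟨α, hα⟩ := exists_of_gap_pos hT hx
  have hpiece : ∀ y ∈ Ioo (T.left α) (T.right α), y ∈ T.piece α := fun y hy => ⟨hy.1.le, hy.2⟩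
  have h1 := abs_sub_mid_le ha (fun y hy => (h y (gap_pos hT hy)).1) (C := K) (fun y hy => by
    have := (h y (gap_pos hT hy)).2
    rwa [gap_of_mem hT (hpiece y hy)] at this) hα
  rw [← gap_of_mem hT (hpiece x hα)] at h1
  have h2 : |φ (T.mid α)| ≤ m :=
    Finset.single_le_sum (f := fun α => |φ (T.mid α)|) (fun _ _ => abs_nonneg _)
      (Finset.mem_univ α)
  have h3 : 1 ≤ T.total ^ a * T.gap x ^ (-a) := by
    have hle : T.gap x ≤ T.total := (gap_le_len hT (hpiece x hα)).trans
      (Finset.single_le_sum (f := T.len) (fun β _ => (hT β).le) (Finset.mem_univ α))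
    rw [Real.rpow_neg hx.le, ← div_eq_mul_inv, one_le_div (Real.rpow_pos_of_pos hx _)]
    exact Real.rpow_le_rpow hx.le hle ha.le
  have h4 : 0 < T.gap x ^ (-a) := Real.rpow_pos_of_pos hx _
  have h5 : |φ x| ≤ |φ x - φ (T.mid α)| + |φ (T.mid α)| := by
    have := abs_add_le (φ x - φ (T.mid α)) (φ (T.mid α))
    rwa [sub_add_cancel] at this
  have h6 : m * 1 ≤ m * (T.total ^ a * T.gap x ^ (-a)) := mul_le_mul_of_nonneg_left h3 hm0
  change |φ x - φ (T.mid α)| ≤ _ at h1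
  linarith

variable [NeZero d]

theorem towerMean_eq_meanProj {T : IET 𝒜 d} (hT : T.Renormalizable) {n : ℕ → ℕ}
    (hn : IsAccelerating n) {φ ρ : ℝ → ℝ} (h : φ =ᵐ[volume.restrict T.base] ρ) (k : ℕ) (α : 𝒜) :
    T.towerMean n φ k α = (T.acc n k).meanProj (T.specialSum n k ρ) α := by
  have hS := (acc_renormalizable hT n k).pos
  have hae : ∀ᵐ x ∂volume.restrict T.base, ∀ i : ℕ, φ (T.map^[i] x) = ρ (T.map^[i] x) :=
    ae_all_iff.2 fun i =>
      ((measurePreserving_map hT.pos).iterate i).quasiMeasurePreserving.ae h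
  rw [towerMean, meanProj]
  congr 1
  refine integral_congr_ae ?_
  filter_upwards [ae_restrict_of_ae_restrict_of_subset ((piece_subset_base hS α).trans
    (isTower_acc_zero hT hn k).base_subset) hae,
    ae_restrict_mem ((T.acc n k).measurableSet_piece α)] with x hx hxα
  rw [specialSum, Finset.sum_eq_single α, indicator_of_mem hxα]
  · exact Finset.sum_congr rfl fun i _ => hx i
  · intro β _ hβ
    exact indicator_of_notMem (fun hβ' => hβ (piece_unique hS hβ' hxα)) _
  · simp

/-- The `L¹` bound for ergodic integrals, along one acceleration with a small parameter. -/
theorem exists_lintegral_le_rpow {T : IET 𝒜 d} {γ : ℕ} {lam : ℕ → ℝ} {E : ℤ → Submodule ℝ (𝒜 → ℝ)}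
    (hT : T.Renormalizable) (hl : 0 < lam 1) {τ : ℝ} (hτ : 0 < τ) {n : ℕ → ℕ}
    (hacc : T.IsFDCAcceleration γ lam E τ n) {g : ℝ → ℝ≥0∞} (hg : Measurable g)
    {c : ℝ} (hc0 : 0 < c) (hc : ∀ x, ENNReal.ofReal c ≤ g x) {a b Kg K Kψ : ℝ} (hb : 0 < b)
    (ha0 : 0 < a) (ha : a < 1) (hb1 : b < 1) (hKg : 1 ≤ Kg)
    (hgK : ∀ x, 0 < T.gap x → g x ≤ ENNReal.ofReal (Kg * T.gap x ^ (-a))) {f : ℝ × ℝ → ℝ}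
    (hf : IntegrableOn f (T.suspension g)) (hK : 0 ≤ K) {φ ψ : ℝ → ℝ} (hφK : T.PowDeriv b K φ)
    (hφ : φ =ᵐ[volume.restrict T.base] roofIntegral g f) (hKψ : 0 ≤ Kψ)
    (hψK : ∀ x, 0 < T.gap x → |ψ x| ≤ Kψ * T.gap x ^ (-b))
    (hψ : ψ =ᵐ[volume.restrict T.base] roofIntegral g (fun p => |f p|))
    (hM : (fun k : ℕ => vecNorm ((T.acc n k).meanProj (T.specialSum n k (roofIntegral g f))))
      =O[atTop] fun k : ℕ => Real.exp (b * lam 1 * (1 + τ) * k)) :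
    ∃ C, ∀ s : ℝ, 1 ≤ s →
      ∫⁻ p in T.suspension g, ‖∫ t in (0 : ℝ)..s, f (T.specialFlow g t p)‖ₑ ≤
        ENNReal.ofReal (C * s ^ (2 * (τ / lam 1) + b * (1 + τ + τ / lam 1))) := by
  obtain ⟨hn, ⟨δ, hδ0, hδ1, hR⟩, c₀, Cz, κ, r, U, hc₀, hCz, hκ, -, -, hest⟩ := hacc
  obtain ⟨C₁, hC₁, hlevel⟩ := exists_level_bound hT hn hκ hest.balanced hg hc0 hc hb ha0 ha hb1
    hKg hgK hf hK hφK hφ hKψ hψK hψ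
  obtain ⟨D, hD, hchoose⟩ := exists_level hT hn hκ hδ0 hδ1 hR hest.balanced hc₀ hl hτ hCz
    hest.Z_bound hest.Q_lower
  obtain ⟨M₁, hM₁⟩ := (Asymptotics.isBigO_nat_atTop_iff fun k h =>
    absurd h (Real.exp_pos _).ne').1 hM
  set M₀ := max M₁ 0
  have hM₀ : 0 ≤ M₀ := le_max_right _ _
  have hmean : ∀ k α, |T.towerMean n φ k α| ≤ M₀ * Real.exp (b * lam 1 * (1 + τ) * k) := by
    intro k α
    rw [towerMean_eq_meanProj hT hn hφ]
    have h1 : |(T.acc n k).meanProj (T.specialSum n k (roofIntegral g f)) α| ≤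
        vecNorm ((T.acc n k).meanProj (T.specialSum n k (roofIntegral g f))) :=
      Finset.single_le_sum (f := fun α =>
        |(T.acc n k).meanProj (T.specialSum n k (roofIntegral g f)) α|)
        (fun _ _ => abs_nonneg _) (Finset.mem_univ α)
    have h2 := hM₁ k
    rw [Real.norm_eq_abs, Real.norm_eq_abs, abs_of_pos (Real.exp_pos _)] at h2
    exact h1.trans ((le_abs_self _).trans (h2.trans
      (mul_le_mul_of_nonneg_right (le_max_left _ _) (Real.exp_pos _).le)))
  set e := 2 * (τ / lam 1) + b * (1 + τ + τ / lam 1)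
  have he : 0 ≤ e := by positivity
  refine ⟨C₁ * ((Cz / τ + 1) * (M₀ + 2)) * (D * (1 / c + 1)) ^ e, fun s hs => ?_⟩
  have hsc : 0 ≤ s / c := by positivity
  obtain ⟨k, hk1, hk2, hk3⟩ := hchoose (s / c + 1) (by linarith)
  set Y := D * (1 / c + 1) * s with hY
  have hXY : D * (s / c + 1) ≤ Y := by
    have : s / c + 1 ≤ (1 / c + 1) * s := by
      rw [add_mul, one_mul, div_mul_eq_mul_div, one_mul]; linarith
    rw [hY, mul_assoc]
    gcongr
  have hsY : s ≤ Y := by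
    have h1 : s ≤ (1 / c + 1) * s := by
      have : 0 ≤ 1 / c * s := by positivity
      linarith
    have h2 : 0 ≤ (1 / c + 1) * s := by linarith
    rw [hY, mul_assoc]
    exact h1.trans (le_mul_of_one_le_left h2 hD)
  have hbound := hlevel k s (M₀ * Real.exp (b * lam 1 * (1 + τ) * k)) (Cz * Real.exp (τ * k))
    (by linarith) (by positivity) (fun l hlk α => (hmean l α).trans (by gcongr))
    (fun l hlk => (hest.Z_bound l).trans (by gcongr)) hk1
  refine hbound.trans (ENNReal.ofReal_le_ofReal ?_)
  have := level_bound_le_rpow (l := lam 1) (τ := τ) (b := b) (C := Cz) (M₀ := M₀) (k := k) (s := s)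
    (Y := Y) (m := matNorm (T.Q n 0 k)) hl hτ hb hCz hM₀ (Nat.cast_nonneg k) (by linarith) hsY
    (hs.trans hsY) (hk2.trans hXY) (Nat.cast_nonneg _) (hk3.trans (by gcongr))
  calc C₁ * (k * (Cz * Real.exp (τ * k)) + 1) *
        (M₀ * Real.exp (b * lam 1 * (1 + τ) * k) + matNorm (T.Q n 0 k) ^ b + s ^ b)
      ≤ C₁ * ((Cz / τ + 1) * (M₀ + 2) * Y ^ e) := by
        rw [mul_assoc]
        exact mul_le_mul_of_nonneg_left this hC₁.le
    _ = _ := by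
        rw [hY, Real.mul_rpow (by positivity) (by linarith)]
        ring

end IET

theorem theorem7p6 {𝒜 : Type*} [Fintype 𝒜] [DecidableEq 𝒜] {d : ℕ} [NeZero d]
    (T : IET 𝒜 d) (γ : ℕ) (lam : ℕ → ℝ) (m : ℕ → ℕ) (E : ℤ → Submodule ℝ (𝒜 → ℝ))
    (hT : T.SatisfiesFDC γ lam m E)
    (a b : ℝ) (hb : 0 < b) (hba : b ≤ a) (ha : a < 1)
    (g : ℝ → ℝ≥0∞) (hg : T.IsRoofPaG a g)
    (f : ℝ × ℝ → ℝ) (hf : IntegrableOn f (T.suspension g))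
    (hφ : ∃ φ : ℝ → ℝ, T.MemPaG b φ ∧ φ =ᵐ[volume.restrict T.base] roofIntegral g f)
    (hψ : ∃ ψ : ℝ → ℝ, T.MemPhat b ψ ∧
      ψ =ᵐ[volume.restrict T.base] roofIntegral g (fun p => |f p|))
    (hM : ∀ τ : ℝ, 0 < τ → ∃ n : ℕ → ℕ, T.IsFDCAcceleration γ lam E τ n ∧
      (fun k : ℕ => IET.vecNorm
          ((T.acc n k).meanProj (T.specialSum n k (roofIntegral g f))))
        =O[atTop] fun k : ℕ => Real.exp (b * lam 1 * (1 + τ) * k)) :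
    (∀ s : ℝ, 0 ≤ s →
      (∀ᵐ p ∂(volume.restrict (T.suspension g)),
        IntervalIntegrable (fun t => f (T.specialFlow g t p)) volume 0 s) ∧
      IntegrableOn (fun p => ∫ t in (0 : ℝ)..s, f (T.specialFlow g t p)) (T.suspension g)) ∧
    ∀ τ : ℝ, 0 < τ →
      (fun s : ℝ => ∫ p in T.suspension g, |∫ t in (0 : ℝ)..s, f (T.specialFlow g t p)|)
        =O[atTop] fun s : ℝ => s ^ ((1 + τ) * b) := by
  classical
  have hpos := hT.isIET.len_pos
  have hne := T.nonempty_alphabet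
  have hren : T.Renormalizable := by
    obtain ⟨n, hn, ⟨δ, hδ0, -, hR⟩, -⟩ := hT.exists_acc 1 one_pos
    exact ⟨hpos, hT.keane, IET.two_le_of_RTC hpos hn hδ0 hR⟩
  have hl : 0 < lam 1 := by
    have h1 := hT.generic.one_le
    have := hT.generic.lam_anti (show 1 ∈ Icc 1 (γ + 1) from ⟨le_rfl, by omega⟩)
      (show γ + 1 ∈ Icc 1 (γ + 1) from ⟨by omega, le_rfl⟩) (by omega)
    rwa [hT.generic.lam_last] at this
  -- outside of the base the roof function is irrelevant, so it may be replaced by `∞` there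
  set g' : ℝ → ℝ≥0∞ := T.base.piecewise g fun _ => ∞ with hg'
  have heq : EqOn g g' T.base := fun x hx => (piecewise_eq_of_mem _ _ _ hx).symm
  have hgm : Measurable g' := IET.measurable_piecewise_roof hpos hg
  have hsus : T.suspension g = T.suspension g' := IET.suspension_congr heq
  have hflow : ∀ t, ∀ p ∈ T.suspension g, T.specialFlow g t p = T.specialFlow g' t p :=
    fun t p hp => IET.specialFlow_congr hpos heq t hp.1
  have hms : MeasurableSet (T.suspension g) := by
    rw [hsus]; exact T.measurableSet_suspension hgm
  obtain ⟨c, hc0, hc⟩ : ∃ c : ℝ, 0 < c ∧ ∀ x, ENNReal.ofReal c ≤ g' x := by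
    obtain ⟨c, hc0, hc⟩ := hg.lower
    have hfin : min c 1 ≠ ∞ := ne_top_of_le_ne_top ENNReal.one_ne_top (min_le_right _ _)
    refine ⟨(min c 1).toReal, ENNReal.toReal_pos (lt_min hc0 one_pos).ne' hfin, fun x => ?_⟩
    rw [ENNReal.ofReal_toReal hfin]
    by_cases hx : x ∈ T.base
    · rw [← heq hx]; exact (min_le_left _ _).trans (hc x hx)
    · rw [hg', piecewise_eq_of_notMem _ _ _ hx]; exact le_top
  have hf' : IntegrableOn f (T.suspension g') := hsus ▸ hf
  have hroof : ∀ h : ℝ × ℝ → ℝ, roofIntegral g h =ᵐ[volume.restrict T.base] roofIntegral g' h :=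
    fun h => (ae_restrict_iff' T.measurableSet_base).2
      (Eventually.of_forall fun x hx => IET.roofIntegral_congr h (heq hx))
  have hprod := IET.integrable_comp_specialFlow hpos hgm hc0 hc hf'
  have hint : ∀ s : ℝ, 0 ≤ s →
      IntegrableOn (fun p => ∫ t in (0 : ℝ)..s, f (T.specialFlow g t p)) (T.suspension g) := by
    intro s hs
    have h1 := (hprod s).integral_prod_right
    rw [← hsus] at h1
    refine IntegrableOn.congr_fun h1 (fun p hp => ?_) hms
    simp only [intervalIntegral.integral_of_le hs, hflow _ p hp]
  refine ⟨fun s hs => ⟨?_, hint s hs⟩, fun τ hτ => ?_⟩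
  · have h1 := (hprod s).prod_left_ae
    rw [← hsus] at h1
    filter_upwards [h1, ae_restrict_mem hms] with p hp hps
    rw [intervalIntegrable_iff_integrableOn_Ioc_of_le hs]
    simp only [hflow _ p hps]
    exact hp
  · obtain ⟨φ, ⟨Cp, Cm, hφP, -, -⟩, hφe⟩ := hφ
    obtain ⟨ψ, hψP, hψe⟩ := hψ
    obtain ⟨K, hK, hφK⟩ := hφP.powDeriv hpos
    obtain ⟨Kψ, hKψ, hψK⟩ := hψP.abs_le hpos
    obtain ⟨Cp', Cm', hgP, -, -⟩ := hg.memPaG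
    obtain ⟨K', hK', hgK'⟩ := hgP.powDeriv hpos
    have ha0 : 0 < a := hb.trans_le hba
    obtain ⟨Kg, hKg, hgK⟩ := hgK'.abs_le hpos ha0 hK'
    have hgK2 : ∀ x, 0 < T.gap x → g' x ≤ ENNReal.ofReal (Kg * T.gap x ^ (-a)) := by
      intro x hx
      obtain ⟨α, hα⟩ := IET.exists_of_gap_pos hpos hx
      rw [← heq (IET.piece_subset_base hpos α ⟨hα.1.le, hα.2⟩),
        ← ENNReal.ofReal_toReal (hg.finite α x hα)]
      exact ENNReal.ofReal_le_ofReal ((le_abs_self _).trans (hgK x hx))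
    -- the parameter for which the accumulated losses amount to the factor `1 + τ`
    set τ' := τ * b / (2 / lam 1 + b * (1 + 1 / lam 1)) with hτ'
    have hden : 0 < 2 / lam 1 + b * (1 + 1 / lam 1) := by positivity
    have hτ'0 : 0 < τ' := by positivity
    obtain ⟨n, hacc, hO⟩ := hM τ' hτ'0
    have hO' : (fun k : ℕ => IET.vecNorm
        ((T.acc n k).meanProj (T.specialSum n k (roofIntegral g' f))))
          =O[atTop] fun k : ℕ => Real.exp (b * lam 1 * (1 + τ') * k) := by
      have e : ∀ k, (T.acc n k).meanProj (T.specialSum n k (roofIntegral g' f)) =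
          (T.acc n k).meanProj (T.specialSum n k (roofIntegral g f)) := fun k => funext fun α => by
        rw [← IET.towerMean_eq_meanProj hren hacc.1 (hφe.trans (hroof f)),
          ← IET.towerMean_eq_meanProj hren hacc.1 hφe]
      simpa only [e] using hO
    obtain ⟨C, hC⟩ := IET.exists_lintegral_le_rpow hren hl hτ'0 hacc hgm hc0 hc hb ha0 ha
      (hba.trans_lt ha) hKg hgK2 hf' hK hφK (hφe.trans (hroof f)) hKψ hψK
      (hψe.trans (hroof fun p => |f p|)) hO'
    have hexp : 2 * (τ' / lam 1) + b * (1 + τ' + τ' / lam 1) = (1 + τ) * b := by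
      have : τ' * (2 / lam 1 + b * (1 + 1 / lam 1)) = τ * b := by
        rw [hτ', div_mul_cancel₀ _ hden.ne']
      linear_combination this
    rw [hexp] at hC
    refine Asymptotics.IsBigO.of_bound (max C 0) ?_
    filter_upwards [eventually_ge_atTop (1 : ℝ)] with s hs
    have hs0 : 0 ≤ s := by linarith
    have hsp : 0 ≤ s ^ ((1 + τ) * b) := Real.rpow_nonneg hs0 _
    rw [Real.norm_eq_abs, abs_of_nonneg (integral_nonneg fun p => abs_nonneg _), Real.norm_eq_abs,
      abs_of_nonneg hsp]
    have h1 : ∫⁻ p in T.suspension g, ‖∫ t in (0 : ℝ)..s, f (T.specialFlow g t p)‖ₑ ≤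
        ENNReal.ofReal (max C 0 * s ^ ((1 + τ) * b)) := by
      have h2 : ∫⁻ p in T.suspension g, ‖∫ t in (0 : ℝ)..s, f (T.specialFlow g t p)‖ₑ =
          ∫⁻ p in T.suspension g, ‖∫ t in (0 : ℝ)..s, f (T.specialFlow g' t p)‖ₑ :=
        setLIntegral_congr_fun hms fun p hp => by simp only [hflow _ p hp]
      rw [h2, hsus]
      refine (hC s hs).trans (ENNReal.ofReal_le_ofReal ?_)
      exact mul_le_mul_of_nonneg_right (le_max_left _ _) hsp
    have h3 := ofReal_integral_norm_eq_lintegral_enorm (hint s hs0)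
    rw [← h3] at h1
    exact (ENNReal.ofReal_le_ofReal_iff (by positivity)).1 h1
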